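/- **Theorem (Mean curvature of coassociatives).** Let $\phi_0 = e^{123} + e^1\wedge(e^{45}+e^{67}) + e^2\wedge(e^{46}-e^{57}) + e^3\wedge(-e^{47}-e^{56})$ on $\mathbb{R}^7$. A $\mathrm{G}_2$-structure on a smooth $7$-manifold $M$ is a smooth $3$-form $\varphi$ such that at each $x$ some linear isomorphism $u\colon T_xM\to\mathbb{R}^7$ satisfies $\varphi_x=u^*\phi_0$; it induces a Riemannian metric and an orientation (those making every such $u$ an oriented isometry), with Hodge star $\ast$. Its *torsion forms* $\tau_0\in\Lambda^0$, $\tau_1\in\Lambda^1$, $\tau_2\in\Lambda^2_{14}=\{\beta : \ast(\varphi\wedge\beta)=-\beta\}$, $\tau_3\in\Lambda^3_{27}=\{\gamma : \gamma\wedge\varphi=0,\ \gamma\wedge\ast\varphi=0\}$ are the forms, which exist and are unique, with $$d\varphi=\tau_0\ast\varphi+3\tau_1\wedge\varphi+\ast\tau_3,\qquad d{\ast}\varphi=4\tau_1\wedge\ast\varphi+\tau_2\wedge\varphi .$$ For $E\subseteq\{W_1,W_7,W_{14},W_{27}\}$, $\varphi$ belongs to the torsion class $\bigoplus_{W\in E}W$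 if $\tau_0$, $\tau_1$, $\tau_2$, $\tau_3$ vanishes whenever $W_1$, $W_7$, $W_{14}$, $W_{27}$, respectively, is not in $E$. A *coassociative $4$-fold* is an immersed $4$-dimensional submanifold $\Sigma$ of $M$ with $\varphi|_{T_p\Sigma}=0$ for all $p$. At $p\in\Sigma$ put $\mathsf{C}^\sharp=T_p\Sigma$, $\mathsf{A}^\sharp=(T_p\Sigma)^\perp$, and let $T_p^*M=\mathsf{A}\oplus\mathsf{C}$ be the dual splitting. Let $\Lambda^2_\pm(\mathsf{C})$ be the (anti-)self-dual forms of $\mathsf{C}$ for the orientation given by $\ast\varphi$. Then $$\Lambda^2_{14}=\bigl[\Lambda^2_{14}\cap(\Lambda^2(\mathsf{A})\oplus\Lambda^2_+(\mathsf{C}))\bigr]\oplus\bigl[\Lambda^2_{14}\cap(\mathsf{A}\otimes\mathsf{C})\bigr]\oplus\bigl[\Lambda^2_{14}\cap\Lambda^2_-(\mathsf{C})\bigr];$$ write $(\Lambda^2_{14})_{\mathsf A}$ for the first summand, $(\tau_2)_{\mathsf{A}}$ for the component of $\tau_2$ in it, and $(\tau_1)_{\mathsf{A}}$ for the $\mathsf{A}$-component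 of $\tau_1$. For $\alpha\in\mathsf{A}$ let $W(\alpha)=2L_{\mathsf{A}}(\alpha)-L_{\mathsf{C}}(\alpha)$, where $L_{\mathsf{A}}(\alpha)$, $L_{\mathsf{C}}(\alpha)$ are the components of $\iota_{\alpha^\sharp}\varphi$ in $\Lambda^2(\mathsf{A})$, $\Lambda^2(\mathsf{C})$; $W\colon\mathsf{A}\to(\Lambda^2_{14})_{\mathsf{A}}$ is an isomorphism, and $\beta^\natural:=\sqrt6\,(W^{-1}\beta)^\sharp$. 1. The mean curvature vector $H$ of a coassociative $4$-fold (the trace of its second fundamental form) is $$H=-4\,[(\tau_1)_{\mathsf{A}}]^\sharp+\tfrac{\sqrt6}{3}\,[(\tau_2)_{\mathsf{A}}]^\natural .$$ 2. The largest torsion class $E$ such that, for every $7$-manifold with a $\mathrm{G}_2$-structure of class $E$, every coassociative $4$-fold is minimal, is $W_1\oplus W_{27}$; and a $\mathrm{G}_2$-structure belongs to $W_1\oplus W_{27}$ if and only if $d{\ast}\varphi=0$. -/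

import Mathlib

open scoped Manifold ContDiff

noncomputable section

namespace G2Geom

/-! ### Exterior algebra on a real vector space -/

/-- Alternating `k`-forms on `V`. -/
abbrev Form (V : Type*) [AddCommGroup V] [Module ℝ V] (k : ℕ) := V [⋀^Fin k]→ₗ[ℝ] ℝ

section LinearAlgebra

variable {V : Type*} [AddCommGroup V] [Module ℝ V]

/-- The exterior product
`(α ∧ β)(v₁, …) = ∑ sign(σ) α(v_σ(1), …, v_σ(k)) β(v_σ(k+1), …)`, summed over `(k, l)`-shuffles. -/
def wedge {k l : ℕ} (α : Form V k) (β : Form V l) : Form V (k + l) :=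
  ((LinearMap.mul' ℝ ℝ).compAlternatingMap (α.domCoprod β)).domDomCongr finSumFinEquiv

/-- The form `e^I = e^{I 0} ∧ … ∧ e^{I (k-1)}` for a basis `e` with dual basis `e^i`, written as
a determinant. -/
def coordForm {n k : ℕ} (e : Module.Basis (Fin n) ℝ V) (I : Fin k → Fin n) : Form V k :=
  (Matrix.detRowAlternating (n := Fin k) (R := ℝ)).compLinearMap
    (LinearMap.pi fun a => e.coord (I a))

theorem append_update_right {X : Type*} {k m : ℕ} (w : Fin k → X) (v : Fin m → X)
    (i : Fin m) (z : X) :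
    Fin.append w (Function.update v i z)
      = Function.update (Fin.append w v) (Fin.natAdd k i) z := by
  funext j
  refine Fin.addCases (fun a => ?_) (fun b => ?_) j
  · rw [Fin.append_left, Function.update_of_ne, Fin.append_left]
    intro h
    simp [Fin.ext_iff] at h
    omega
  · by_cases hb : b = i
    · subst hb; simp
    · rw [Fin.append_right, Function.update_of_ne hb, Function.update_of_ne, Fin.append_right]
      simpa using hb

/-- The form obtained by inserting the vectors `w` into the first `k` slots of `a`. -/
def insertVectors {k m : ℕ} (a : Form V (k + m)) (w : Fin k → V) : Form V m where
  toFun v := a (Fin.append w v)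
  map_update_add' {inst} v i x y := by
    obtain rfl : inst = instDecidableEqFin m := Subsingleton.elim _ _
    simp only [append_update_right]
    exact a.map_update_add _ _ _ _
  map_update_smul' {inst} v i c x := by
    obtain rfl : inst = instDecidableEqFin m := Subsingleton.elim _ _
    simp only [append_update_right]
    exact a.map_update_smul _ _ _ _
  map_eq_zero_of_eq' v i j hv hij := by
    refine a.map_eq_zero_of_eq _ (i := Fin.natAdd k i) (j := Fin.natAdd k j) ?_ ?_
    · simpa using hv
    · simpa using hij

/-- The Hodge star for the inner product and the orientation that make the basis `e` oriented
orthonormal: `(∗α)(w) = ∑_I α(e_I) vol(e_I, w)`, the sum being over increasing multi-indices.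
Equivalently, `∗ e^I = ± e^J` with `e^I ∧ (∗ e^I) = e^{1⋯n}`. -/
def hodgeOfBasis {n : ℕ} (e : Module.Basis (Fin n) ℝ V) (k m : ℕ) (h : k + m = n)
    (α : Form V k) : Form V m :=
  open Classical in
  ∑ I : Fin k → Fin n with StrictMono I,
    α (fun a => e (I a)) • insertVectors (e.det.domDomCongr (finCongr h.symm)) (fun a => e (I a))

/-! ### G₂-structures on a vector space -/

/-- The associative form
`e¹²³ + e¹ ∧ (e⁴⁵ + e⁶⁷) + e² ∧ (e⁴⁶ - e⁵⁷) + e³ ∧ (- e⁴⁷ - e⁵⁶)` (indices shifted by one). -/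
def assocForm (e : Module.Basis (Fin 7) ℝ V) : Form V 3 :=
  coordForm e ![0, 1, 2] + coordForm e ![0, 3, 4] + coordForm e ![0, 5, 6]
    + coordForm e ![1, 3, 5] - coordForm e ![1, 4, 6]
    - coordForm e ![2, 3, 6] - coordForm e ![2, 4, 5]

/-- `φ` lies in the orbit `Λ³₊` of the associative form: some frame identifies `φ` with it. -/
def IsG2Form (φ : Form V 3) : Prop := ∃ e : Module.Basis (Fin 7) ℝ V, φ = assocForm e

/-- A frame in which `φ` is the standard associative form. Two such frames differ by an element of
`G₂ ⊂ SO(7)`, so that the metric and the Hodge star below depend on `φ` only. -/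
def IsG2Form.frame {φ : Form V 3} (h : IsG2Form φ) : Module.Basis (Fin 7) ℝ V := h.choose

/-- The inner product `∑ eⁱ ⊗ eⁱ` induced by `φ`. -/
def IsG2Form.metric {φ : Form V 3} (h : IsG2Form φ) : LinearMap.BilinForm ℝ V :=
  ∑ i, (h.frame.coord i).smulRight (h.frame.coord i)

/-- The Hodge star for the metric and the orientation induced by `φ`. -/
def IsG2Form.star {φ : Form V 3} (h : IsG2Form φ) (k m : ℕ) (hkm : k + m = 7) :
    Form V k → Form V m :=
  hodgeOfBasis h.frame k m hkm

/-- The coassociative form `∗φ`. -/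
def IsG2Form.coassocForm {φ : Form V 3} (h : IsG2Form φ) : Form V 4 := h.star 3 4 rfl φ

/-- The index-raising isomorphism `♯`, expressed in an orthonormal frame. -/
def IsG2Form.sharp {φ : Form V 3} (h : IsG2Form φ) (α : Form V 1) : V :=
  ∑ i, α ![h.frame i] • h.frame i

theorem IsG2Form.metric_apply {φ : Form V 3} (h : IsG2Form φ) (x y : V) :
    h.metric x y = ∑ i, h.frame.coord i x * h.frame.coord i y := by
  simp [IsG2Form.metric]

theorem IsG2Form.metric_symm {φ : Form V 3} (h : IsG2Form φ) (x y : V) :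
    h.metric x y = h.metric y x := by
  simp only [h.metric_apply, mul_comm]

theorem IsG2Form.eq_zero_of_metric_self {φ : Form V 3} (h : IsG2Form φ) (x : V)
    (hx : h.metric x x = 0) : x = 0 := by
  rw [h.metric_apply, Finset.sum_eq_zero_iff_of_nonneg fun i _ => mul_self_nonneg _] at hx
  refine h.frame.ext_elem fun i => ?_
  simpa using hx i (Finset.mem_univ i)

/-- The orthogonal complement `C^⊥` of a subspace. -/
def IsG2Form.perp {φ : Form V 3} (h : IsG2Form φ) (C : Submodule ℝ V) : Submodule ℝ V :=
  h.metric.orthogonal C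

theorem IsG2Form.isCompl_perp {φ : Form V 3} (h : IsG2Form φ) (C : Submodule ℝ V) :
    IsCompl (h.perp C) C := by
  have : FiniteDimensional ℝ V := Module.Finite.of_basis h.frame
  have hs : LinearMap.IsRefl h.metric := fun x y hxy => by rw [h.metric_symm]; exact hxy
  refine (LinearMap.BilinForm.isCompl_orthogonal_of_restrict_nondegenerate hs ?_).symm
  refine ⟨fun x hx => ?_, fun x hx => ?_⟩ <;>
  · have := hx x
    exact Subtype.ext (h.eq_zero_of_metric_self x this)

/-- The orthogonal projection onto `C^⊥`. -/
def IsG2Form.perpProj {φ : Form V 3} (h : IsG2Form φ) (C : Submodule ℝ V) : V →ₗ[ℝ] V :=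
  (h.perp C).projection C (h.isCompl_perp C)

/-- The orthogonal projection onto `C`. -/
def IsG2Form.tanProj {φ : Form V 3} (h : IsG2Form φ) (C : Submodule ℝ V) : V →ₗ[ℝ] V :=
  C.projection (h.perp C) (h.isCompl_perp C).symm

/-- A coassociative `4`-plane: a `4`-dimensional subspace on which `φ` vanishes. -/
def IsCoassociative (φ : Form V 3) (C : Submodule ℝ V) : Prop :=
  Module.finrank ℝ C = 4 ∧ ∀ u ∈ C, ∀ v ∈ C, ∀ w ∈ C, φ ![u, v, w] = 0

/-! ### The splitting of `1`- and `2`-forms along a coassociative `4`-plane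

Throughout, `C` stands for the coassociative plane `C^♯` and `A = C^⊥` for the associative plane. -/

/-- The summand `Λ²₁₄ = {β | ∗(φ ∧ β) = -β}`. -/
def IsG2Form.Lam14 {φ : Form V 3} (h : IsG2Form φ) : Set (Form V 2) :=
  {β | h.star 5 2 rfl (wedge φ β) = -β}

/-- `A ⊂ V*`: the covectors that vanish on `C`. -/
def formsA (C : Submodule ℝ V) : Set (Form V 1) := {α | ∀ v ∈ C, α ![v] = 0}

/-- `Λ²(A)`. -/
def lam2A (C : Submodule ℝ V) : Set (Form V 2) := {β | ∀ v ∈ C, ∀ w, β ![v, w] = 0}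

/-- `Λ²(C)`. -/
def IsG2Form.lam2C {φ : Form V 3} (h : IsG2Form φ) (C : Submodule ℝ V) : Set (Form V 2) :=
  {β | ∀ v ∈ h.perp C, ∀ w, β ![v, w] = 0}

/-- `A ⊗ C`, as a subspace of `Λ²(V*)`. -/
def IsG2Form.lamAC {φ : Form V 3} (h : IsG2Form φ) (C : Submodule ℝ V) : Set (Form V 2) :=
  {β | (∀ v ∈ C, ∀ w ∈ C, β ![v, w] = 0) ∧ ∀ v ∈ h.perp C, ∀ w ∈ h.perp C, β ![v, w] = 0}

/-- The Hodge star of `C` (oriented by `∗φ`) on `Λ²(C)`: `∗_C β = ∗(vol_A ∧ β)`, where the volume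
form `vol_A` of the associative plane is the restriction of `φ` to it. -/
def IsG2Form.starC {φ : Form V 3} (h : IsG2Form φ) (C : Submodule ℝ V) (β : Form V 2) :
    Form V 2 :=
  h.star 5 2 rfl (wedge (φ.compLinearMap (h.perpProj C)) β)

/-- `Λ²₊(C)`, the self-dual forms. -/
def IsG2Form.lam2Plus {φ : Form V 3} (h : IsG2Form φ) (C : Submodule ℝ V) : Set (Form V 2) :=
  {β | β ∈ h.lam2C C ∧ h.starC C β = β}

/-- `Λ²₋(C)`, the anti-self-dual forms. -/
def IsG2Form.lam2Minus {φ : Form V 3} (h : IsG2Form φ) (C : Submodule ℝ V) : Set (Form V 2) :=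
  {β | β ∈ h.lam2C C ∧ h.starC C β = -β}

/-- `(Λ²₁₄)_A = Λ²₁₄ ∩ (Λ²(A) ⊕ Λ²₊(C))`. -/
def IsG2Form.lam14A {φ : Form V 3} (h : IsG2Form φ) (C : Submodule ℝ V) : Set (Form V 2) :=
  {β | β ∈ h.Lam14 ∧ ∃ a ∈ lam2A C, ∃ c ∈ h.lam2Plus C, β = a + c}

/-- `(Λ²₁₄)₁,₃ = Λ²₁₄ ∩ (A ⊗ C)`. -/
def IsG2Form.lam14AC {φ : Form V 3} (h : IsG2Form φ) (C : Submodule ℝ V) : Set (Form V 2) :=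
  h.Lam14 ∩ h.lamAC C

/-- `(Λ²₁₄)₂,₀ = Λ²₁₄ ∩ Λ²₋(C)`. -/
def IsG2Form.lam14C {φ : Form V 3} (h : IsG2Form φ) (C : Submodule ℝ V) : Set (Form V 2) :=
  h.Lam14 ∩ h.lam2Minus C

/-- The component `α_A` of a `1`-form in `V* = A ⊕ C`. -/
def IsG2Form.oneA {φ : Form V 3} (h : IsG2Form φ) (C : Submodule ℝ V) (α : Form V 1) : Form V 1 :=
  α.compLinearMap (h.perpProj C)

/-- The component `β_A` of `β ∈ Λ²₁₄` in `Λ²₁₄ = (Λ²₁₄)_A ⊕ (Λ²₁₄)₁,₃ ⊕ (Λ²₁₄)₂,₀`. -/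
def IsG2Form.twoA {φ : Form V 3} (h : IsG2Form φ) (C : Submodule ℝ V) (β : Form V 2) : Form V 2 :=
  Classical.epsilon fun b =>
    b ∈ h.lam14A C ∧ ∃ b' ∈ h.lam14AC C, ∃ b'' ∈ h.lam14C C, β = b + b' + b''

/-- `W(α) = 2 L_A(α) - L_C(α)`, where `L_A(α)` and `L_C(α)` are the components of
`L(α) = ι_{α^♯} φ` in `Λ²(A)` and `Λ²(C)`. -/
def IsG2Form.mapW {φ : Form V 3} (h : IsG2Form φ) (C : Submodule ℝ V) (α : Form V 1) : Form V 2 :=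
  (2 : ℝ) • (φ.curryLeft (h.sharp α)).compLinearMap (h.perpProj C)
    - (φ.curryLeft (h.sharp α)).compLinearMap (h.tanProj C)

/-- The isometry `β ↦ β^♮ = √6 (W⁻¹ β)^♯` from `(Λ²₁₄)_A` to `A^♯`, where `W : A → (Λ²₁₄)_A`. -/
def IsG2Form.natural {φ : Form V 3} (h : IsG2Form φ) (C : Submodule ℝ V) (β : Form V 2) : V :=
  √6 • h.sharp (Classical.epsilon fun α => α ∈ formsA C ∧ h.mapW C α = β)

end LinearAlgebra

/-! ### Differential forms on a `7`-manifold -/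

/-- The Euclidean space `ℝⁿ`. -/
abbrev Euc (n : ℕ) := EuclideanSpace ℝ (Fin n)

/-- An alternating form on `ℝⁿ` as a continuous alternating form. -/
def toCont {n k : ℕ} (a : Form (Euc n) k) : Euc n [⋀^Fin k]→L[ℝ] ℝ where
  toMultilinearMap := a.toMultilinearMap
  map_eq_zero_of_eq' := a.map_eq_zero_of_eq'
  cont := by
    let b := (EuclideanSpace.basisFun (Fin n) ℝ).toBasis
    have hE : ∀ v : Fin k → Euc n, a.toFun v =
        ∑ r : Fin k → Fin n, (∏ i, v i (r i)) * a (fun i => b (r i)) := by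
      intro v
      have hv : v = fun i => ∑ j, v i j • b j := by
        funext i
        conv_lhs => rw [← b.sum_repr (v i)]
        simp [b]
      change a v = _
      conv_lhs => rw [hv]
      change a.toMultilinearMap _ = _
      rw [MultilinearMap.map_sum]
      refine Finset.sum_congr rfl fun r _ => ?_
      rw [MultilinearMap.map_smul_univ]
      rfl
    change Continuous a.toFun
    rw [show a.toFun = _ from funext hE]
    fun_prop

section Manifold

variable {M : Type*} [TopologicalSpace M] [ChartedSpace (Euc 7) M]

/-- A (not necessarily continuous) field of `k`-forms on a `7`-manifold. -/
abbrev FormField (M : Type*) [TopologicalSpace M] [ChartedSpace (Euc 7) M] (k : ℕ) :=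
  ∀ x : M, Form (TangentSpace (𝓡 7) x) k

/-- The derivative at `y` of the inverse of the preferred chart at `x₀`, i.e. the frame of
coordinate vector fields of that chart. -/
def chartFrame (x₀ : M) (y : Euc 7) :
    Euc 7 →ₗ[ℝ] TangentSpace (𝓡 7) ((extChartAt (𝓡 7) x₀).symm y) :=
  ((mfderiv 𝓘(ℝ, Euc 7) (𝓡 7) (extChartAt (𝓡 7) x₀).symm y).comp
    (NormedSpace.fromTangentSpace (𝕜 := ℝ) y).symm.toContinuousLinearMap).toLinearMap

/-- The derivative at `x` of the preferred chart at `x`, i.e. the components of tangent vectors. -/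
def chartCoframe (x : M) : TangentSpace (𝓡 7) x →ₗ[ℝ] Euc 7 :=
  ((NormedSpace.fromTangentSpace (𝕜 := ℝ) (extChartAt (𝓡 7) x x)).toContinuousLinearMap.comp
    (mfderiv (𝓡 7) 𝓘(ℝ, Euc 7) (extChartAt (𝓡 7) x) x)).toLinearMap

/-- The inverse of `chartCoframe x`: the tangent vector at `x` with given components. -/
def coordVec (x : M) : Euc 7 →ₗ[ℝ] TangentSpace (𝓡 7) x :=
  ((mfderiv (𝓡 7) 𝓘(ℝ, Euc 7) (extChartAt (𝓡 7) x) x).inverse.comp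
    (NormedSpace.fromTangentSpace (𝕜 := ℝ) (extChartAt (𝓡 7) x x)).symm.toContinuousLinearMap
    ).toLinearMap

/-- The coordinate representation of a field of forms in the preferred chart at `x₀`. -/
def chartForm {k : ℕ} (a : FormField M k) (x₀ : M) (y : Euc 7) : Euc 7 [⋀^Fin k]→L[ℝ] ℝ :=
  toCont ((a ((extChartAt (𝓡 7) x₀).symm y)).compLinearMap (chartFrame x₀ y))

/-- A field of forms is smooth when its coordinate representations are. -/
def IsSmoothForm {k : ℕ} (a : FormField M k) : Prop :=
  ∀ x₀ : M, ContDiffOn ℝ ∞ (chartForm a x₀) (extChartAt (𝓡 7) x₀).target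

/-- The exterior derivative, computed at `x` in the preferred chart at `x`. -/
def extD {k : ℕ} (a : FormField M k) : FormField M (k + 1) := fun x =>
  (extDeriv (chartForm a x) (extChartAt (𝓡 7) x x)).toAlternatingMap.compLinearMap (chartCoframe x)

/-- A `G₂`-structure on `M`: a smooth `3`-form lying pointwise in `Λ³₊`. -/
structure G2Structure (M : Type*) [TopologicalSpace M] [ChartedSpace (Euc 7) M] where
  form : FormField M 3
  smooth : IsSmoothForm form
  isG2 : ∀ x, IsG2Form (form x)

/-- The `4`-form `∗φ`. -/
def G2Structure.coassoc (φ : G2Structure M) : FormField M 4 := fun x => (φ.isG2 x).coassocForm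

/-! ### Torsion forms and torsion classes -/

/-- Values `(τ₀, τ₁, τ₂, τ₃)` of torsion forms at a point. -/
structure TorsionForms (V : Type*) [AddCommGroup V] [Module ℝ V] where
  τ₀ : ℝ
  τ₁ : Form V 1
  τ₂ : Form V 2
  τ₃ : Form V 3

/-- `τ` are the torsion forms of `φ`:
`dφ = τ₀ ∗φ + 3 τ₁ ∧ φ + ∗τ₃` and `d∗φ = 4 τ₁ ∧ ∗φ + τ₂ ∧ φ` with `τ₂ ∈ Λ²₁₄` and `τ₃ ∈ Λ³₂₇`. -/
structure G2Structure.IsTorsion (φ : G2Structure M)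
    (τ : ∀ x : M, TorsionForms (TangentSpace (𝓡 7) x)) : Prop where
  d_form : ∀ x, extD φ.form x =
    (τ x).τ₀ • φ.coassoc x + (3 : ℝ) • (wedge (τ x).τ₁ (φ.form x) : Form _ 4)
      + (φ.isG2 x).star 3 4 rfl (τ x).τ₃
  d_coassoc : ∀ x, extD φ.coassoc x =
    (4 : ℝ) • (wedge (τ x).τ₁ (φ.coassoc x) : Form _ 5) + wedge (τ x).τ₂ (φ.form x)
  mem_two : ∀ x, (τ x).τ₂ ∈ (φ.isG2 x).Lam14
  mem_three : ∀ x, wedge (τ x).τ₃ (φ.form x) = 0 ∧ wedge (τ x).τ₃ (φ.coassoc x) = 0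

/-- The irreducible torsion modules. -/
inductive TorsionModule
  | W1
  | W7
  | W14
  | W27

open TorsionModule in
/-- `φ` belongs to the torsion class `⨁_{W ∈ S} W`, i.e. its torsion forms are valued in it. -/
def G2Structure.HasTorsionClass (φ : G2Structure M) (S : Set TorsionModule) : Prop :=
  ∃ τ : ∀ x : M, TorsionForms (TangentSpace (𝓡 7) x), φ.IsTorsion τ ∧ ∀ x,
    (W1 ∉ S → (τ x).τ₀ = 0) ∧ (W7 ∉ S → (τ x).τ₁ = 0) ∧
    (W14 ∉ S → (τ x).τ₂ = 0) ∧ (W27 ∉ S → (τ x).τ₃ = 0)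

/-! ### Coassociative immersions and their mean curvature -/

namespace G2Structure

variable (φ : G2Structure M)

/-- The coefficients `g_ij` of the metric in the preferred chart at `x₀`. -/
def gram (x₀ : M) (y : Euc 7) : Matrix (Fin 7) (Fin 7) ℝ := fun i j =>
  (φ.isG2 ((extChartAt (𝓡 7) x₀).symm y)).metric
    (chartFrame x₀ y (EuclideanSpace.single i 1)) (chartFrame x₀ y (EuclideanSpace.single j 1))

/-- The partial derivative `∂_l g_ij`. -/
def dGram (x₀ : M) (y : Euc 7) (l i j : Fin 7) : ℝ :=
  fderiv ℝ (fun z => φ.gram x₀ z i j) y (EuclideanSpace.single l 1)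

/-- The Christoffel symbols `Γ^k_ij` of the Levi-Civita connection. -/
def christoffel (x₀ : M) (y : Euc 7) (k i j : Fin 7) : ℝ :=
  (1 / 2) * ∑ l, (φ.gram x₀ y)⁻¹ k l *
    (φ.dGram x₀ y i j l + φ.dGram x₀ y j i l - φ.dGram x₀ y l i j)

variable {S : Type*} [TopologicalSpace S] [ChartedSpace (Euc 4) S]

/-- The tangent plane `df(T_p S) ⊂ T_{f p} M`. -/
def tangentPlane (f : S → M) (p : S) : Submodule ℝ (TangentSpace (𝓡 7) (f p)) :=
  LinearMap.range (mfderiv (𝓡 4) (𝓡 7) f p).toLinearMap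

/-- `f : S → M` is an immersed coassociative `4`-fold. -/
structure IsCoassociativeImmersion (f : S → M) : Prop where
  smooth : ContMDiff (𝓡 4) (𝓡 7) ∞ f
  injective : ∀ p, Function.Injective (mfderiv (𝓡 4) (𝓡 7) f p)
  coassociative : ∀ p, IsCoassociative (φ.form (f p)) (tangentPlane f p)

/-- The partial derivative `∂_a F` at `u` of the coordinate representation `F` of `f` near `p`. -/
def partialRep (f : S → M) (p : S) (u : Euc 4) (a : Fin 4) : Euc 7 :=
  fderiv ℝ (writtenInExtChartAt (𝓡 4) (𝓡 7) p f) u (EuclideanSpace.single a 1)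

/-- The vector `∇_{∂_a} (df ∂_b)` in `T_{f p} M`, where `∇` is the Levi-Civita connection; its
components are `∂_a ∂_b F^k + Γ^k_ij ∂_a F^i ∂_b F^j`. -/
def covHessian (f : S → M) (p : S) (a b : Fin 4) : TangentSpace (𝓡 7) (f p) :=
  coordVec (f p) <| WithLp.toLp 2 fun k =>
    fderiv ℝ (fun u => partialRep f p u b) (extChartAt (𝓡 4) p p) (EuclideanSpace.single a 1) k
      + ∑ i, ∑ j, φ.christoffel (f p) (extChartAt (𝓡 7) (f p) (f p)) k i j
        * partialRep f p (extChartAt (𝓡 4) p p) a i * partialRep f p (extChartAt (𝓡 4) p p) b j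

/-- The induced metric `h_ab = g(df ∂_a, df ∂_b)` at `p`. -/
def inducedMetric (f : S → M) (p : S) : Matrix (Fin 4) (Fin 4) ℝ := fun a b =>
  (φ.isG2 (f p)).metric (coordVec (f p) (partialRep f p (extChartAt (𝓡 4) p p) a))
    (coordVec (f p) (partialRep f p (extChartAt (𝓡 4) p p) b))

/-- The mean curvature vector `H = h^ab (∇_{∂_a} (df ∂_b))^⊥`, the trace of the second fundamental
form (not divided by the dimension). -/
def meanCurvature (f : S → M) (p : S) : TangentSpace (𝓡 7) (f p) :=
  ∑ a, ∑ b, (φ.inducedMetric f p)⁻¹ a b •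
    (φ.isG2 (f p)).perpProj (tangentPlane f p) (φ.covHessian f p a b)

/-- Every coassociative `4`-fold in `(M, φ)` is minimal. -/
def CoassociativesMinimal : Prop :=
  ∀ (S : Type) [TopologicalSpace S] [ChartedSpace (Euc 4) S] [IsManifold (𝓡 4) ∞ S]
    [T2Space S] [SecondCountableTopology S] (f : S → M),
    φ.IsCoassociativeImmersion f → ∀ p, φ.meanCurvature f p = 0

end G2Structure
end Manifold
end G2Geom
end

noncomputable section

namespace G2Geom

/-! ### Exterior algebra: products of covectors and contraction. -/

section ExteriorAlgebra

variable {V : Type*} {N : ℕ} [AddCommGroup V] [Module ℝ V]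

/-! A `G₂`-form may be studied in any frame that identifies it with the standard form. Bryant's
identity `(ι_u φ)² ∧ φ = 6 |u|² vol` (`curry_sq_wedge_assocForm`) shows that `φ` determines its
metric and volume form, hence its Hodge star (`hodgeOfBasis_eq`), so the frame chosen in the
definitions is harmless. Along a coassociative plane the frame can be taken with `e₃, …, e₆` tangent
(`exists_adapted_frame`; indices start at zero throughout).

The geometric reason for the formula is that `∗φ` is a calibrating form: it is bounded by volume on
`4`-planes, with equality on coassociative ones. The first variations of volume and of the integral
of `∗φ` therefore agree on a coassociative `4`-fold, which gives `-⟨H, v⟩ = d∗φ(v, e₃, e₄, e₅, e₆)`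
for normal `v`. The proof establishes this identity pointwise, without integrals. By the inverse
function theorem (`exists_pullback_eq`), near a point `x` the form `φ` is the pullback of its value
at `x` by a differentiable field `L` of endomorphisms with `L(x) = 1`. Then `dφ`, `d∗φ` and the
Christoffel symbols at `x` are all linear in the derivative of `L`, and differentiating `F^*φ = 0`
along the immersion constrains the second derivatives of `F`. What remains is a linear identity,
`sum_secondFundamentalForm_eq`, which yields `meanCurvature_eq_extD`.

The torsion equations turn `d∗φ(e₀, e₃, e₄, e₅, e₆)` into `4 τ₁(e₀) - τ₂(e₁, e₂)`, and similarly for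
`e₁`, `e₂` (`IsTorsionAt.apply_normal`). An element of `(Λ²₁₄)_A` is known from its part in `Λ²(A)`,
so these numbers are the components of the stated right-hand side (`sharp_add_natural`). Existence
and uniqueness of the torsion forms is linear algebra, apart from the fact that `dφ` and `d∗φ`
produce the same `τ₁`; this is again an identity in the derivative of `L`
(`contrAssoc_eq_contrCoassoc`).

Since `d∗φ = 0` exactly when `τ₁ = τ₂ = 0`, the class `W₁ ⊕ W₂₇` forces minimality. For sharpness
take on `ℝ⁷` the coframe `exp(wᵢ x₀) dxᵢ`. The planes spanned by the last four coordinates are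
coassociative, with the `e₀`-component of `H` a nonzero multiple of `w₃ + w₄ + w₅ + w₆`. The weights
`(1, …, 1)` give class `W₇` and `(0, -2, -2, 1, 1, 1, 1)` class `W₁₄`, so neither module can be
admitted. -/

theorem sum_form_apply {ι : Type*} {k : ℕ} (s : Finset ι) (f : ι → Form V k) (v : Fin k → V) :
    (∑ i ∈ s, f i) v = ∑ i ∈ s, f i v :=
  map_sum ({ toFun := fun a => a v, map_zero' := rfl, map_add' := fun _ _ => rfl } :
    Form V k →+ ℝ) f s

/-- The exterior product of `1`-forms, written as a determinant. -/
def detForm {k : ℕ} (θ : Fin k → V →ₗ[ℝ] ℝ) : Form V k :=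
  (Matrix.detRowAlternating (n := Fin k) (R := ℝ)).compLinearMap (LinearMap.pi θ)

theorem coordForm_eq_detForm {n k : ℕ} (e : Module.Basis (Fin n) ℝ V) (I : Fin k → Fin n) :
    coordForm e I = detForm fun a => e.coord (I a) := rfl

theorem detForm_apply {k : ℕ} (θ : Fin k → V →ₗ[ℝ] ℝ) (v : Fin k → V) :
    detForm θ v = Matrix.det (Matrix.of fun b a => θ a (v b)) := rfl

/-- Leibniz's formula for the determinant; this is the form in which products of covectors meet the
definition of `wedge`. -/
theorem detForm_eq_alternatization {k : ℕ} (θ : Fin k → V →ₗ[ℝ] ℝ) :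
    detForm θ = MultilinearMap.alternatization
      ((MultilinearMap.mkPiAlgebra ℝ (Fin k) ℝ).compLinearMap θ) := by
  ext v
  rw [detForm_apply, Matrix.det_apply, MultilinearMap.alternatization_apply]
  refine Finset.sum_congr rfl fun σ _ => ?_
  simp

/-- Alternating two factors separately and then forming shuffles is the same as alternating the
tensor product, so both sides are one signed sum over the permutations of `k + l` slots. -/
theorem wedge_detForm {k l : ℕ} (θ : Fin k → V →ₗ[ℝ] ℝ) (η : Fin l → V →ₗ[ℝ] ℝ) :
    wedge (detForm θ) (detForm η) = detForm (Fin.append θ η) := by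
  ext v
  rw [detForm_apply, Matrix.det_apply, wedge, detForm_eq_alternatization,
    detForm_eq_alternatization, ← MultilinearMap.domCoprod_alternization]
  simp only [AlternatingMap.domDomCongr_apply, LinearMap.compAlternatingMap_apply,
    MultilinearMap.alternatization_apply, map_sum]
  refine Fintype.sum_equiv finSumFinEquiv.permCongr _ _ fun σ => ?_
  rw [Equiv.Perm.sign_permCongr, Fin.prod_univ_add]
  simp only [Function.comp_def, Units.smul_def,
    MultilinearMap.domDomCongr_apply, MultilinearMap.domCoprod_apply,
    MultilinearMap.compLinearMap_apply, MultilinearMap.mkPiAlgebra_apply, map_zsmul,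
    LinearMap.mul'_apply]
  simp

theorem wedge_add_left {k l : ℕ} (α α' : Form V k) (β : Form V l) :
    wedge (α + α') β = wedge α β + wedge α' β := by
  simp only [wedge, ← AlternatingMap.domCoprod'_apply, TensorProduct.add_tmul, map_add]
  ext; simp

theorem wedge_smul_left {k l : ℕ} (c : ℝ) (α : Form V k) (β : Form V l) :
    wedge (c • α) β = c • wedge α β := by
  simp only [wedge, ← AlternatingMap.domCoprod'_apply, ← TensorProduct.smul_tmul', map_smul]
  ext; simp

theorem wedge_add_right {k l : ℕ} (α : Form V k) (β β' : Form V l) :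
    wedge α (β + β') = wedge α β + wedge α β' := by
  simp only [wedge, ← AlternatingMap.domCoprod'_apply, TensorProduct.tmul_add, map_add]
  ext; simp

theorem wedge_smul_right {k l : ℕ} (c : ℝ) (α : Form V k) (β : Form V l) :
    wedge α (c • β) = c • wedge α β := by
  simp only [wedge, ← AlternatingMap.domCoprod'_apply, TensorProduct.tmul_smul, map_smul]
  ext; simp

/-- The exterior product as a bilinear map. -/
def wedgeL (V : Type*) [AddCommGroup V] [Module ℝ V] (k l : ℕ) :
    Form V k →ₗ[ℝ] Form V l →ₗ[ℝ] Form V (k + l) :=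
  LinearMap.mk₂ ℝ wedge wedge_add_left wedge_smul_left wedge_add_right wedge_smul_right

/-- As a tensor, `α` is the sum of its values times products of dual covectors. Alternating the
expansion turns the products into determinants, and multiplies `α`, which is already alternating, by
`k!`. -/
theorem sum_smul_detForm {n k : ℕ} (e : Module.Basis (Fin n) ℝ V) (α : Form V k) :
    ∑ I : Fin k → Fin n, α (fun a => e (I a)) • detForm (fun a => e.coord (I a))
      = (k.factorial : ℝ) • α := by
  have h : (α : MultilinearMap ℝ (fun _ : Fin k => V) ℝ) = ∑ I : Fin k → Fin n,
      α (fun a => e (I a)) •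
        (MultilinearMap.mkPiAlgebra ℝ (Fin k) ℝ).compLinearMap (fun a => e.coord (I a)) := by
    refine Module.Basis.ext_multilinear (fun _ => e) fun J => ?_
    rw [_root_.sum_apply, Finset.sum_eq_single J]
    · simp
    · intro I _ hI
      obtain ⟨a, ha⟩ := Function.ne_iff.1 hI
      simp only [_root_.smul_apply, MultilinearMap.compLinearMap_apply,
        MultilinearMap.mkPiAlgebra_apply, smul_eq_mul]
      rw [Finset.prod_eq_zero (Finset.mem_univ a), mul_zero]
      simp [ha.symm]
    · simp
  have h2 := AlternatingMap.coe_alternatization α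
  rw [Fintype.card_fin] at h2
  rw [Nat.cast_smul_eq_nsmul, ← h2, h, map_sum]
  refine Finset.sum_congr rfl fun I _ => ?_
  rw [detForm_eq_alternatization]
  ext v
  simp [MultilinearMap.alternatization_apply, Finset.mul_sum, mul_left_comm, Units.smul_def]

theorem form_eq_sum_detForm {n k : ℕ} (e : Module.Basis (Fin n) ℝ V) (α : Form V k) :
    α = ∑ I : Fin k → Fin n,
      ((k.factorial : ℝ)⁻¹ * α (fun a => e (I a))) • detForm (fun a => e.coord (I a)) := by
  simp only [mul_smul]
  rw [← Finset.smul_sum, sum_smul_detForm, smul_smul, inv_mul_cancel₀, one_smul]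
  exact_mod_cast k.factorial_ne_zero

/-- Linear maps on `k`-forms that agree on products of `1`-forms agree. -/
theorem linearMap_ext_detForm {n k : ℕ} (e : Module.Basis (Fin n) ℝ V) {W : Type*}
    [AddCommGroup W] [Module ℝ W] (f g : Form V k →ₗ[ℝ] W)
    (h : ∀ θ : Fin k → V →ₗ[ℝ] ℝ, f (detForm θ) = g (detForm θ)) : f = g := by
  ext1 α
  rw [form_eq_sum_detForm e α]
  simp only [map_sum, map_smul, h]

theorem detForm_cons {k : ℕ} (θ : Fin (k + 1) → V →ₗ[ℝ] ℝ) (v : V) (w : Fin k → V) :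
    detForm θ (Fin.cons v w) =
      ∑ a : Fin (k + 1), (-1) ^ (a : ℕ) * θ a v * detForm (fun b => θ (a.succAbove b)) w := by
  rw [detForm_apply, Matrix.det_succ_row_zero]
  rfl

theorem curryLeft_detForm {k : ℕ} (θ : Fin (k + 1) → V →ₗ[ℝ] ℝ) (v : V) :
    (detForm θ).curryLeft v =
      ∑ a : Fin (k + 1), ((-1) ^ (a : ℕ) * θ a v) • detForm (fun b => θ (a.succAbove b)) := by
  ext w
  rw [sum_form_apply]
  exact detForm_cons θ v w

theorem detForm_comp_cast {k l : ℕ} (h : k = l) (θ : Fin k → V →ₗ[ℝ] ℝ) (w : Fin l → V) :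
    detForm θ (w ∘ Fin.cast h) = detForm (θ ∘ Fin.cast h.symm) w := by
  subst h; rfl

/-- Deleting a covector from the left block of a concatenation deletes it from that block alone. The
cast reconciles the lengths `k + 1 + l` and `k + (l + 1)`. Together with the version for the right
block, this describes the minors in the Laplace expansion behind `wedge_cons`. -/
theorem append_succAbove_left {X : Type*} {k l : ℕ} (θ : Fin (k + 1) → X) (η : Fin (l + 1) → X)
    (i : Fin (k + 1)) :
    (fun b : Fin (k + 1 + l) => Fin.append θ η
        ((Fin.castAdd (l + 1) i : Fin (k + 1 + l + 1)).succAbove b))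
      = Fin.append (fun b => θ (i.succAbove b)) η ∘ Fin.cast (by omega) := by
  funext b
  obtain ⟨c, rfl⟩ : ∃ c : Fin (k + (l + 1)), b = Fin.cast (by omega) c :=
    ⟨Fin.cast (by omega) b, rfl⟩
  refine Fin.addCases (fun c => ?_) (fun c => ?_) c
  · have : (Fin.castAdd (l + 1) i : Fin (k + 1 + l + 1)).succAbove
        (Fin.cast (show k + (l + 1) = k + 1 + l by omega) (Fin.castAdd (l + 1) c))
          = Fin.castAdd (l + 1) (i.succAbove c) := by
      ext
      simp only [Fin.succAbove, Fin.lt_def, Fin.val_castSucc, Fin.val_cast, Fin.val_castAdd]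
      split_ifs <;> simp
    rw [this]
    simp 
  · have : (Fin.castAdd (l + 1) i : Fin (k + 1 + l + 1)).succAbove
        (Fin.cast (show k + (l + 1) = k + 1 + l by omega) (Fin.natAdd k c))
          = Fin.natAdd (k + 1) c := by
      ext
      simp only [Fin.succAbove, Fin.lt_def, Fin.val_castSucc, Fin.val_cast, Fin.val_castAdd,
        Fin.val_natAdd]
      split_ifs
      · omega
      · simp; omega
    rw [this]
    simp

theorem append_succAbove_right {X : Type*} {k l : ℕ} (θ : Fin (k + 1) → X) (η : Fin (l + 1) → X)
    (j : Fin (l + 1)) :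
    (fun b : Fin (k + 1 + l) => Fin.append θ η
        ((Fin.natAdd (k + 1) j : Fin (k + 1 + l + 1)).succAbove b))
      = Fin.append θ (fun b => η (j.succAbove b)) := by
  funext b
  refine Fin.addCases (fun c => ?_) (fun c => ?_) b
  · have : (Fin.natAdd (k + 1) j : Fin (k + 1 + l + 1)).succAbove (Fin.castAdd l c)
        = Fin.castAdd (l + 1) c := by
      ext
      simp only [Fin.succAbove, Fin.lt_def, Fin.val_castSucc, Fin.val_natAdd, Fin.val_castAdd]
      split_ifs
      · simp
      · omega
    rw [this, Fin.append_left, Fin.append_left]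
  · have : (Fin.natAdd (k + 1) j : Fin (k + 1 + l + 1)).succAbove (Fin.natAdd (k + 1) c)
        = Fin.natAdd (k + 1) (j.succAbove c) := by
      ext
      simp only [Fin.succAbove, Fin.lt_def, Fin.val_castSucc, Fin.val_natAdd]
      split_ifs <;> first | omega | (simp; try omega)
    rw [this, Fin.append_right, Fin.append_right]

/-- The interior product is a graded derivation. -/
theorem wedge_cons {n : ℕ} (e : Module.Basis (Fin n) ℝ V) {k l : ℕ} (α : Form V (k + 1))
    (β : Form V (l + 1)) (v : V) (w : Fin (k + 1 + l) → V) :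
    wedge α β (Fin.cons v w : Fin (k + 1 + l + 1) → V) =
      wedge (α.curryLeft v) β (w ∘ Fin.cast (by omega))
        + (-1) ^ (k + 1) * wedge α (β.curryLeft v) w := by
  have hlin : ∀ {m : ℕ} (u : Fin m → V), ∃ L : Form V m →ₗ[ℝ] ℝ, ∀ a, L a = a u := fun u =>
    ⟨{ toFun := fun a => a u, map_add' := fun _ _ => rfl, map_smul' := fun _ _ => rfl },
      fun _ => rfl⟩
  obtain ⟨L₁, h₁⟩ := hlin (Fin.cons v w : Fin (k + 1 + l + 1) → V)
  obtain ⟨L₂, h₂⟩ := hlin (w ∘ Fin.cast (show k + (l + 1) = k + 1 + l by omega))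
  obtain ⟨L₃, h₃⟩ := hlin w
  -- Both sides are bilinear in the forms, so it suffices to test products of covectors. There the
  -- wedge product is concatenation, and contracting the first slot is Laplace expansion along the
  -- first row. The first `k + 1` terms give the contraction of `α`; the others give that of `β`,
  -- with the sign `(-1) ^ (k + 1)` coming from the shift of the column index.
  have key : (wedgeL V (k + 1) (l + 1)).compr₂ (show Form V (k + 1 + (l + 1)) →ₗ[ℝ] ℝ from L₁) =
      ((wedgeL V k (l + 1)).compr₂ L₂).comp
          ((AlternatingMap.curryLeftLinearMap (R := ℝ) (M := V) (N := ℝ) (n := k)).flip v)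
        + (-1 : ℝ) ^ (k + 1) • ((wedgeL V (k + 1) l).compr₂ L₃).compl₂
          ((AlternatingMap.curryLeftLinearMap (R := ℝ) (M := V) (N := ℝ) (n := l)).flip v) := by
    refine linearMap_ext_detForm e _ _ fun θ => ?_
    refine linearMap_ext_detForm e _ _ fun η => ?_
    simp only [LinearMap.compr₂_apply, LinearMap.add_apply, LinearMap.comp_apply,
      LinearMap.smul_apply, LinearMap.compl₂_apply, LinearMap.flip_apply,
      AlternatingMap.curryLeftLinearMap_apply, curryLeft_detForm, map_sum, map_smul,
      LinearMap.sum_apply, LinearMap.smul_apply]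
    simp only [wedgeL, LinearMap.mk₂_apply, wedge_detForm, h₁, h₂, h₃]
    have e₁ := detForm_cons (k := k + 1 + l) (Fin.append (m := k + 1) (n := l + 1) θ η) v w
    have e₂ := Fin.sum_univ_add (a := k + 1) (b := l + 1) fun a : Fin (k + 1 + l + 1) =>
      (-1 : ℝ) ^ (a : ℕ) * Fin.append (m := k + 1) (n := l + 1) θ η a v
        * detForm (fun b => Fin.append (m := k + 1) (n := l + 1) θ η (a.succAbove b)) w
    refine (e₁.trans e₂).trans (congrArg₂ (· + ·) ?_ ?_)
    · refine Finset.sum_congr rfl fun i _ => ?_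
      rw [append_succAbove_left, detForm_comp_cast, Fin.append_left]
      simp
    · rw [smul_eq_mul, Finset.mul_sum]
      refine Finset.sum_congr rfl fun j _ => ?_
      rw [append_succAbove_right, Fin.append_right]
      simp [pow_add]; ring
  have := congrArg (fun f => f α β) key
  simpa [wedgeL, h₁, h₂, h₃] using this

theorem detForm_of_isEmpty (θ : Fin 0 → V →ₗ[ℝ] ℝ) (v : Fin 0 → V) : detForm θ v = 1 := by
  rw [detForm_apply, Matrix.det_isEmpty]

theorem form_zero_eq (α : Form V 0) : α = α ![] • detForm ![] := by
  ext v
  rw [AlternatingMap.smul_apply, detForm_of_isEmpty, smul_eq_mul, mul_one]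
  exact congrArg α (Subsingleton.elim _ _)

/-- With its counterpart on the right, the base case of the recursion through `wedge_cons`: repeated
contraction leaves a factor of degree zero, which acts as a scalar. -/
theorem wedge_zero_left {l : ℕ} (e : Module.Basis (Fin N) ℝ V) (α : Form V 0) (β : Form V l)
    (v : Fin l → V) : wedge α β (v ∘ Fin.cast (zero_add l)) = α ![] * β v := by
  have key : ∀ β : Form V l, wedge (detForm ![]) β (v ∘ Fin.cast (zero_add l)) = β v := by
    intro β
    obtain ⟨L, hL⟩ : ∃ L : Form V (0 + l) →ₗ[ℝ] ℝ,
        ∀ a, L a = a (v ∘ Fin.cast (zero_add l)) :=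
      ⟨{ toFun := fun a => a _, map_add' := fun _ _ => rfl, map_smul' := fun _ _ => rfl },
        fun _ => rfl⟩
    obtain ⟨L', hL'⟩ : ∃ L : Form V l →ₗ[ℝ] ℝ, ∀ a, L a = a v :=
      ⟨{ toFun := fun a => a _, map_add' := fun _ _ => rfl, map_smul' := fun _ _ => rfl },
        fun _ => rfl⟩
    have : L ∘ₗ wedgeL V 0 l (detForm ![]) = L' := by
      refine linearMap_ext_detForm e _ _ fun η => ?_
      rw [LinearMap.comp_apply, hL, hL', wedgeL, LinearMap.mk₂_apply, wedge_detForm]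
      have h0 : Fin.append ![] η = η ∘ Fin.cast (zero_add l) := Fin.elim0_append η
      rw [h0, detForm_comp_cast]
      rfl
    simpa [hL, hL', wedgeL] using congrArg (fun f => f β) this
  rw [form_zero_eq α, wedge_smul_left, AlternatingMap.smul_apply, key]
  simp [detForm_of_isEmpty]

theorem wedge_zero_right {k : ℕ} (e : Module.Basis (Fin N) ℝ V) (α : Form V k) (β : Form V 0)
    (v : Fin k → V) : wedge α β v = α v * β ![] := by
  have key : ∀ α : Form V k, wedge α (detForm ![]) v = α v := by
    intro α
    obtain ⟨L, hL⟩ : ∃ L : Form V k →ₗ[ℝ] ℝ, ∀ a, L a = a v :=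
      ⟨{ toFun := fun a => a v, map_add' := fun _ _ => rfl, map_smul' := fun _ _ => rfl },
        fun _ => rfl⟩
    have : L ∘ₗ (wedgeL V k 0).flip (detForm ![]) = L := by
      refine linearMap_ext_detForm e _ _ fun η => ?_
      rw [LinearMap.comp_apply, LinearMap.flip_apply, wedgeL, LinearMap.mk₂_apply, wedge_detForm]
      have h0 : Fin.append η ![] = η := Fin.append_elim0 η
      rw [h0]
    simpa [hL, wedgeL] using congrArg (fun f => f α) this
  rw [form_zero_eq β, wedge_smul_right, AlternatingMap.smul_apply, key]
  simp [detForm_of_isEmpty, mul_comm]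

/-! ### Explicit shuffle formulas in low degrees. -/

set_option maxRecDepth 4000

/-- Here and in the formulas that follow, contracting the first slot by `wedge_cons` reduces
bidegree `(k, l)` to `(k - 1, l)` and `(k, l - 1)`. -/
theorem wedge_apply_1_1 (e : Module.Basis (Fin N) ℝ V) (α : Form V 1) (β : Form V 1)
    (a b : V) : DFunLike.coe (F := Form V 2) (wedge α β) ![a, b] =
      α ![a] * β ![b] - α ![b] * β ![a] := by
  refine (wedge_cons e α β a ![b]).trans
    ((congrArg₂ (fun x y : ℝ => x + (-1) ^ 1 * y)
      (wedge_zero_left e (α.curryLeft a) β ![b])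
      (wedge_zero_right e α (β.curryLeft a) ![b])).trans ?_)
  simp only [AlternatingMap.curryLeft_apply_apply]
  ring

theorem wedge_apply_1_2 (e : Module.Basis (Fin N) ℝ V) (α : Form V 1) (β : Form V 2)
    (a b c : V) : DFunLike.coe (F := Form V 3) (wedge α β) ![a, b, c] =
      α ![a] * β ![b, c] - α ![b] * β ![a, c] + α ![c] * β ![a, b] := by
  refine (wedge_cons e α β a ![b, c]).trans
    ((congrArg₂ (fun x y : ℝ => x + (-1) ^ 1 * y)
      (wedge_zero_left e (α.curryLeft a) β ![b, c])
      (wedge_apply_1_1 e α (β.curryLeft a) b c)).trans ?_)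
  simp only [AlternatingMap.curryLeft_apply_apply]
  ring

theorem wedge_apply_1_3 (e : Module.Basis (Fin N) ℝ V) (α : Form V 1) (β : Form V 3)
    (a b c d : V) : DFunLike.coe (F := Form V 4) (wedge α β) ![a, b, c, d] =
      α ![a] * β ![b, c, d] - α ![b] * β ![a, c, d] + α ![c] * β ![a, b, d]
      - α ![d] * β ![a, b, c] := by
  refine (wedge_cons e α β a ![b, c, d]).trans
    ((congrArg₂ (fun x y : ℝ => x + (-1) ^ 1 * y)
      (wedge_zero_left e (α.curryLeft a) β ![b, c, d])
      (wedge_apply_1_2 e α (β.curryLeft a) b c d)).trans ?_)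
  simp only [AlternatingMap.curryLeft_apply_apply]
  ring

theorem wedge_apply_1_4 (e : Module.Basis (Fin N) ℝ V) (α : Form V 1) (β : Form V 4)
    (a b c d p : V) : DFunLike.coe (F := Form V 5) (wedge α β) ![a, b, c, d, p] =
      α ![a] * β ![b, c, d, p] - α ![b] * β ![a, c, d, p] + α ![c] * β ![a, b, d, p]
      - α ![d] * β ![a, b, c, p] + α ![p] * β ![a, b, c, d] := by
  refine (wedge_cons e α β a ![b, c, d, p]).trans
    ((congrArg₂ (fun x y : ℝ => x + (-1) ^ 1 * y)
      (wedge_zero_left e (α.curryLeft a) β ![b, c, d, p])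
      (wedge_apply_1_3 e α (β.curryLeft a) b c d p)).trans ?_)
  simp only [AlternatingMap.curryLeft_apply_apply]
  ring

theorem wedge_apply_2_1 (e : Module.Basis (Fin N) ℝ V) (α : Form V 2) (β : Form V 1)
    (a b c : V) : DFunLike.coe (F := Form V 3) (wedge α β) ![a, b, c] =
      α ![a, b] * β ![c] - α ![a, c] * β ![b] + α ![b, c] * β ![a] := by
  refine (wedge_cons e α β a ![b, c]).trans
    ((congrArg₂ (fun x y : ℝ => x + (-1) ^ 2 * y)
      (wedge_apply_1_1 e (α.curryLeft a) β b c)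
      (wedge_zero_right e α (β.curryLeft a) ![b, c])).trans ?_)
  simp only [AlternatingMap.curryLeft_apply_apply]
  ring

theorem wedge_apply_2_2 (e : Module.Basis (Fin N) ℝ V) (α : Form V 2) (β : Form V 2)
    (a b c d : V) : DFunLike.coe (F := Form V 4) (wedge α β) ![a, b, c, d] =
      α ![a, b] * β ![c, d] - α ![a, c] * β ![b, d] + α ![a, d] * β ![b, c]
      + α ![b, c] * β ![a, d] - α ![b, d] * β ![a, c] + α ![c, d] * β ![a, b] := by
  refine (wedge_cons e α β a ![b, c, d]).trans
    ((congrArg₂ (fun x y : ℝ => x + (-1) ^ 2 * y)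
      (wedge_apply_1_2 e (α.curryLeft a) β b c d)
      (wedge_apply_2_1 e α (β.curryLeft a) b c d)).trans ?_)
  simp only [AlternatingMap.curryLeft_apply_apply]
  ring

theorem wedge_apply_2_3 (e : Module.Basis (Fin N) ℝ V) (α : Form V 2) (β : Form V 3)
    (a b c d p : V) : DFunLike.coe (F := Form V 5) (wedge α β) ![a, b, c, d, p] =
      α ![a, b] * β ![c, d, p] - α ![a, c] * β ![b, d, p] + α ![a, d] * β ![b, c, p]
      - α ![a, p] * β ![b, c, d] + α ![b, c] * β ![a, d, p]
      - α ![b, d] * β ![a, c, p] + α ![b, p] * β ![a, c, d]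
      + α ![c, d] * β ![a, b, p] - α ![c, p] * β ![a, b, d]
      + α ![d, p] * β ![a, b, c] := by
  refine (wedge_cons e α β a ![b, c, d, p]).trans
    ((congrArg₂ (fun x y : ℝ => x + (-1) ^ 2 * y)
      (wedge_apply_1_3 e (α.curryLeft a) β b c d p)
      (wedge_apply_2_2 e α (β.curryLeft a) b c d p)).trans ?_)
  simp only [AlternatingMap.curryLeft_apply_apply]
  ring

theorem wedge_apply_2_4 (e : Module.Basis (Fin N) ℝ V) (α : Form V 2) (β : Form V 4)
    (a b c d p q : V) : DFunLike.coe (F := Form V 6) (wedge α β) ![a, b, c, d, p, q] =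
      α ![a, b] * β ![c, d, p, q] - α ![a, c] * β ![b, d, p, q]
      + α ![a, d] * β ![b, c, p, q] - α ![a, p] * β ![b, c, d, q]
      + α ![a, q] * β ![b, c, d, p] + α ![b, c] * β ![a, d, p, q]
      - α ![b, d] * β ![a, c, p, q] + α ![b, p] * β ![a, c, d, q]
      - α ![b, q] * β ![a, c, d, p] + α ![c, d] * β ![a, b, p, q]
      - α ![c, p] * β ![a, b, d, q] + α ![c, q] * β ![a, b, d, p]
      + α ![d, p] * β ![a, b, c, q] - α ![d, q] * β ![a, b, c, p]
      + α ![p, q] * β ![a, b, c, d] := by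
  refine (wedge_cons e α β a ![b, c, d, p, q]).trans
    ((congrArg₂ (fun x y : ℝ => x + (-1) ^ 2 * y)
      (wedge_apply_1_4 e (α.curryLeft a) β b c d p q)
      (wedge_apply_2_3 e α (β.curryLeft a) b c d p q)).trans ?_)
  simp only [AlternatingMap.curryLeft_apply_apply]
  ring

theorem wedge_apply_3_1 (e : Module.Basis (Fin N) ℝ V) (α : Form V 3) (β : Form V 1)
    (a b c d : V) : DFunLike.coe (F := Form V 4) (wedge α β) ![a, b, c, d] =
      α ![a, b, c] * β ![d] - α ![a, b, d] * β ![c] + α ![a, c, d] * β ![b]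
      - α ![b, c, d] * β ![a] := by
  refine (wedge_cons e α β a ![b, c, d]).trans
    ((congrArg₂ (fun x y : ℝ => x + (-1) ^ 3 * y)
      (wedge_apply_2_1 e (α.curryLeft a) β b c d)
      (wedge_zero_right e α (β.curryLeft a) ![b, c, d])).trans ?_)
  simp only [AlternatingMap.curryLeft_apply_apply]
  ring

theorem wedge_apply_3_2 (e : Module.Basis (Fin N) ℝ V) (α : Form V 3) (β : Form V 2)
    (a b c d p : V) : DFunLike.coe (F := Form V 5) (wedge α β) ![a, b, c, d, p] =
      α ![a, b, c] * β ![d, p] - α ![a, b, d] * β ![c, p] + α ![a, b, p] * β ![c, d]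
      + α ![a, c, d] * β ![b, p] - α ![a, c, p] * β ![b, d]
      + α ![a, d, p] * β ![b, c] - α ![b, c, d] * β ![a, p]
      + α ![b, c, p] * β ![a, d] - α ![b, d, p] * β ![a, c]
      + α ![c, d, p] * β ![a, b] := by
  refine (wedge_cons e α β a ![b, c, d, p]).trans
    ((congrArg₂ (fun x y : ℝ => x + (-1) ^ 3 * y)
      (wedge_apply_2_2 e (α.curryLeft a) β b c d p)
      (wedge_apply_3_1 e α (β.curryLeft a) b c d p)).trans ?_)
  simp only [AlternatingMap.curryLeft_apply_apply]
  ring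

theorem wedge_apply_3_3 (e : Module.Basis (Fin N) ℝ V) (α : Form V 3) (β : Form V 3)
    (a b c d p q : V) : DFunLike.coe (F := Form V 6) (wedge α β) ![a, b, c, d, p, q] =
      α ![a, b, c] * β ![d, p, q] - α ![a, b, d] * β ![c, p, q]
      + α ![a, b, p] * β ![c, d, q] - α ![a, b, q] * β ![c, d, p]
      + α ![a, c, d] * β ![b, p, q] - α ![a, c, p] * β ![b, d, q]
      + α ![a, c, q] * β ![b, d, p] + α ![a, d, p] * β ![b, c, q]
      - α ![a, d, q] * β ![b, c, p] + α ![a, p, q] * β ![b, c, d]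
      - α ![b, c, d] * β ![a, p, q] + α ![b, c, p] * β ![a, d, q]
      - α ![b, c, q] * β ![a, d, p] - α ![b, d, p] * β ![a, c, q]
      + α ![b, d, q] * β ![a, c, p] - α ![b, p, q] * β ![a, c, d]
      + α ![c, d, p] * β ![a, b, q] - α ![c, d, q] * β ![a, b, p]
      + α ![c, p, q] * β ![a, b, d] - α ![d, p, q] * β ![a, b, c] := by
  refine (wedge_cons e α β a ![b, c, d, p, q]).trans
    ((congrArg₂ (fun x y : ℝ => x + (-1) ^ 3 * y)
      (wedge_apply_2_3 e (α.curryLeft a) β b c d p q)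
      (wedge_apply_3_2 e α (β.curryLeft a) b c d p q)).trans ?_)
  simp only [AlternatingMap.curryLeft_apply_apply]
  ring

theorem wedge_apply_3_4 (e : Module.Basis (Fin N) ℝ V) (α : Form V 3) (β : Form V 4)
    (a b c d p q r : V) : DFunLike.coe (F := Form V 7) (wedge α β) ![a, b, c, d, p, q, r] =
      α ![a, b, c] * β ![d, p, q, r] - α ![a, b, d] * β ![c, p, q, r]
      + α ![a, b, p] * β ![c, d, q, r] - α ![a, b, q] * β ![c, d, p, r]
      + α ![a, b, r] * β ![c, d, p, q] + α ![a, c, d] * β ![b, p, q, r]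
      - α ![a, c, p] * β ![b, d, q, r] + α ![a, c, q] * β ![b, d, p, r]
      - α ![a, c, r] * β ![b, d, p, q] + α ![a, d, p] * β ![b, c, q, r]
      - α ![a, d, q] * β ![b, c, p, r] + α ![a, d, r] * β ![b, c, p, q]
      + α ![a, p, q] * β ![b, c, d, r] - α ![a, p, r] * β ![b, c, d, q]
      + α ![a, q, r] * β ![b, c, d, p] - α ![b, c, d] * β ![a, p, q, r]
      + α ![b, c, p] * β ![a, d, q, r] - α ![b, c, q] * β ![a, d, p, r]
      + α ![b, c, r] * β ![a, d, p, q] - α ![b, d, p] * β ![a, c, q, r]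
      + α ![b, d, q] * β ![a, c, p, r] - α ![b, d, r] * β ![a, c, p, q]
      - α ![b, p, q] * β ![a, c, d, r] + α ![b, p, r] * β ![a, c, d, q]
      - α ![b, q, r] * β ![a, c, d, p] + α ![c, d, p] * β ![a, b, q, r]
      - α ![c, d, q] * β ![a, b, p, r] + α ![c, d, r] * β ![a, b, p, q]
      + α ![c, p, q] * β ![a, b, d, r] - α ![c, p, r] * β ![a, b, d, q]
      + α ![c, q, r] * β ![a, b, d, p] - α ![d, p, q] * β ![a, b, c, r]
      + α ![d, p, r] * β ![a, b, c, q] - α ![d, q, r] * β ![a, b, c, p]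
      + α ![p, q, r] * β ![a, b, c, d] := by
  have h₁ := wedge_apply_2_4 e (α.curryLeft a) β b c d p q r
  have h₂ := wedge_apply_3_3 e α (β.curryLeft a) b c d p q r
  simp only [AlternatingMap.curryLeft_apply_apply] at h₁ h₂
  -- The lengths `2 + 4`, `2 + 1 + 3` and `7` agree only after reduction, so the argument tuples and
  -- the two readings of the product are identified by hand.
  have hw : (![b, c, d, p, q, r] : Fin (2 + 1 + 3) → V) ∘ Fin.cast (show 2 + 4 = 2 + 1 + 3 from rfl)
      = (![b, c, d, p, q, r] : Fin (2 + 4) → V) := funext fun i => rfl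
  have h₃ := wedge_cons e (k := 2) (l := 3) α β a ![b, c, d, p, q, r]
  rw [hw, h₁, h₂] at h₃
  have hk : ∀ x : Fin 7 → V, wedge (k := 3) (l := 4) α β x
      = wedge (k := 2 + 1) (l := 3 + 1) α β x := fun x => by congr 1
  rw [hk]
  refine Eq.trans ?_ (h₃.trans ?_)
  · congr 1
  · ring

end ExteriorAlgebra

/-! ### Forms and the Hodge star on the vectors of a frame. -/

section Frames

variable {V : Type*} {n k m : ℕ} [AddCommGroup V] [Module ℝ V]

theorem coordForm_apply_three (e : Module.Basis (Fin n) ℝ V) (I : Fin 3 → Fin n) (u v w : V) :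
    coordForm e I ![u, v, w] =
      e.coord (I 0) u * (e.coord (I 1) v * e.coord (I 2) w - e.coord (I 2) v * e.coord (I 1) w)
      - e.coord (I 1) u * (e.coord (I 0) v * e.coord (I 2) w - e.coord (I 2) v * e.coord (I 0) w)
      + e.coord (I 2) u
        * (e.coord (I 0) v * e.coord (I 1) w - e.coord (I 1) v * e.coord (I 0) w) := by
  rw [coordForm_eq_detForm, detForm_apply, Matrix.det_fin_three]
  simp
  ring

theorem coordForm_apply_sorted (e : Module.Basis (Fin n) ℝ V) {i j k a b c : Fin n} (hij : i < j)
    (hjk : j < k) (hab : a < b) (hbc : b < c) : coordForm e ![i, j, k] ![e a, e b, e c] =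
      if i = a ∧ j = b ∧ k = c then 1 else 0 := by
  rw [coordForm_apply_three]
  simp only [Matrix.cons_val, Module.Basis.coord_apply, Module.Basis.repr_self,
    Finsupp.single_apply]
  rcases lt_trichotomy a i with h | h | h
  · rw [if_neg (show a ≠ i by omega), if_neg (show a ≠ j by omega), if_neg (show a ≠ k by omega),
      if_neg (show ¬(i = a ∧ j = b ∧ k = c) by omega)]
    ring
  · rcases lt_trichotomy b j with h' | h' | h'
    · rw [if_neg (show b ≠ i by omega), if_neg (show b ≠ j by omega),
        if_neg (show b ≠ k by omega), if_neg (show a ≠ j by omega), if_neg (show a ≠ k by omega),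
        if_neg (show ¬(i = a ∧ j = b ∧ k = c) by omega)]
      ring
    · subst h h'
      rw [if_pos rfl, if_pos rfl, if_neg (show b ≠ a by omega), if_neg (show a ≠ b by omega),
        if_neg (show c ≠ b by omega), if_neg (show a ≠ k by omega)]
      by_cases hc : k = c
      · simp [hc]
      · simp [hc, Ne.symm hc]
    · rw [if_neg (show a ≠ j by omega), if_neg (show b ≠ j by omega),
        if_neg (show c ≠ j by omega), if_neg (show b ≠ i by omega), if_neg (show c ≠ i by omega),
        if_neg (show ¬(i = a ∧ j = b ∧ k = c) by omega)]
      ring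
  · rw [if_neg (show a ≠ i by omega), if_neg (show b ≠ i by omega), if_neg (show c ≠ i by omega),
      if_neg (show ¬(i = a ∧ j = b ∧ k = c) by omega)]
    ring

theorem coordForm_apply_four (e : Module.Basis (Fin n) ℝ V) (I : Fin 4 → Fin n) (u v w z : V) :
    coordForm e I ![u, v, w, z] =
      e.coord (I 0) u * coordForm e ![I 1, I 2, I 3] ![v, w, z]
      - e.coord (I 1) u * coordForm e ![I 0, I 2, I 3] ![v, w, z]
      + e.coord (I 2) u * coordForm e ![I 0, I 1, I 3] ![v, w, z]
      - e.coord (I 3) u * coordForm e ![I 0, I 1, I 2] ![v, w, z] := by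
  refine (detForm_cons (fun a => e.coord (I a)) u ![v, w, z]).trans ?_
  have h₀ : (fun b => I ((0 : Fin 4).succAbove b)) = ![I 1, I 2, I 3] := by
    funext b; fin_cases b <;> rfl
  have h₁ : (fun b => I ((1 : Fin 4).succAbove b)) = ![I 0, I 2, I 3] := by
    funext b; fin_cases b <;> rfl
  have h₂ : (fun b => I ((2 : Fin 4).succAbove b)) = ![I 0, I 1, I 3] := by
    funext b; fin_cases b <;> rfl
  have h₃ : (fun b => I ((3 : Fin 4).succAbove b)) = ![I 0, I 1, I 2] := by
    funext b; fin_cases b <;> rfl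
  rw [Fin.sum_univ_four, ← h₀, ← h₁, ← h₂, ← h₃]
  simp only [coordForm_eq_detForm]
  norm_num
  ring

/-- Forms that agree on increasing multi-indices agree. -/
theorem form_ext_strictMono (e : Module.Basis (Fin n) ℝ V) {f g : Form V k}
    (h : ∀ I : Fin k → Fin n, StrictMono I → f (fun a => e (I a)) = g fun a => e (I a)) :
    f = g := by
  refine Module.Basis.ext_alternating e fun I hI => ?_
  have hs : StrictMono (I ∘ Tuple.sort I) :=
    (Tuple.monotone_sort I).strictMono_of_injective (hI.comp (Tuple.sort I).injective)
  have h₁ := h _ hs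
  have hf := f.map_perm (fun a => e (I a)) (Tuple.sort I)
  have hg := g.map_perm (fun a => e (I a)) (Tuple.sort I)
  have : Equiv.Perm.sign (Tuple.sort I) • f (fun a => e (I a))
      = Equiv.Perm.sign (Tuple.sort I) • g fun a => e (I a) := by
    rw [← hf, ← hg]; exact h₁
  exact smul_left_cancel _ this

/-- The sign of a permutation of `Fin n`, given as a function, by counting inversions. -/
def inversionSign (K : Fin n → Fin n) : ℤˣ :=
  ∏ j, ∏ i ∈ Finset.Iio j, if K i < K j then 1 else -1

/-- A sign obtained by counting inversions can be evaluated, so that every entry of the Hodge star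
tables is settled by `decide`. -/
theorem det_apply_injective (e : Module.Basis (Fin n) ℝ V) (K : Fin n → Fin n)
    (hK : Function.Injective K) : e.det (fun a => e (K a)) = ((inversionSign K : ℤ) : ℝ) := by
  obtain ⟨σ, rfl⟩ : ∃ σ : Equiv.Perm (Fin n), ⇑σ = K :=
    ⟨Equiv.ofBijective K (Finite.injective_iff_bijective.1 hK), rfl⟩
  have := e.det.map_perm e σ
  rw [e.det_self] at this
  rw [inversionSign, ← Equiv.Perm.sign_eq_prod_prod_Iio]
  simpa [Units.smul_def, Function.comp_def] using this

theorem hodgeOfBasis_apply (e : Module.Basis (Fin n) ℝ V) (h : k + m = n) (α : Form V k)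
    (v : Fin m → V) : hodgeOfBasis e k m h α v =
      open Classical in
      ∑ I : Fin k → Fin n with StrictMono I, α (fun a => e (I a))
        * e.det (Fin.append (fun a => e (I a)) v ∘ Fin.cast h.symm) := by
  rw [hodgeOfBasis, sum_form_apply]
  rfl

/-- In the sum over increasing multi-indices the volume form kills every `I'` that is not
complementary to `J`, and an increasing multi-index is determined by its range. One term survives.
-/
theorem hodgeOfBasis_apply_basis (e : Module.Basis (Fin n) ℝ V) (h : k + m = n)
    (I : Fin k → Fin n) (J : Fin m → Fin n) (hI : StrictMono I) (K : Fin n → Fin n)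
    (hK : Function.Injective K) (hIJ : Fin.append I J ∘ Fin.cast h.symm = K) (α : Form V k) :
    hodgeOfBasis e k m h α (fun a => e (J a))
      = ((inversionSign K : ℤ) : ℝ) * α fun a => e (I a) := by
  classical
  have happ : ∀ I' : Fin k → Fin n, Fin.append (fun a => e (I' a)) (fun a => e (J a))
      ∘ Fin.cast h.symm = fun a => e ((Fin.append I' J ∘ Fin.cast h.symm) a) := by
    intro I'
    have : Fin.append (fun a => e (I' a)) (fun a => e (J a)) = e ∘ Fin.append I' J := by
      funext a; refine Fin.addCases (fun a => ?_) (fun a => ?_) a <;> simp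
    rw [this]; rfl
  subst h
  have hdisj : ∀ I' : Fin k → Fin (k + m), Function.Injective (Fin.append I' J) →
      Set.range I' = (Set.range J)ᶜ := by
    intro I' hinj
    have hsurj := Finite.injective_iff_surjective.1 hinj
    ext x
    constructor
    · rintro ⟨a, rfl⟩ ⟨b, hb⟩
      have := @hinj (Fin.castAdd m a) (Fin.natAdd k b) (by simp [hb])
      simp [Fin.ext_iff] at this
      omega
    · intro hx
      obtain ⟨y, rfl⟩ := hsurj x
      induction y using Fin.addCases with
      | left a => exact ⟨a, by simp⟩
      | right b => exact absurd ⟨b, by simp⟩ hx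
  rw [hodgeOfBasis_apply, Finset.sum_eq_single I]
  · rw [happ, hIJ, det_apply_injective e K hK, mul_comm]
  · intro I' hI' hne
    rw [happ, e.det.map_eq_zero_of_not_injective, mul_zero]
    intro hinj
    refine hne ?_
    have h₁ : Function.Injective (Fin.append I' J) := fun a b hab => hinj (congrArg e hab)
    have h₂ : Function.Injective (Fin.append I J) := by
      have : Fin.append I J = K := hIJ
      rw [this]; exact hK
    exact ((Finset.mem_filter.1 hI').2.range_inj hI).1 ((hdisj I' h₁).trans (hdisj I h₂).symm)
  · intro hI'
    exact absurd (Finset.mem_filter.2 ⟨Finset.mem_univ _, hI⟩) hI'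

/-- The coassociative form in a frame. -/
def coassoc (e : Module.Basis (Fin 7) ℝ V) : Form V 4 :=
  coordForm e ![3, 4, 5, 6] + coordForm e ![1, 2, 5, 6] + coordForm e ![1, 2, 3, 4]
    + coordForm e ![0, 2, 4, 6] - coordForm e ![0, 2, 3, 5]
    - coordForm e ![0, 1, 4, 5] - coordForm e ![0, 1, 3, 6]

theorem hodgeOfBasis_apply_basis_pos (e : Module.Basis (Fin n) ℝ V) (h : k + m = n)
    {I : Fin k → Fin n} {J : Fin m → Fin n} {K : Fin n → Fin n} (hI : StrictMono I)
    (hK : Function.Injective K) (hIJ : Fin.append I J ∘ Fin.cast h.symm = K)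
    (hs : inversionSign K = 1) (α : Form V k) {u : Fin k → V} {v : Fin m → V}
    (hu : u = fun a => e (I a)) (hv : v = fun a => e (J a)) :
    hodgeOfBasis e k m h α v = α u := by
  rw [hu, hv, hodgeOfBasis_apply_basis e h I J hI K hK hIJ, hs]
  simp

theorem hodgeOfBasis_apply_basis_neg (e : Module.Basis (Fin n) ℝ V) (h : k + m = n)
    {I : Fin k → Fin n} {J : Fin m → Fin n} {K : Fin n → Fin n} (hI : StrictMono I)
    (hK : Function.Injective K) (hIJ : Fin.append I J ∘ Fin.cast h.symm = K)
    (hs : inversionSign K = -1) (α : Form V k) {u : Fin k → V} {v : Fin m → V}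
    (hu : u = fun a => e (I a)) (hv : v = fun a => e (J a)) :
    hodgeOfBasis e k m h α v = -α u := by
  rw [hu, hv, hodgeOfBasis_apply_basis e h I J hI K hK hIJ, hs]
  simp

/-! ### Evaluation tables for `φ`, `∗φ` and the Hodge star. -/

set_option maxRecDepth 4000

-- The first slot of the tables for `φ` and `∗φ` is left free, since exterior derivatives will be
-- evaluated there on derivatives of the coframe, which are not frame vectors.
@[simp]
theorem assocForm_table_0 (e : Module.Basis (Fin 7) ℝ V) :
    (∀ u, assocForm e ![u, e 0, e 1] = e.repr u 2) ∧
    (∀ u, assocForm e ![u, e 0, e 2] = -e.repr u 1) ∧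
    (∀ u, assocForm e ![u, e 0, e 3] = e.repr u 4) ∧
    (∀ u, assocForm e ![u, e 0, e 4] = -e.repr u 3) ∧
    (∀ u, assocForm e ![u, e 0, e 5] = e.repr u 6) ∧
    (∀ u, assocForm e ![u, e 0, e 6] = -e.repr u 5) ∧
    (∀ u, assocForm e ![u, e 1, e 2] = e.repr u 0) := by
  and_intros <;> intro u <;>
  simp [assocForm, coordForm_apply_three]

@[simp]
theorem assocForm_table_1 (e : Module.Basis (Fin 7) ℝ V) :
    (∀ u, assocForm e ![u, e 1, e 3] = e.repr u 5) ∧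
    (∀ u, assocForm e ![u, e 1, e 4] = -e.repr u 6) ∧
    (∀ u, assocForm e ![u, e 1, e 5] = -e.repr u 3) ∧
    (∀ u, assocForm e ![u, e 1, e 6] = e.repr u 4) ∧
    (∀ u, assocForm e ![u, e 2, e 3] = -e.repr u 6) ∧
    (∀ u, assocForm e ![u, e 2, e 4] = -e.repr u 5) ∧
    (∀ u, assocForm e ![u, e 2, e 5] = e.repr u 4) := by
  and_intros <;> intro u <;>
  simp [assocForm, coordForm_apply_three]

@[simp]
theorem assocForm_table_2 (e : Module.Basis (Fin 7) ℝ V) :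
    (∀ u, assocForm e ![u, e 2, e 6] = e.repr u 3) ∧
    (∀ u, assocForm e ![u, e 3, e 4] = e.repr u 0) ∧
    (∀ u, assocForm e ![u, e 3, e 5] = e.repr u 1) ∧
    (∀ u, assocForm e ![u, e 3, e 6] = -e.repr u 2) ∧
    (∀ u, assocForm e ![u, e 4, e 5] = -e.repr u 2) ∧
    (∀ u, assocForm e ![u, e 4, e 6] = -e.repr u 1) ∧
    (∀ u, assocForm e ![u, e 5, e 6] = e.repr u 0) := by
  and_intros <;> intro u <;>
  simp [assocForm, coordForm_apply_three]

@[simp]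
theorem coassoc_table_0 (e : Module.Basis (Fin 7) ℝ V) :
    (∀ u, coassoc e ![u, e 0, e 1, e 2] = 0) ∧
    (∀ u, coassoc e ![u, e 0, e 1, e 3] = e.repr u 6) ∧
    (∀ u, coassoc e ![u, e 0, e 1, e 4] = e.repr u 5) ∧
    (∀ u, coassoc e ![u, e 0, e 1, e 5] = -e.repr u 4) ∧
    (∀ u, coassoc e ![u, e 0, e 1, e 6] = -e.repr u 3) ∧
    (∀ u, coassoc e ![u, e 0, e 2, e 3] = e.repr u 5) ∧
    (∀ u, coassoc e ![u, e 0, e 2, e 4] = -e.repr u 6) := by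
  and_intros <;> intro u <;>
  simp [coassoc, coordForm_apply_four, coordForm_apply_sorted]

@[simp]
theorem coassoc_table_1 (e : Module.Basis (Fin 7) ℝ V) :
    (∀ u, coassoc e ![u, e 0, e 2, e 5] = -e.repr u 3) ∧
    (∀ u, coassoc e ![u, e 0, e 2, e 6] = e.repr u 4) ∧
    (∀ u, coassoc e ![u, e 0, e 3, e 4] = 0) ∧
    (∀ u, coassoc e ![u, e 0, e 3, e 5] = e.repr u 2) ∧
    (∀ u, coassoc e ![u, e 0, e 3, e 6] = e.repr u 1) ∧
    (∀ u, coassoc e ![u, e 0, e 4, e 5] = e.repr u 1) ∧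
    (∀ u, coassoc e ![u, e 0, e 4, e 6] = -e.repr u 2) := by
  and_intros <;> intro u <;>
  simp [coassoc, coordForm_apply_four, coordForm_apply_sorted]

@[simp]
theorem coassoc_table_2 (e : Module.Basis (Fin 7) ℝ V) :
    (∀ u, coassoc e ![u, e 0, e 5, e 6] = 0) ∧
    (∀ u, coassoc e ![u, e 1, e 2, e 3] = -e.repr u 4) ∧
    (∀ u, coassoc e ![u, e 1, e 2, e 4] = e.repr u 3) ∧
    (∀ u, coassoc e ![u, e 1, e 2, e 5] = -e.repr u 6) ∧
    (∀ u, coassoc e ![u, e 1, e 2, e 6] = e.repr u 5) ∧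
    (∀ u, coassoc e ![u, e 1, e 3, e 4] = -e.repr u 2) ∧
    (∀ u, coassoc e ![u, e 1, e 3, e 5] = 0) := by
  and_intros <;> intro u <;>
  simp [coassoc, coordForm_apply_four, coordForm_apply_sorted]

@[simp]
theorem coassoc_table_3 (e : Module.Basis (Fin 7) ℝ V) :
    (∀ u, coassoc e ![u, e 1, e 3, e 6] = -e.repr u 0) ∧
    (∀ u, coassoc e ![u, e 1, e 4, e 5] = -e.repr u 0) ∧
    (∀ u, coassoc e ![u, e 1, e 4, e 6] = 0) ∧
    (∀ u, coassoc e ![u, e 1, e 5, e 6] = -e.repr u 2) ∧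
    (∀ u, coassoc e ![u, e 2, e 3, e 4] = e.repr u 1) ∧
    (∀ u, coassoc e ![u, e 2, e 3, e 5] = -e.repr u 0) ∧
    (∀ u, coassoc e ![u, e 2, e 3, e 6] = 0) := by
  and_intros <;> intro u <;>
  simp [coassoc, coordForm_apply_four, coordForm_apply_sorted]

@[simp]
theorem coassoc_table_4 (e : Module.Basis (Fin 7) ℝ V) :
    (∀ u, coassoc e ![u, e 2, e 4, e 5] = 0) ∧
    (∀ u, coassoc e ![u, e 2, e 4, e 6] = e.repr u 0) ∧
    (∀ u, coassoc e ![u, e 2, e 5, e 6] = e.repr u 1) ∧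
    (∀ u, coassoc e ![u, e 3, e 4, e 5] = -e.repr u 6) ∧
    (∀ u, coassoc e ![u, e 3, e 4, e 6] = e.repr u 5) ∧
    (∀ u, coassoc e ![u, e 3, e 5, e 6] = -e.repr u 4) ∧
    (∀ u, coassoc e ![u, e 4, e 5, e 6] = e.repr u 3) := by
  and_intros <;> intro u <;>
  simp [coassoc, coordForm_apply_four, coordForm_apply_sorted]

theorem hodgeOfBasis_3_4_pos (f : Module.Basis (Fin 7) ℝ V) (α : Form V 3) {a b c p q r s : Fin 7}
    (hI : StrictMono ![a, b, c]) (hK : Function.Injective ![a, b, c, p, q, r, s])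
    (hs : inversionSign ![a, b, c, p, q, r, s] = 1) :
    hodgeOfBasis f 3 4 rfl α ![f p, f q, f r, f s] = α ![f a, f b, f c] := by
  have h₁ : Fin.append ![a, b, c] ![p, q, r, s] ∘ Fin.cast (rfl : 3 + 4 = 7).symm
      = ![a, b, c, p, q, r, s] := by
    simp [funext_iff, Fin.forall_fin_succ, Fin.append, Fin.addCases]
  have h₂ : ![f a, f b, f c] = fun i => f (![a, b, c] i) := by
    simp [funext_iff, Fin.forall_fin_succ]
  have h₃ : ![f p, f q, f r, f s] = fun i => f (![p, q, r, s] i) := by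
    simp [funext_iff, Fin.forall_fin_succ]
  have := @hodgeOfBasis_apply_basis_pos V 7 3 4 _ _ f rfl ![a, b, c] ![p, q, r, s]
    ![a, b, c, p, q, r, s] hI hK
  exact this h₁ hs α h₂ h₃

theorem hodgeOfBasis_3_4_neg (f : Module.Basis (Fin 7) ℝ V) (α : Form V 3) {a b c p q r s : Fin 7}
    (hI : StrictMono ![a, b, c]) (hK : Function.Injective ![a, b, c, p, q, r, s])
    (hs : inversionSign ![a, b, c, p, q, r, s] = -1) :
    hodgeOfBasis f 3 4 rfl α ![f p, f q, f r, f s] = -α ![f a, f b, f c] := by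
  have h₁ : Fin.append ![a, b, c] ![p, q, r, s] ∘ Fin.cast (rfl : 3 + 4 = 7).symm
      = ![a, b, c, p, q, r, s] := by
    simp [funext_iff, Fin.forall_fin_succ, Fin.append, Fin.addCases]
  have h₂ : ![f a, f b, f c] = fun i => f (![a, b, c] i) := by
    simp [funext_iff, Fin.forall_fin_succ]
  have h₃ : ![f p, f q, f r, f s] = fun i => f (![p, q, r, s] i) := by
    simp [funext_iff, Fin.forall_fin_succ]
  have := @hodgeOfBasis_apply_basis_neg V 7 3 4 _ _ f rfl ![a, b, c] ![p, q, r, s]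
    ![a, b, c, p, q, r, s] hI hK
  exact this h₁ hs α h₂ h₃

@[simp]
theorem hodgeOfBasis_3_4_table_0 (e : Module.Basis (Fin 7) ℝ V) (α : Form V 3) :
    hodgeOfBasis e 3 4 rfl α ![e 3, e 4, e 5, e 6] = α ![e 0, e 1, e 2] ∧
    hodgeOfBasis e 3 4 rfl α ![e 2, e 4, e 5, e 6] = -α ![e 0, e 1, e 3] ∧
    hodgeOfBasis e 3 4 rfl α ![e 2, e 3, e 5, e 6] = α ![e 0, e 1, e 4] ∧
    hodgeOfBasis e 3 4 rfl α ![e 2, e 3, e 4, e 6] = -α ![e 0, e 1, e 5] ∧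
    hodgeOfBasis e 3 4 rfl α ![e 2, e 3, e 4, e 5] = α ![e 0, e 1, e 6] ∧
    hodgeOfBasis e 3 4 rfl α ![e 1, e 4, e 5, e 6] = α ![e 0, e 2, e 3] ∧
    hodgeOfBasis e 3 4 rfl α ![e 1, e 3, e 5, e 6] = -α ![e 0, e 2, e 4] := by
  and_intros <;> first
    | exact hodgeOfBasis_3_4_pos e α (by decide) (by decide) (by decide)
    | exact hodgeOfBasis_3_4_neg e α (by decide) (by decide) (by decide)

@[simp]
theorem hodgeOfBasis_3_4_table_1 (e : Module.Basis (Fin 7) ℝ V) (α : Form V 3) :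
    hodgeOfBasis e 3 4 rfl α ![e 1, e 3, e 4, e 6] = α ![e 0, e 2, e 5] ∧
    hodgeOfBasis e 3 4 rfl α ![e 1, e 3, e 4, e 5] = -α ![e 0, e 2, e 6] ∧
    hodgeOfBasis e 3 4 rfl α ![e 1, e 2, e 5, e 6] = α ![e 0, e 3, e 4] ∧
    hodgeOfBasis e 3 4 rfl α ![e 1, e 2, e 4, e 6] = -α ![e 0, e 3, e 5] ∧
    hodgeOfBasis e 3 4 rfl α ![e 1, e 2, e 4, e 5] = α ![e 0, e 3, e 6] ∧
    hodgeOfBasis e 3 4 rfl α ![e 1, e 2, e 3, e 6] = α ![e 0, e 4, e 5] ∧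
    hodgeOfBasis e 3 4 rfl α ![e 1, e 2, e 3, e 5] = -α ![e 0, e 4, e 6] := by
  and_intros <;> first
    | exact hodgeOfBasis_3_4_pos e α (by decide) (by decide) (by decide)
    | exact hodgeOfBasis_3_4_neg e α (by decide) (by decide) (by decide)

@[simp]
theorem hodgeOfBasis_3_4_table_2 (e : Module.Basis (Fin 7) ℝ V) (α : Form V 3) :
    hodgeOfBasis e 3 4 rfl α ![e 1, e 2, e 3, e 4] = α ![e 0, e 5, e 6] ∧
    hodgeOfBasis e 3 4 rfl α ![e 0, e 4, e 5, e 6] = -α ![e 1, e 2, e 3] ∧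
    hodgeOfBasis e 3 4 rfl α ![e 0, e 3, e 5, e 6] = α ![e 1, e 2, e 4] ∧
    hodgeOfBasis e 3 4 rfl α ![e 0, e 3, e 4, e 6] = -α ![e 1, e 2, e 5] ∧
    hodgeOfBasis e 3 4 rfl α ![e 0, e 3, e 4, e 5] = α ![e 1, e 2, e 6] ∧
    hodgeOfBasis e 3 4 rfl α ![e 0, e 2, e 5, e 6] = -α ![e 1, e 3, e 4] ∧
    hodgeOfBasis e 3 4 rfl α ![e 0, e 2, e 4, e 6] = α ![e 1, e 3, e 5] := by
  and_intros <;> first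
    | exact hodgeOfBasis_3_4_pos e α (by decide) (by decide) (by decide)
    | exact hodgeOfBasis_3_4_neg e α (by decide) (by decide) (by decide)

@[simp]
theorem hodgeOfBasis_3_4_table_3 (e : Module.Basis (Fin 7) ℝ V) (α : Form V 3) :
    hodgeOfBasis e 3 4 rfl α ![e 0, e 2, e 4, e 5] = -α ![e 1, e 3, e 6] ∧
    hodgeOfBasis e 3 4 rfl α ![e 0, e 2, e 3, e 6] = -α ![e 1, e 4, e 5] ∧
    hodgeOfBasis e 3 4 rfl α ![e 0, e 2, e 3, e 5] = α ![e 1, e 4, e 6] ∧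
    hodgeOfBasis e 3 4 rfl α ![e 0, e 2, e 3, e 4] = -α ![e 1, e 5, e 6] ∧
    hodgeOfBasis e 3 4 rfl α ![e 0, e 1, e 5, e 6] = α ![e 2, e 3, e 4] ∧
    hodgeOfBasis e 3 4 rfl α ![e 0, e 1, e 4, e 6] = -α ![e 2, e 3, e 5] ∧
    hodgeOfBasis e 3 4 rfl α ![e 0, e 1, e 4, e 5] = α ![e 2, e 3, e 6] := by
  and_intros <;> first
    | exact hodgeOfBasis_3_4_pos e α (by decide) (by decide) (by decide)
    | exact hodgeOfBasis_3_4_neg e α (by decide) (by decide) (by decide)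

@[simp]
theorem hodgeOfBasis_3_4_table_4 (e : Module.Basis (Fin 7) ℝ V) (α : Form V 3) :
    hodgeOfBasis e 3 4 rfl α ![e 0, e 1, e 3, e 6] = α ![e 2, e 4, e 5] ∧
    hodgeOfBasis e 3 4 rfl α ![e 0, e 1, e 3, e 5] = -α ![e 2, e 4, e 6] ∧
    hodgeOfBasis e 3 4 rfl α ![e 0, e 1, e 3, e 4] = α ![e 2, e 5, e 6] ∧
    hodgeOfBasis e 3 4 rfl α ![e 0, e 1, e 2, e 6] = -α ![e 3, e 4, e 5] ∧
    hodgeOfBasis e 3 4 rfl α ![e 0, e 1, e 2, e 5] = α ![e 3, e 4, e 6] ∧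
    hodgeOfBasis e 3 4 rfl α ![e 0, e 1, e 2, e 4] = -α ![e 3, e 5, e 6] ∧
    hodgeOfBasis e 3 4 rfl α ![e 0, e 1, e 2, e 3] = α ![e 4, e 5, e 6] := by
  and_intros <;> first
    | exact hodgeOfBasis_3_4_pos e α (by decide) (by decide) (by decide)
    | exact hodgeOfBasis_3_4_neg e α (by decide) (by decide) (by decide)

theorem hodgeOfBasis_4_3_pos (f : Module.Basis (Fin 7) ℝ V) (α : Form V 4) {a b c d p q r : Fin 7}
    (hI : StrictMono ![a, b, c, d]) (hK : Function.Injective ![a, b, c, d, p, q, r])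
    (hs : inversionSign ![a, b, c, d, p, q, r] = 1) :
    hodgeOfBasis f 4 3 rfl α ![f p, f q, f r] = α ![f a, f b, f c, f d] := by
  have h₁ : Fin.append ![a, b, c, d] ![p, q, r] ∘ Fin.cast (rfl : 4 + 3 = 7).symm
      = ![a, b, c, d, p, q, r] := by
    simp [funext_iff, Fin.forall_fin_succ, Fin.append, Fin.addCases]
  have h₂ : ![f a, f b, f c, f d] = fun i => f (![a, b, c, d] i) := by
    simp [funext_iff, Fin.forall_fin_succ]
  have h₃ : ![f p, f q, f r] = fun i => f (![p, q, r] i) := by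
    simp [funext_iff, Fin.forall_fin_succ]
  have := @hodgeOfBasis_apply_basis_pos V 7 4 3 _ _ f rfl ![a, b, c, d] ![p, q, r]
    ![a, b, c, d, p, q, r] hI hK
  exact this h₁ hs α h₂ h₃

theorem hodgeOfBasis_4_3_neg (f : Module.Basis (Fin 7) ℝ V) (α : Form V 4) {a b c d p q r : Fin 7}
    (hI : StrictMono ![a, b, c, d]) (hK : Function.Injective ![a, b, c, d, p, q, r])
    (hs : inversionSign ![a, b, c, d, p, q, r] = -1) :
    hodgeOfBasis f 4 3 rfl α ![f p, f q, f r] = -α ![f a, f b, f c, f d] := by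
  have h₁ : Fin.append ![a, b, c, d] ![p, q, r] ∘ Fin.cast (rfl : 4 + 3 = 7).symm
      = ![a, b, c, d, p, q, r] := by
    simp [funext_iff, Fin.forall_fin_succ, Fin.append, Fin.addCases]
  have h₂ : ![f a, f b, f c, f d] = fun i => f (![a, b, c, d] i) := by
    simp [funext_iff, Fin.forall_fin_succ]
  have h₃ : ![f p, f q, f r] = fun i => f (![p, q, r] i) := by
    simp [funext_iff, Fin.forall_fin_succ]
  have := @hodgeOfBasis_apply_basis_neg V 7 4 3 _ _ f rfl ![a, b, c, d] ![p, q, r]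
    ![a, b, c, d, p, q, r] hI hK
  exact this h₁ hs α h₂ h₃

@[simp]
theorem hodgeOfBasis_4_3_table_0 (e : Module.Basis (Fin 7) ℝ V) (α : Form V 4) :
    hodgeOfBasis e 4 3 rfl α ![e 4, e 5, e 6] = α ![e 0, e 1, e 2, e 3] ∧
    hodgeOfBasis e 4 3 rfl α ![e 3, e 5, e 6] = -α ![e 0, e 1, e 2, e 4] ∧
    hodgeOfBasis e 4 3 rfl α ![e 3, e 4, e 6] = α ![e 0, e 1, e 2, e 5] ∧
    hodgeOfBasis e 4 3 rfl α ![e 3, e 4, e 5] = -α ![e 0, e 1, e 2, e 6] ∧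
    hodgeOfBasis e 4 3 rfl α ![e 2, e 5, e 6] = α ![e 0, e 1, e 3, e 4] ∧
    hodgeOfBasis e 4 3 rfl α ![e 2, e 4, e 6] = -α ![e 0, e 1, e 3, e 5] ∧
    hodgeOfBasis e 4 3 rfl α ![e 2, e 4, e 5] = α ![e 0, e 1, e 3, e 6] := by
  and_intros <;> first
    | exact hodgeOfBasis_4_3_pos e α (by decide) (by decide) (by decide)
    | exact hodgeOfBasis_4_3_neg e α (by decide) (by decide) (by decide)

@[simp]
theorem hodgeOfBasis_4_3_table_1 (e : Module.Basis (Fin 7) ℝ V) (α : Form V 4) :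
    hodgeOfBasis e 4 3 rfl α ![e 2, e 3, e 6] = α ![e 0, e 1, e 4, e 5] ∧
    hodgeOfBasis e 4 3 rfl α ![e 2, e 3, e 5] = -α ![e 0, e 1, e 4, e 6] ∧
    hodgeOfBasis e 4 3 rfl α ![e 2, e 3, e 4] = α ![e 0, e 1, e 5, e 6] ∧
    hodgeOfBasis e 4 3 rfl α ![e 1, e 5, e 6] = -α ![e 0, e 2, e 3, e 4] ∧
    hodgeOfBasis e 4 3 rfl α ![e 1, e 4, e 6] = α ![e 0, e 2, e 3, e 5] ∧
    hodgeOfBasis e 4 3 rfl α ![e 1, e 4, e 5] = -α ![e 0, e 2, e 3, e 6] ∧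
    hodgeOfBasis e 4 3 rfl α ![e 1, e 3, e 6] = -α ![e 0, e 2, e 4, e 5] := by
  and_intros <;> first
    | exact hodgeOfBasis_4_3_pos e α (by decide) (by decide) (by decide)
    | exact hodgeOfBasis_4_3_neg e α (by decide) (by decide) (by decide)

@[simp]
theorem hodgeOfBasis_4_3_table_2 (e : Module.Basis (Fin 7) ℝ V) (α : Form V 4) :
    hodgeOfBasis e 4 3 rfl α ![e 1, e 3, e 5] = α ![e 0, e 2, e 4, e 6] ∧
    hodgeOfBasis e 4 3 rfl α ![e 1, e 3, e 4] = -α ![e 0, e 2, e 5, e 6] ∧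
    hodgeOfBasis e 4 3 rfl α ![e 1, e 2, e 6] = α ![e 0, e 3, e 4, e 5] ∧
    hodgeOfBasis e 4 3 rfl α ![e 1, e 2, e 5] = -α ![e 0, e 3, e 4, e 6] ∧
    hodgeOfBasis e 4 3 rfl α ![e 1, e 2, e 4] = α ![e 0, e 3, e 5, e 6] ∧
    hodgeOfBasis e 4 3 rfl α ![e 1, e 2, e 3] = -α ![e 0, e 4, e 5, e 6] ∧
    hodgeOfBasis e 4 3 rfl α ![e 0, e 5, e 6] = α ![e 1, e 2, e 3, e 4] := by
  and_intros <;> first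
    | exact hodgeOfBasis_4_3_pos e α (by decide) (by decide) (by decide)
    | exact hodgeOfBasis_4_3_neg e α (by decide) (by decide) (by decide)

@[simp]
theorem hodgeOfBasis_4_3_table_3 (e : Module.Basis (Fin 7) ℝ V) (α : Form V 4) :
    hodgeOfBasis e 4 3 rfl α ![e 0, e 4, e 6] = -α ![e 1, e 2, e 3, e 5] ∧
    hodgeOfBasis e 4 3 rfl α ![e 0, e 4, e 5] = α ![e 1, e 2, e 3, e 6] ∧
    hodgeOfBasis e 4 3 rfl α ![e 0, e 3, e 6] = α ![e 1, e 2, e 4, e 5] ∧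
    hodgeOfBasis e 4 3 rfl α ![e 0, e 3, e 5] = -α ![e 1, e 2, e 4, e 6] ∧
    hodgeOfBasis e 4 3 rfl α ![e 0, e 3, e 4] = α ![e 1, e 2, e 5, e 6] ∧
    hodgeOfBasis e 4 3 rfl α ![e 0, e 2, e 6] = -α ![e 1, e 3, e 4, e 5] ∧
    hodgeOfBasis e 4 3 rfl α ![e 0, e 2, e 5] = α ![e 1, e 3, e 4, e 6] := by
  and_intros <;> first
    | exact hodgeOfBasis_4_3_pos e α (by decide) (by decide) (by decide)
    | exact hodgeOfBasis_4_3_neg e α (by decide) (by decide) (by decide)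

@[simp]
theorem hodgeOfBasis_4_3_table_4 (e : Module.Basis (Fin 7) ℝ V) (α : Form V 4) :
    hodgeOfBasis e 4 3 rfl α ![e 0, e 2, e 4] = -α ![e 1, e 3, e 5, e 6] ∧
    hodgeOfBasis e 4 3 rfl α ![e 0, e 2, e 3] = α ![e 1, e 4, e 5, e 6] ∧
    hodgeOfBasis e 4 3 rfl α ![e 0, e 1, e 6] = α ![e 2, e 3, e 4, e 5] ∧
    hodgeOfBasis e 4 3 rfl α ![e 0, e 1, e 5] = -α ![e 2, e 3, e 4, e 6] ∧
    hodgeOfBasis e 4 3 rfl α ![e 0, e 1, e 4] = α ![e 2, e 3, e 5, e 6] ∧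
    hodgeOfBasis e 4 3 rfl α ![e 0, e 1, e 3] = -α ![e 2, e 4, e 5, e 6] ∧
    hodgeOfBasis e 4 3 rfl α ![e 0, e 1, e 2] = α ![e 3, e 4, e 5, e 6] := by
  and_intros <;> first
    | exact hodgeOfBasis_4_3_pos e α (by decide) (by decide) (by decide)
    | exact hodgeOfBasis_4_3_neg e α (by decide) (by decide) (by decide)

theorem hodgeOfBasis_5_2_pos (f : Module.Basis (Fin 7) ℝ V) (α : Form V 5) {a b c d e p q : Fin 7}
    (hI : StrictMono ![a, b, c, d, e]) (hK : Function.Injective ![a, b, c, d, e, p, q])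
    (hs : inversionSign ![a, b, c, d, e, p, q] = 1) :
    hodgeOfBasis f 5 2 rfl α ![f p, f q] = α ![f a, f b, f c, f d, f e] := by
  have h₁ : Fin.append ![a, b, c, d, e] ![p, q] ∘ Fin.cast (rfl : 5 + 2 = 7).symm
      = ![a, b, c, d, e, p, q] := by
    simp [funext_iff, Fin.forall_fin_succ, Fin.append, Fin.addCases]
  have h₂ : ![f a, f b, f c, f d, f e] = fun i => f (![a, b, c, d, e] i) := by
    simp [funext_iff, Fin.forall_fin_succ]
  have h₃ : ![f p, f q] = fun i => f (![p, q] i) := by simp [funext_iff, Fin.forall_fin_succ]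
  have := @hodgeOfBasis_apply_basis_pos V 7 5 2 _ _ f rfl ![a, b, c, d, e] ![p, q]
    ![a, b, c, d, e, p, q] hI hK
  exact this h₁ hs α h₂ h₃

theorem hodgeOfBasis_5_2_neg (f : Module.Basis (Fin 7) ℝ V) (α : Form V 5) {a b c d e p q : Fin 7}
    (hI : StrictMono ![a, b, c, d, e]) (hK : Function.Injective ![a, b, c, d, e, p, q])
    (hs : inversionSign ![a, b, c, d, e, p, q] = -1) :
    hodgeOfBasis f 5 2 rfl α ![f p, f q] = -α ![f a, f b, f c, f d, f e] := by
  have h₁ : Fin.append ![a, b, c, d, e] ![p, q] ∘ Fin.cast (rfl : 5 + 2 = 7).symm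
      = ![a, b, c, d, e, p, q] := by
    simp [funext_iff, Fin.forall_fin_succ, Fin.append, Fin.addCases]
  have h₂ : ![f a, f b, f c, f d, f e] = fun i => f (![a, b, c, d, e] i) := by
    simp [funext_iff, Fin.forall_fin_succ]
  have h₃ : ![f p, f q] = fun i => f (![p, q] i) := by simp [funext_iff, Fin.forall_fin_succ]
  have := @hodgeOfBasis_apply_basis_neg V 7 5 2 _ _ f rfl ![a, b, c, d, e] ![p, q]
    ![a, b, c, d, e, p, q] hI hK
  exact this h₁ hs α h₂ h₃

@[simp]
theorem hodgeOfBasis_5_2_table_0 (e : Module.Basis (Fin 7) ℝ V) (α : Form V 5) :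
    hodgeOfBasis e 5 2 rfl α ![e 5, e 6] = α ![e 0, e 1, e 2, e 3, e 4] ∧
    hodgeOfBasis e 5 2 rfl α ![e 4, e 6] = -α ![e 0, e 1, e 2, e 3, e 5] ∧
    hodgeOfBasis e 5 2 rfl α ![e 4, e 5] = α ![e 0, e 1, e 2, e 3, e 6] ∧
    hodgeOfBasis e 5 2 rfl α ![e 3, e 6] = α ![e 0, e 1, e 2, e 4, e 5] ∧
    hodgeOfBasis e 5 2 rfl α ![e 3, e 5] = -α ![e 0, e 1, e 2, e 4, e 6] ∧
    hodgeOfBasis e 5 2 rfl α ![e 3, e 4] = α ![e 0, e 1, e 2, e 5, e 6] ∧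
    hodgeOfBasis e 5 2 rfl α ![e 2, e 6] = -α ![e 0, e 1, e 3, e 4, e 5] := by
  and_intros <;> first
    | exact hodgeOfBasis_5_2_pos e α (by decide) (by decide) (by decide)
    | exact hodgeOfBasis_5_2_neg e α (by decide) (by decide) (by decide)

@[simp]
theorem hodgeOfBasis_5_2_table_1 (e : Module.Basis (Fin 7) ℝ V) (α : Form V 5) :
    hodgeOfBasis e 5 2 rfl α ![e 2, e 5] = α ![e 0, e 1, e 3, e 4, e 6] ∧
    hodgeOfBasis e 5 2 rfl α ![e 2, e 4] = -α ![e 0, e 1, e 3, e 5, e 6] ∧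
    hodgeOfBasis e 5 2 rfl α ![e 2, e 3] = α ![e 0, e 1, e 4, e 5, e 6] ∧
    hodgeOfBasis e 5 2 rfl α ![e 1, e 6] = α ![e 0, e 2, e 3, e 4, e 5] ∧
    hodgeOfBasis e 5 2 rfl α ![e 1, e 5] = -α ![e 0, e 2, e 3, e 4, e 6] ∧
    hodgeOfBasis e 5 2 rfl α ![e 1, e 4] = α ![e 0, e 2, e 3, e 5, e 6] ∧
    hodgeOfBasis e 5 2 rfl α ![e 1, e 3] = -α ![e 0, e 2, e 4, e 5, e 6] := by
  and_intros <;> first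
    | exact hodgeOfBasis_5_2_pos e α (by decide) (by decide) (by decide)
    | exact hodgeOfBasis_5_2_neg e α (by decide) (by decide) (by decide)

@[simp]
theorem hodgeOfBasis_5_2_table_2 (e : Module.Basis (Fin 7) ℝ V) (α : Form V 5) :
    hodgeOfBasis e 5 2 rfl α ![e 1, e 2] = α ![e 0, e 3, e 4, e 5, e 6] ∧
    hodgeOfBasis e 5 2 rfl α ![e 0, e 6] = -α ![e 1, e 2, e 3, e 4, e 5] ∧
    hodgeOfBasis e 5 2 rfl α ![e 0, e 5] = α ![e 1, e 2, e 3, e 4, e 6] ∧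
    hodgeOfBasis e 5 2 rfl α ![e 0, e 4] = -α ![e 1, e 2, e 3, e 5, e 6] ∧
    hodgeOfBasis e 5 2 rfl α ![e 0, e 3] = α ![e 1, e 2, e 4, e 5, e 6] ∧
    hodgeOfBasis e 5 2 rfl α ![e 0, e 2] = -α ![e 1, e 3, e 4, e 5, e 6] ∧
    hodgeOfBasis e 5 2 rfl α ![e 0, e 1] = α ![e 2, e 3, e 4, e 5, e 6] := by
  and_intros <;> first
    | exact hodgeOfBasis_5_2_pos e α (by decide) (by decide) (by decide)
    | exact hodgeOfBasis_5_2_neg e α (by decide) (by decide) (by decide)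
end Frames

/-! ### Extensionality on increasing multi-indices. -/

section Frames

variable {V : Type*} [AddCommGroup V] [Module ℝ V]

set_option maxRecDepth 8000

/-- The increasing multi-indices of length `2`. -/
def sortedTwo : List (Fin 7 × Fin 7) :=
  [(0, 1), (0, 2), (0, 3), (0, 4), (0, 5), (0, 6), (1, 2), (1, 3), (1, 4), (1, 5), (1, 6),
   (2, 3), (2, 4), (2, 5), (2, 6), (3, 4), (3, 5), (3, 6), (4, 5), (4, 6), (5, 6)]

/-- Equality of forms becomes one literal conjunction, which `simp` can evaluate with the tables. It
is definitionally `List.Forall` over the list of increasing multi-indices, whose completeness is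
decided by evaluation. -/
theorem form_ext_two (e : Module.Basis (Fin 7) ℝ V) {f g : Form V 2}
    (hfg : f ![e 0, e 1] = g ![e 0, e 1] ∧
      f ![e 0, e 2] = g ![e 0, e 2] ∧
      f ![e 0, e 3] = g ![e 0, e 3] ∧
      f ![e 0, e 4] = g ![e 0, e 4] ∧
      f ![e 0, e 5] = g ![e 0, e 5] ∧
      f ![e 0, e 6] = g ![e 0, e 6] ∧
      f ![e 1, e 2] = g ![e 1, e 2] ∧
      f ![e 1, e 3] = g ![e 1, e 3] ∧
      f ![e 1, e 4] = g ![e 1, e 4] ∧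
      f ![e 1, e 5] = g ![e 1, e 5] ∧
      f ![e 1, e 6] = g ![e 1, e 6] ∧
      f ![e 2, e 3] = g ![e 2, e 3] ∧
      f ![e 2, e 4] = g ![e 2, e 4] ∧
      f ![e 2, e 5] = g ![e 2, e 5] ∧
      f ![e 2, e 6] = g ![e 2, e 6] ∧
      f ![e 3, e 4] = g ![e 3, e 4] ∧
      f ![e 3, e 5] = g ![e 3, e 5] ∧
      f ![e 3, e 6] = g ![e 3, e 6] ∧
      f ![e 4, e 5] = g ![e 4, e 5] ∧
      f ![e 4, e 6] = g ![e 4, e 6] ∧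
      f ![e 5, e 6] = g ![e 5, e 6]) :
    f = g := by
  have hfg' : sortedTwo.Forall fun x =>
      f ![e x.1, e x.2] =
        g ![e x.1, e x.2] := hfg
  have key : ∀ a b : Fin 7, a < b → (a, b) ∈ sortedTwo := by
    decide
  refine form_ext_strictMono e fun I hI => ?_
  have h : ∀ a b : Fin 2, a < b → I a < I b := fun a b hab => hI hab
  have hv : (fun a => e (I a)) = ![e (I 0), e (I 1)] := by
    simp [funext_iff, Fin.forall_fin_succ]
  rw [hv]
  exact List.forall_iff_forall_mem.1 hfg' _
    (key (I 0) (I 1) (h 0 1 (by decide)))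

/-- The increasing multi-indices of length `3`. -/
def sortedThree : List (Fin 7 × Fin 7 × Fin 7) :=
  [(0, 1, 2), (0, 1, 3), (0, 1, 4), (0, 1, 5), (0, 1, 6), (0, 2, 3), (0, 2, 4), (0, 2, 5),
   (0, 2, 6), (0, 3, 4), (0, 3, 5), (0, 3, 6), (0, 4, 5), (0, 4, 6), (0, 5, 6), (1, 2, 3),
   (1, 2, 4), (1, 2, 5), (1, 2, 6), (1, 3, 4), (1, 3, 5), (1, 3, 6), (1, 4, 5), (1, 4, 6),
   (1, 5, 6), (2, 3, 4), (2, 3, 5), (2, 3, 6), (2, 4, 5), (2, 4, 6), (2, 5, 6), (3, 4, 5),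
   (3, 4, 6), (3, 5, 6), (4, 5, 6)]

theorem form_ext_three (e : Module.Basis (Fin 7) ℝ V) {f g : Form V 3}
    (hfg : f ![e 0, e 1, e 2] = g ![e 0, e 1, e 2] ∧
      f ![e 0, e 1, e 3] = g ![e 0, e 1, e 3] ∧
      f ![e 0, e 1, e 4] = g ![e 0, e 1, e 4] ∧
      f ![e 0, e 1, e 5] = g ![e 0, e 1, e 5] ∧
      f ![e 0, e 1, e 6] = g ![e 0, e 1, e 6] ∧
      f ![e 0, e 2, e 3] = g ![e 0, e 2, e 3] ∧
      f ![e 0, e 2, e 4] = g ![e 0, e 2, e 4] ∧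
      f ![e 0, e 2, e 5] = g ![e 0, e 2, e 5] ∧
      f ![e 0, e 2, e 6] = g ![e 0, e 2, e 6] ∧
      f ![e 0, e 3, e 4] = g ![e 0, e 3, e 4] ∧
      f ![e 0, e 3, e 5] = g ![e 0, e 3, e 5] ∧
      f ![e 0, e 3, e 6] = g ![e 0, e 3, e 6] ∧
      f ![e 0, e 4, e 5] = g ![e 0, e 4, e 5] ∧
      f ![e 0, e 4, e 6] = g ![e 0, e 4, e 6] ∧
      f ![e 0, e 5, e 6] = g ![e 0, e 5, e 6] ∧
      f ![e 1, e 2, e 3] = g ![e 1, e 2, e 3] ∧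
      f ![e 1, e 2, e 4] = g ![e 1, e 2, e 4] ∧
      f ![e 1, e 2, e 5] = g ![e 1, e 2, e 5] ∧
      f ![e 1, e 2, e 6] = g ![e 1, e 2, e 6] ∧
      f ![e 1, e 3, e 4] = g ![e 1, e 3, e 4] ∧
      f ![e 1, e 3, e 5] = g ![e 1, e 3, e 5] ∧
      f ![e 1, e 3, e 6] = g ![e 1, e 3, e 6] ∧
      f ![e 1, e 4, e 5] = g ![e 1, e 4, e 5] ∧
      f ![e 1, e 4, e 6] = g ![e 1, e 4, e 6] ∧
      f ![e 1, e 5, e 6] = g ![e 1, e 5, e 6] ∧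
      f ![e 2, e 3, e 4] = g ![e 2, e 3, e 4] ∧
      f ![e 2, e 3, e 5] = g ![e 2, e 3, e 5] ∧
      f ![e 2, e 3, e 6] = g ![e 2, e 3, e 6] ∧
      f ![e 2, e 4, e 5] = g ![e 2, e 4, e 5] ∧
      f ![e 2, e 4, e 6] = g ![e 2, e 4, e 6] ∧
      f ![e 2, e 5, e 6] = g ![e 2, e 5, e 6] ∧
      f ![e 3, e 4, e 5] = g ![e 3, e 4, e 5] ∧
      f ![e 3, e 4, e 6] = g ![e 3, e 4, e 6] ∧
      f ![e 3, e 5, e 6] = g ![e 3, e 5, e 6] ∧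
      f ![e 4, e 5, e 6] = g ![e 4, e 5, e 6]) :
    f = g := by
  have hfg' : sortedThree.Forall fun x =>
      f ![e x.1, e x.2.1, e x.2.2] =
        g ![e x.1, e x.2.1, e x.2.2] := hfg
  have key : ∀ a b : Fin 7, a < b → ∀ c, b < c → (a, b, c) ∈ sortedThree := by
    decide
  refine form_ext_strictMono e fun I hI => ?_
  have h : ∀ a b : Fin 3, a < b → I a < I b := fun a b hab => hI hab
  have hv : (fun a => e (I a)) = ![e (I 0), e (I 1), e (I 2)] := by
    simp [funext_iff, Fin.forall_fin_succ]
  rw [hv]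
  exact List.forall_iff_forall_mem.1 hfg' _
    (key (I 0) (I 1) (h 0 1 (by decide)) (I 2) (h 1 2 (by decide)))

/-- The increasing multi-indices of length `4`. -/
def sortedFour : List (Fin 7 × Fin 7 × Fin 7 × Fin 7) :=
  [(0, 1, 2, 3), (0, 1, 2, 4), (0, 1, 2, 5), (0, 1, 2, 6), (0, 1, 3, 4), (0, 1, 3, 5),
   (0, 1, 3, 6), (0, 1, 4, 5), (0, 1, 4, 6), (0, 1, 5, 6), (0, 2, 3, 4), (0, 2, 3, 5),
   (0, 2, 3, 6), (0, 2, 4, 5), (0, 2, 4, 6), (0, 2, 5, 6), (0, 3, 4, 5), (0, 3, 4, 6),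
   (0, 3, 5, 6), (0, 4, 5, 6), (1, 2, 3, 4), (1, 2, 3, 5), (1, 2, 3, 6), (1, 2, 4, 5),
   (1, 2, 4, 6), (1, 2, 5, 6), (1, 3, 4, 5), (1, 3, 4, 6), (1, 3, 5, 6), (1, 4, 5, 6),
   (2, 3, 4, 5), (2, 3, 4, 6), (2, 3, 5, 6), (2, 4, 5, 6), (3, 4, 5, 6)]

theorem form_ext_four (e : Module.Basis (Fin 7) ℝ V) {f g : Form V 4}
    (hfg : f ![e 0, e 1, e 2, e 3] = g ![e 0, e 1, e 2, e 3] ∧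
      f ![e 0, e 1, e 2, e 4] = g ![e 0, e 1, e 2, e 4] ∧
      f ![e 0, e 1, e 2, e 5] = g ![e 0, e 1, e 2, e 5] ∧
      f ![e 0, e 1, e 2, e 6] = g ![e 0, e 1, e 2, e 6] ∧
      f ![e 0, e 1, e 3, e 4] = g ![e 0, e 1, e 3, e 4] ∧
      f ![e 0, e 1, e 3, e 5] = g ![e 0, e 1, e 3, e 5] ∧
      f ![e 0, e 1, e 3, e 6] = g ![e 0, e 1, e 3, e 6] ∧
      f ![e 0, e 1, e 4, e 5] = g ![e 0, e 1, e 4, e 5] ∧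
      f ![e 0, e 1, e 4, e 6] = g ![e 0, e 1, e 4, e 6] ∧
      f ![e 0, e 1, e 5, e 6] = g ![e 0, e 1, e 5, e 6] ∧
      f ![e 0, e 2, e 3, e 4] = g ![e 0, e 2, e 3, e 4] ∧
      f ![e 0, e 2, e 3, e 5] = g ![e 0, e 2, e 3, e 5] ∧
      f ![e 0, e 2, e 3, e 6] = g ![e 0, e 2, e 3, e 6] ∧
      f ![e 0, e 2, e 4, e 5] = g ![e 0, e 2, e 4, e 5] ∧
      f ![e 0, e 2, e 4, e 6] = g ![e 0, e 2, e 4, e 6] ∧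
      f ![e 0, e 2, e 5, e 6] = g ![e 0, e 2, e 5, e 6] ∧
      f ![e 0, e 3, e 4, e 5] = g ![e 0, e 3, e 4, e 5] ∧
      f ![e 0, e 3, e 4, e 6] = g ![e 0, e 3, e 4, e 6] ∧
      f ![e 0, e 3, e 5, e 6] = g ![e 0, e 3, e 5, e 6] ∧
      f ![e 0, e 4, e 5, e 6] = g ![e 0, e 4, e 5, e 6] ∧
      f ![e 1, e 2, e 3, e 4] = g ![e 1, e 2, e 3, e 4] ∧
      f ![e 1, e 2, e 3, e 5] = g ![e 1, e 2, e 3, e 5] ∧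
      f ![e 1, e 2, e 3, e 6] = g ![e 1, e 2, e 3, e 6] ∧
      f ![e 1, e 2, e 4, e 5] = g ![e 1, e 2, e 4, e 5] ∧
      f ![e 1, e 2, e 4, e 6] = g ![e 1, e 2, e 4, e 6] ∧
      f ![e 1, e 2, e 5, e 6] = g ![e 1, e 2, e 5, e 6] ∧
      f ![e 1, e 3, e 4, e 5] = g ![e 1, e 3, e 4, e 5] ∧
      f ![e 1, e 3, e 4, e 6] = g ![e 1, e 3, e 4, e 6] ∧
      f ![e 1, e 3, e 5, e 6] = g ![e 1, e 3, e 5, e 6] ∧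
      f ![e 1, e 4, e 5, e 6] = g ![e 1, e 4, e 5, e 6] ∧
      f ![e 2, e 3, e 4, e 5] = g ![e 2, e 3, e 4, e 5] ∧
      f ![e 2, e 3, e 4, e 6] = g ![e 2, e 3, e 4, e 6] ∧
      f ![e 2, e 3, e 5, e 6] = g ![e 2, e 3, e 5, e 6] ∧
      f ![e 2, e 4, e 5, e 6] = g ![e 2, e 4, e 5, e 6] ∧
      f ![e 3, e 4, e 5, e 6] = g ![e 3, e 4, e 5, e 6]) :
    f = g := by
  have hfg' : sortedFour.Forall fun x =>
      f ![e x.1, e x.2.1, e x.2.2.1, e x.2.2.2] =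
        g ![e x.1, e x.2.1, e x.2.2.1, e x.2.2.2] := hfg
  have key : ∀ a b : Fin 7, a < b → ∀ c, b < c → ∀ d, c < d → (a, b, c, d) ∈ sortedFour := by
    decide
  refine form_ext_strictMono e fun I hI => ?_
  have h : ∀ a b : Fin 4, a < b → I a < I b := fun a b hab => hI hab
  have hv : (fun a => e (I a)) = ![e (I 0), e (I 1), e (I 2), e (I 3)] := by
    simp [funext_iff, Fin.forall_fin_succ]
  rw [hv]
  exact List.forall_iff_forall_mem.1 hfg' _
    (key (I 0) (I 1) (h 0 1 (by decide)) (I 2) (h 1 2 (by decide)) (I 3) (h 2 3 (by decide)))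

/-- The increasing multi-indices of length `5`. -/
def sortedFive : List (Fin 7 × Fin 7 × Fin 7 × Fin 7 × Fin 7) :=
  [(0, 1, 2, 3, 4), (0, 1, 2, 3, 5), (0, 1, 2, 3, 6), (0, 1, 2, 4, 5), (0, 1, 2, 4, 6),
   (0, 1, 2, 5, 6), (0, 1, 3, 4, 5), (0, 1, 3, 4, 6), (0, 1, 3, 5, 6), (0, 1, 4, 5, 6),
   (0, 2, 3, 4, 5), (0, 2, 3, 4, 6), (0, 2, 3, 5, 6), (0, 2, 4, 5, 6), (0, 3, 4, 5, 6),
   (1, 2, 3, 4, 5), (1, 2, 3, 4, 6), (1, 2, 3, 5, 6), (1, 2, 4, 5, 6), (1, 3, 4, 5, 6),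
   (2, 3, 4, 5, 6)]

theorem form_ext_five (e : Module.Basis (Fin 7) ℝ V) {f g : Form V 5}
    (hfg : f ![e 0, e 1, e 2, e 3, e 4] = g ![e 0, e 1, e 2, e 3, e 4] ∧
      f ![e 0, e 1, e 2, e 3, e 5] = g ![e 0, e 1, e 2, e 3, e 5] ∧
      f ![e 0, e 1, e 2, e 3, e 6] = g ![e 0, e 1, e 2, e 3, e 6] ∧
      f ![e 0, e 1, e 2, e 4, e 5] = g ![e 0, e 1, e 2, e 4, e 5] ∧
      f ![e 0, e 1, e 2, e 4, e 6] = g ![e 0, e 1, e 2, e 4, e 6] ∧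
      f ![e 0, e 1, e 2, e 5, e 6] = g ![e 0, e 1, e 2, e 5, e 6] ∧
      f ![e 0, e 1, e 3, e 4, e 5] = g ![e 0, e 1, e 3, e 4, e 5] ∧
      f ![e 0, e 1, e 3, e 4, e 6] = g ![e 0, e 1, e 3, e 4, e 6] ∧
      f ![e 0, e 1, e 3, e 5, e 6] = g ![e 0, e 1, e 3, e 5, e 6] ∧
      f ![e 0, e 1, e 4, e 5, e 6] = g ![e 0, e 1, e 4, e 5, e 6] ∧
      f ![e 0, e 2, e 3, e 4, e 5] = g ![e 0, e 2, e 3, e 4, e 5] ∧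
      f ![e 0, e 2, e 3, e 4, e 6] = g ![e 0, e 2, e 3, e 4, e 6] ∧
      f ![e 0, e 2, e 3, e 5, e 6] = g ![e 0, e 2, e 3, e 5, e 6] ∧
      f ![e 0, e 2, e 4, e 5, e 6] = g ![e 0, e 2, e 4, e 5, e 6] ∧
      f ![e 0, e 3, e 4, e 5, e 6] = g ![e 0, e 3, e 4, e 5, e 6] ∧
      f ![e 1, e 2, e 3, e 4, e 5] = g ![e 1, e 2, e 3, e 4, e 5] ∧
      f ![e 1, e 2, e 3, e 4, e 6] = g ![e 1, e 2, e 3, e 4, e 6] ∧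
      f ![e 1, e 2, e 3, e 5, e 6] = g ![e 1, e 2, e 3, e 5, e 6] ∧
      f ![e 1, e 2, e 4, e 5, e 6] = g ![e 1, e 2, e 4, e 5, e 6] ∧
      f ![e 1, e 3, e 4, e 5, e 6] = g ![e 1, e 3, e 4, e 5, e 6] ∧
      f ![e 2, e 3, e 4, e 5, e 6] = g ![e 2, e 3, e 4, e 5, e 6]) :
    f = g := by
  have hfg' : sortedFive.Forall fun x =>
      f ![e x.1, e x.2.1, e x.2.2.1, e x.2.2.2.1, e x.2.2.2.2] =
        g ![e x.1, e x.2.1, e x.2.2.1, e x.2.2.2.1, e x.2.2.2.2] := hfg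
  have key : ∀ a b : Fin 7, a < b → ∀ c, b < c → ∀ d, c < d → ∀ p, d < p → (a, b, c, d, p)
    ∈ sortedFive := by
    decide
  refine form_ext_strictMono e fun I hI => ?_
  have h : ∀ a b : Fin 5, a < b → I a < I b := fun a b hab => hI hab
  have hv : (fun a => e (I a)) = ![e (I 0), e (I 1), e (I 2), e (I 3), e (I 4)] := by
    simp [funext_iff, Fin.forall_fin_succ]
  rw [hv]
  exact List.forall_iff_forall_mem.1 hfg' _
    (key (I 0) (I 1) (h 0 1 (by decide)) (I 2) (h 1 2 (by decide)) (I 3) (h 2 3 (by decide)) (I 4)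
      (h 3 4 (by decide)))

/-- The increasing multi-indices of length `6`. -/
def sortedSix : List (Fin 7 × Fin 7 × Fin 7 × Fin 7 × Fin 7 × Fin 7) :=
  [(0, 1, 2, 3, 4, 5), (0, 1, 2, 3, 4, 6), (0, 1, 2, 3, 5, 6), (0, 1, 2, 4, 5, 6),
   (0, 1, 3, 4, 5, 6), (0, 2, 3, 4, 5, 6), (1, 2, 3, 4, 5, 6)]

theorem form_ext_six (e : Module.Basis (Fin 7) ℝ V) {f g : Form V 6}
    (hfg : f ![e 0, e 1, e 2, e 3, e 4, e 5] = g ![e 0, e 1, e 2, e 3, e 4, e 5] ∧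
      f ![e 0, e 1, e 2, e 3, e 4, e 6] = g ![e 0, e 1, e 2, e 3, e 4, e 6] ∧
      f ![e 0, e 1, e 2, e 3, e 5, e 6] = g ![e 0, e 1, e 2, e 3, e 5, e 6] ∧
      f ![e 0, e 1, e 2, e 4, e 5, e 6] = g ![e 0, e 1, e 2, e 4, e 5, e 6] ∧
      f ![e 0, e 1, e 3, e 4, e 5, e 6] = g ![e 0, e 1, e 3, e 4, e 5, e 6] ∧
      f ![e 0, e 2, e 3, e 4, e 5, e 6] = g ![e 0, e 2, e 3, e 4, e 5, e 6] ∧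
      f ![e 1, e 2, e 3, e 4, e 5, e 6] = g ![e 1, e 2, e 3, e 4, e 5, e 6]) :
    f = g := by
  have hfg' : sortedSix.Forall fun x =>
      f ![e x.1, e x.2.1, e x.2.2.1, e x.2.2.2.1, e x.2.2.2.2.1, e x.2.2.2.2.2] =
        g ![e x.1, e x.2.1, e x.2.2.1, e x.2.2.2.1, e x.2.2.2.2.1, e x.2.2.2.2.2] := hfg
  have key : ∀ a b : Fin 7, a < b → ∀ c, b < c → ∀ d, c < d → ∀ p, d < p → ∀ q, p < q →
      (a, b, c, d, p, q) ∈ sortedSix := by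
    decide
  refine form_ext_strictMono e fun I hI => ?_
  have h : ∀ a b : Fin 6, a < b → I a < I b := fun a b hab => hI hab
  have hv : (fun a => e (I a)) = ![e (I 0), e (I 1), e (I 2), e (I 3), e (I 4), e (I 5)] := by
    simp [funext_iff, Fin.forall_fin_succ]
  rw [hv]
  exact List.forall_iff_forall_mem.1 hfg' _
    (key (I 0) (I 1) (h 0 1 (by decide)) (I 2) (h 1 2 (by decide)) (I 3) (h 2 3 (by decide)) (I 4)
      (h 3 4 (by decide)) (I 5) (h 4 5 (by decide)))

theorem form_ext_seven (e : Module.Basis (Fin 7) ℝ V) {f g : Form V 7}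
    (hfg : f ![e 0, e 1, e 2, e 3, e 4, e 5, e 6] = g ![e 0, e 1, e 2, e 3, e 4, e 5, e 6]) :
    f = g := by
  have hv : ![e 0, e 1, e 2, e 3, e 4, e 5, e 6] = e := by
    simp [funext_iff, Fin.forall_fin_succ]
  rw [hv] at hfg
  rw [f.eq_smul_basis_det e, g.eq_smul_basis_det e, hfg]

/-- The exterior product of a `1`-form and a `3`-form, as a `4`-form. -/
def wedge13 (α : Form V 1) (β : Form V 3) : Form V 4 := wedge α β

theorem wedge13_apply (e : Module.Basis (Fin 7) ℝ V) (α : Form V 1) (β : Form V 3)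
    (a b c d : V) : wedge13 α β ![a, b, c, d] =
      α ![a] * β ![b, c, d] - α ![b] * β ![a, c, d] + α ![c] * β ![a, b, d]
      - α ![d] * β ![a, b, c] :=
  wedge_apply_1_3 e α β a b c d

/-- The exterior product of a `1`-form and a `4`-form, as a `5`-form. -/
def wedge14 (α : Form V 1) (β : Form V 4) : Form V 5 := wedge α β

theorem wedge14_apply (e : Module.Basis (Fin 7) ℝ V) (α : Form V 1) (β : Form V 4)
    (a b c d p : V) : wedge14 α β ![a, b, c, d, p] =
      α ![a] * β ![b, c, d, p] - α ![b] * β ![a, c, d, p] + α ![c] * β ![a, b, d, p]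
      - α ![d] * β ![a, b, c, p] + α ![p] * β ![a, b, c, d] :=
  wedge_apply_1_4 e α β a b c d p

/-- The exterior product of a `2`-form and a `2`-form, as a `4`-form. -/
def wedge22 (α : Form V 2) (β : Form V 2) : Form V 4 := wedge α β

theorem wedge22_apply (e : Module.Basis (Fin 7) ℝ V) (α : Form V 2) (β : Form V 2)
    (a b c d : V) : wedge22 α β ![a, b, c, d] =
      α ![a, b] * β ![c, d] - α ![a, c] * β ![b, d] + α ![a, d] * β ![b, c]
      + α ![b, c] * β ![a, d] - α ![b, d] * β ![a, c] + α ![c, d] * β ![a, b] :=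
  wedge_apply_2_2 e α β a b c d

/-- The exterior product of a `2`-form and a `3`-form, as a `5`-form. -/
def wedge23 (α : Form V 2) (β : Form V 3) : Form V 5 := wedge α β

theorem wedge23_apply (e : Module.Basis (Fin 7) ℝ V) (α : Form V 2) (β : Form V 3)
    (a b c d p : V) : wedge23 α β ![a, b, c, d, p] =
      α ![a, b] * β ![c, d, p] - α ![a, c] * β ![b, d, p] + α ![a, d] * β ![b, c, p]
      - α ![a, p] * β ![b, c, d] + α ![b, c] * β ![a, d, p]
      - α ![b, d] * β ![a, c, p] + α ![b, p] * β ![a, c, d]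
      + α ![c, d] * β ![a, b, p] - α ![c, p] * β ![a, b, d]
      + α ![d, p] * β ![a, b, c] :=
  wedge_apply_2_3 e α β a b c d p

/-- The exterior product of a `3`-form and a `2`-form, as a `5`-form. -/
def wedge32 (α : Form V 3) (β : Form V 2) : Form V 5 := wedge α β

theorem wedge32_apply (e : Module.Basis (Fin 7) ℝ V) (α : Form V 3) (β : Form V 2)
    (a b c d p : V) : wedge32 α β ![a, b, c, d, p] =
      α ![a, b, c] * β ![d, p] - α ![a, b, d] * β ![c, p] + α ![a, b, p] * β ![c, d]
      + α ![a, c, d] * β ![b, p] - α ![a, c, p] * β ![b, d]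
      + α ![a, d, p] * β ![b, c] - α ![b, c, d] * β ![a, p]
      + α ![b, c, p] * β ![a, d] - α ![b, d, p] * β ![a, c]
      + α ![c, d, p] * β ![a, b] :=
  wedge_apply_3_2 e α β a b c d p

/-- The exterior product of a `3`-form and a `3`-form, as a `6`-form. -/
def wedge33 (α : Form V 3) (β : Form V 3) : Form V 6 := wedge α β

theorem wedge33_apply (e : Module.Basis (Fin 7) ℝ V) (α : Form V 3) (β : Form V 3)
    (a b c d p q : V) : wedge33 α β ![a, b, c, d, p, q] =
      α ![a, b, c] * β ![d, p, q] - α ![a, b, d] * β ![c, p, q]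
      + α ![a, b, p] * β ![c, d, q] - α ![a, b, q] * β ![c, d, p]
      + α ![a, c, d] * β ![b, p, q] - α ![a, c, p] * β ![b, d, q]
      + α ![a, c, q] * β ![b, d, p] + α ![a, d, p] * β ![b, c, q]
      - α ![a, d, q] * β ![b, c, p] + α ![a, p, q] * β ![b, c, d]
      - α ![b, c, d] * β ![a, p, q] + α ![b, c, p] * β ![a, d, q]
      - α ![b, c, q] * β ![a, d, p] - α ![b, d, p] * β ![a, c, q]
      + α ![b, d, q] * β ![a, c, p] - α ![b, p, q] * β ![a, c, d]
      + α ![c, d, p] * β ![a, b, q] - α ![c, d, q] * β ![a, b, p]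
      + α ![c, p, q] * β ![a, b, d] - α ![d, p, q] * β ![a, b, c] :=
  wedge_apply_3_3 e α β a b c d p q

/-- The exterior product of a `3`-form and a `4`-form, as a `7`-form. -/
def wedge34 (α : Form V 3) (β : Form V 4) : Form V 7 := wedge α β

theorem wedge34_apply (e : Module.Basis (Fin 7) ℝ V) (α : Form V 3) (β : Form V 4)
    (a b c d p q r : V) : wedge34 α β ![a, b, c, d, p, q, r] =
      α ![a, b, c] * β ![d, p, q, r] - α ![a, b, d] * β ![c, p, q, r]
      + α ![a, b, p] * β ![c, d, q, r] - α ![a, b, q] * β ![c, d, p, r]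
      + α ![a, b, r] * β ![c, d, p, q] + α ![a, c, d] * β ![b, p, q, r]
      - α ![a, c, p] * β ![b, d, q, r] + α ![a, c, q] * β ![b, d, p, r]
      - α ![a, c, r] * β ![b, d, p, q] + α ![a, d, p] * β ![b, c, q, r]
      - α ![a, d, q] * β ![b, c, p, r] + α ![a, d, r] * β ![b, c, p, q]
      + α ![a, p, q] * β ![b, c, d, r] - α ![a, p, r] * β ![b, c, d, q]
      + α ![a, q, r] * β ![b, c, d, p] - α ![b, c, d] * β ![a, p, q, r]
      + α ![b, c, p] * β ![a, d, q, r] - α ![b, c, q] * β ![a, d, p, r]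
      + α ![b, c, r] * β ![a, d, p, q] - α ![b, d, p] * β ![a, c, q, r]
      + α ![b, d, q] * β ![a, c, p, r] - α ![b, d, r] * β ![a, c, p, q]
      - α ![b, p, q] * β ![a, c, d, r] + α ![b, p, r] * β ![a, c, d, q]
      - α ![b, q, r] * β ![a, c, d, p] + α ![c, d, p] * β ![a, b, q, r]
      - α ![c, d, q] * β ![a, b, p, r] + α ![c, d, r] * β ![a, b, p, q]
      + α ![c, p, q] * β ![a, b, d, r] - α ![c, p, r] * β ![a, b, d, q]
      + α ![c, q, r] * β ![a, b, d, p] - α ![d, p, q] * β ![a, b, c, r]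
      + α ![d, p, r] * β ![a, b, c, q] - α ![d, q, r] * β ![a, b, c, p]
      + α ![p, q, r] * β ![a, b, c, d] := by
  rw [wedge34, wedge_apply_3_4 e]

/-! ### The torsion equations at a point as linear algebra. -/

theorem hodge_assocForm (e : Module.Basis (Fin 7) ℝ V) :
    hodgeOfBasis e 3 4 rfl (assocForm e) = coassoc e := by
  refine form_ext_four e ?_
  simp


/-- The inner product of `ξ` with `eⁱ ∧ φ`, where `φ` is the associative form of the frame `e`. -/
def contrAssoc (e : Module.Basis (Fin 7) ℝ V) (ξ : Form V 4) : Fin 7 → ℝ :=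
  ![ξ ![e 0, e 1, e 3, e 5] - ξ ![e 0, e 1, e 4, e 6] - ξ ![e 0, e 2, e 3, e 6]
    - ξ ![e 0, e 2, e 4, e 5],
    -ξ ![e 0, e 1, e 3, e 4] - ξ ![e 0, e 1, e 5, e 6] - ξ ![e 1, e 2, e 3, e 6]
      - ξ ![e 1, e 2, e 4, e 5],
    -ξ ![e 0, e 2, e 3, e 4] - ξ ![e 0, e 2, e 5, e 6] - ξ ![e 1, e 2, e 3, e 5]
      + ξ ![e 1, e 2, e 4, e 6],
    -ξ ![e 0, e 1, e 2, e 3] - ξ ![e 0, e 3, e 5, e 6] + ξ ![e 1, e 3, e 4, e 6]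
      + ξ ![e 2, e 3, e 4, e 5],
    -ξ ![e 0, e 1, e 2, e 4] - ξ ![e 0, e 4, e 5, e 6] + ξ ![e 1, e 3, e 4, e 5]
      - ξ ![e 2, e 3, e 4, e 6],
    -ξ ![e 0, e 1, e 2, e 5] - ξ ![e 0, e 3, e 4, e 5] - ξ ![e 1, e 4, e 5, e 6]
      - ξ ![e 2, e 3, e 5, e 6],
    -ξ ![e 0, e 1, e 2, e 6] - ξ ![e 0, e 3, e 4, e 6] - ξ ![e 1, e 3, e 5, e 6]
      + ξ ![e 2, e 4, e 5, e 6]]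

/-- The inner product of `ξ` with `eⁱ ∧ ∗φ`, where `φ` is the associative form of the frame `e`. -/
def contrCoassoc (e : Module.Basis (Fin 7) ℝ V) (ξ : Form V 5) : Fin 7 → ℝ :=
  ![ξ ![e 0, e 1, e 2, e 3, e 4] + ξ ![e 0, e 1, e 2, e 5, e 6] + ξ ![e 0, e 3, e 4, e 5, e 6],
    ξ ![e 0, e 1, e 2, e 3, e 5] - ξ ![e 0, e 1, e 2, e 4, e 6] + ξ ![e 1, e 3, e 4, e 5, e 6],
    -ξ ![e 0, e 1, e 2, e 3, e 6] - ξ ![e 0, e 1, e 2, e 4, e 5] + ξ ![e 2, e 3, e 4, e 5, e 6],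
    -ξ ![e 0, e 1, e 3, e 4, e 5] + ξ ![e 0, e 2, e 3, e 4, e 6] + ξ ![e 1, e 2, e 3, e 5, e 6],
    ξ ![e 0, e 1, e 3, e 4, e 6] + ξ ![e 0, e 2, e 3, e 4, e 5] + ξ ![e 1, e 2, e 4, e 5, e 6],
    ξ ![e 0, e 1, e 3, e 5, e 6] - ξ ![e 0, e 2, e 4, e 5, e 6] + ξ ![e 1, e 2, e 3, e 4, e 5],
    -ξ ![e 0, e 1, e 4, e 5, e 6] - ξ ![e 0, e 2, e 3, e 5, e 6] + ξ ![e 1, e 2, e 3, e 4, e 6]]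

/-- The inner product of `ξ` with `∗φ`, where `φ` is the associative form of the frame `e`. -/
def innerCoassoc (e : Module.Basis (Fin 7) ℝ V) (ξ : Form V 4) : ℝ :=
  -ξ ![e 0, e 1, e 3, e 6] - ξ ![e 0, e 1, e 4, e 5] - ξ ![e 0, e 2, e 3, e 5] + ξ ![e 0, e 2, e 4, e 6]
    + ξ ![e 1, e 2, e 3, e 4] + ξ ![e 1, e 2, e 5, e 6] + ξ ![e 3, e 4, e 5, e 6]

/-- The seven equations say that `β` is orthogonal to the forms `ι_{e_i} φ`, which span `Λ²₇`. The
map `β ↦ ∗(φ ∧ β)` has eigenvalue `2` on `Λ²₇` and `-1` on its complement `Λ²₁₄`, so seven of its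
components already give the equations. -/
theorem mem_lam14_iff (e : Module.Basis (Fin 7) ℝ V) (β : Form V 2) :
    hodgeOfBasis e 5 2 rfl (wedge32 (assocForm e) β) = -β ↔
      β ![e 1, e 2] + β ![e 3, e 4] + β ![e 5, e 6] = 0 ∧
      -β ![e 0, e 2] + β ![e 3, e 5] - β ![e 4, e 6] = 0 ∧
      β ![e 0, e 1] - β ![e 3, e 6] - β ![e 4, e 5] = 0 ∧
      -β ![e 0, e 4] - β ![e 1, e 5] + β ![e 2, e 6] = 0 ∧
      β ![e 0, e 3] + β ![e 1, e 6] + β ![e 2, e 5] = 0 ∧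
      -β ![e 0, e 6] + β ![e 1, e 3] - β ![e 2, e 4] = 0 ∧
      β ![e 0, e 5] - β ![e 1, e 4] - β ![e 2, e 3] = 0 := by
  constructor
  · intro h
    have hv : ∀ v, hodgeOfBasis e 5 2 rfl (wedge32 (assocForm e) β) v = -β v := fun v => by
      rw [h]; rfl
    have key := And.intro (hv ![e 0, e 1]) <| And.intro (hv ![e 0, e 2]) <|
      And.intro (hv ![e 0, e 3]) <| And.intro (hv ![e 0, e 4]) <| And.intro (hv ![e 0, e 5]) <|
      And.intro (hv ![e 0, e 6]) (hv ![e 1, e 2])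
    simp [wedge32_apply e] at key
    and_intros <;> linarith
  · intro h
    refine form_ext_two e ?_
    simp [wedge32_apply e]
    and_intros <;> linarith

theorem hodge_hodge_three (e : Module.Basis (Fin 7) ℝ V) (α : Form V 3) :
    hodgeOfBasis e 4 3 rfl (hodgeOfBasis e 3 4 rfl α) = α := by
  refine form_ext_three e ?_
  simp

theorem hodge_hodge_four (e : Module.Basis (Fin 7) ℝ V) (α : Form V 4) :
    hodgeOfBasis e 3 4 rfl (hodgeOfBasis e 4 3 rfl α) = α := by
  refine form_ext_four e ?_
  simp

theorem wedge_assocForm_comm (e : Module.Basis (Fin 7) ℝ V) (β : Form V 2) :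
    wedge23 β (assocForm e) = wedge32 (assocForm e) β := by
  refine form_ext_five e ?_
  simp [wedge23_apply e, wedge32_apply e, add_comm, ← sub_eq_add_neg]

/-- The torsion equations at a point, in a frame. -/
structure IsTorsionAt (e : Module.Basis (Fin 7) ℝ V) (ξ : Form V 4) (ζ : Form V 5)
    (t : TorsionForms V) : Prop where
  d_form : ξ = t.τ₀ • coassoc e + (3 : ℝ) • wedge13 t.τ₁ (assocForm e)
    + hodgeOfBasis e 3 4 rfl t.τ₃
  d_coassoc : ζ = (4 : ℝ) • wedge14 t.τ₁ (coassoc e) + wedge23 t.τ₂ (assocForm e)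
  mem_two : hodgeOfBasis e 5 2 rfl (wedge32 (assocForm e) t.τ₂) = -t.τ₂
  mem_three : wedge33 t.τ₃ (assocForm e) = 0 ∧ wedge34 t.τ₃ (coassoc e) = 0

/-- The form `τ₂ ∧ φ` is orthogonal to each `eⁱ ∧ ∗φ` because `τ₂ ∈ Λ²₁₄`. The forms `eⁱ ∧ ∗φ` are
mutually orthogonal of squared norm `3`, and `12 = 4 · 3`. -/
theorem IsTorsionAt.tau_one_apply {e : Module.Basis (Fin 7) ℝ V} {ξ : Form V 4} {ζ : Form V 5}
    {t : TorsionForms V} (h : IsTorsionAt e ξ ζ t) (i : Fin 7) :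
    contrCoassoc e ζ i = 12 * t.τ₁ ![e i] := by
  have hl := (mem_lam14_iff e _).1 h.mem_two
  rw [h.d_coassoc]
  fin_cases i <;>
  · simp [contrCoassoc, wedge14_apply e, wedge23_apply e]
    linarith

/-- Against `∗φ`, the term `τ₁ ∧ φ` contributes nothing and neither does `∗τ₃`, because `τ₃ ∧ ∗φ =
0`; the factor is `|∗φ|² = 7`. -/
theorem IsTorsionAt.tau_zero_eq {e : Module.Basis (Fin 7) ℝ V} {ξ : Form V 4} {ζ : Form V 5}
    {t : TorsionForms V} (h : IsTorsionAt e ξ ζ t) : innerCoassoc e ξ = 7 * t.τ₀ := by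
  have h3 := congrArg (fun f => f ![e 0, e 1, e 2, e 3, e 4, e 5, e 6]) h.mem_three.2
  simp [wedge34_apply e] at h3
  rw [h.d_form]
  simp [innerCoassoc, wedge13_apply e]
  linarith

/-- The `1`-form with the given values on a basis. -/
def oneForm (e : Module.Basis (Fin 7) ℝ V) (c : Fin 7 → ℝ) : Form V 1 :=
  ∑ i, c i • coordForm e ![i]

theorem oneForm_apply (e : Module.Basis (Fin 7) ℝ V) (c : Fin 7 → ℝ) (i : Fin 7) :
    oneForm e c ![e i] = c i := by
  simp [oneForm, sum_form_apply, coordForm_eq_detForm, detForm_apply, Finsupp.single_apply]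

theorem one_form_ext (e : Module.Basis (Fin 7) ℝ V) {α β : Form V 1}
    (h : ∀ i, α ![e i] = β ![e i]) : α = β := by
  refine Module.Basis.ext_alternating e fun I _ => ?_
  have : (fun a => e (I a)) = ![e (I 0)] := by simp [funext_iff]
  rw [this, h]

/-- The torsion forms at a point exist and are unique, provided that the two expressions for `τ₁`
agree. -/
theorem existsUnique_isTorsionAt (e : Module.Basis (Fin 7) ℝ V) (ξ : Form V 4) (ζ : Form V 5)
    (h : ∀ i, contrAssoc e ξ i = contrCoassoc e ζ i) : ∃! t, IsTorsionAt e ξ ζ t := by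
  -- Each torsion form is solved for in turn: `τ₁` by contraction with `eⁱ ∧ ∗φ`, `τ₂` from `∗(φ ∧
  -- τ₂) = -τ₂`, `τ₀` by contraction with `∗φ`, and `τ₃` as the star of what is left of `ξ`.
  set τ₁ := oneForm e fun i => contrCoassoc e ζ i / 12 with hτ₁
  set τ₂ : Form V 2 := -hodgeOfBasis e 5 2 rfl (ζ - (4 : ℝ) • wedge14 τ₁ (coassoc e))
    with hτ₂
  set τ₀ : ℝ := innerCoassoc e ξ / 7 with hτ₀
  set τ₃ : Form V 3 := hodgeOfBasis e 4 3 rfl (ξ - τ₀ • coassoc e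
    - (3 : ℝ) • wedge13 τ₁ (assocForm e)) with hτ₃
  have h₁ : ∀ i, τ₁ ![e i] = contrCoassoc e ζ i / 12 := fun i => oneForm_apply e _ i
  -- The constant is again `12`, now as `3 · |eⁱ ∧ φ|² = 3 · 4`. Agreement of the two contractions
  -- is exactly what makes `τ₃ ∧ φ` vanish below.
  have h₂ : ∀ i, τ₁ ![e i] = contrAssoc e ξ i / 12 := fun i => by rw [h₁, h]
  refine ⟨⟨τ₀, τ₁, τ₂, τ₃⟩, ⟨?_, ?_, ?_, ?_, ?_⟩, ?_⟩
  · simp only [hτ₃, hodge_hodge_four]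
    abel
  · refine form_ext_five e ?_
    simp [wedge14_apply e, wedge23_apply e, hτ₂, h₁, contrCoassoc]
    and_intros <;> linarith
  · refine (mem_lam14_iff e _).2 ?_
    simp [wedge14_apply e, hτ₂, h₁, contrCoassoc]
    and_intros <;> linarith
  · refine form_ext_six e ?_
    simp [wedge33_apply e, wedge13_apply e, hτ₃, h₂, contrAssoc]
    and_intros <;> linarith
  · refine form_ext_seven e ?_
    simp [wedge34_apply e, wedge13_apply e, hτ₃, hτ₀, innerCoassoc]
    ring
  · rintro ⟨s₀, s₁, s₂, s₃⟩ hs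
    have e₁ : s₁ = τ₁ := one_form_ext e fun i => by
      have := hs.tau_one_apply i
      rw [h₁, this]
      simp
    have e₀ : s₀ = τ₀ := by
      have := hs.tau_zero_eq
      rw [hτ₀, this]
      simp
    have e₂ : s₂ = τ₂ := by
      have h2 := hs.mem_two
      have h5 := hs.d_coassoc
      simp only at h2 h5
      rw [hτ₂, h5, e₁, add_sub_cancel_left, wedge_assocForm_comm, h2, neg_neg]
    have e₃ : s₃ = τ₃ := by
      have h4 := hs.d_form
      simp only at h4
      rw [hτ₃, h4, e₁, e₀, ← hodge_hodge_three e s₃]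
      congr 1
      abel_nf
      simp [hodge_hodge_three]
    rw [e₀, e₁, e₂, e₃]

end Frames

section FrameIndependence

variable {V : Type*} [AddCommGroup V] [Module ℝ V] {n k m : ℕ}

/-! ### Independence of the frame -/

/-- Every injective multi-index is, in exactly one way, an increasing one followed by a permutation.
Sums over all multi-indices are preferred because an orthogonal change of frame acts on each index
separately. -/
theorem sum_strictMono {k n : ℕ} (f : (Fin k → Fin n) → ℝ)
    (hf : ∀ I (σ : Equiv.Perm (Fin k)), f (I ∘ σ) = f I)
    (h0 : ∀ I, ¬ Function.Injective I → f I = 0) :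
    open Classical in
    ∑ I, f I = (k.factorial : ℝ) * ∑ I : Fin k → Fin n with StrictMono I, f I := by
  classical
  have h : ∑ I, f I = ∑ I : Fin k → Fin n with Function.Injective I, f I := by
    rw [Finset.sum_filter]
    exact Finset.sum_congr rfl fun I _ => by split_ifs with hI <;> simp [h0 _, hI]
  rw [h, Finset.mul_sum]
  have h2 : ∑ p ∈ (Finset.univ.filter fun I : Fin k → Fin n => StrictMono I) ×ˢ
      (Finset.univ : Finset (Equiv.Perm (Fin k))), f p.1
      = ∑ I : Fin k → Fin n with Function.Injective I, f I := by
    refine Finset.sum_bij (fun p _ => p.1 ∘ p.2) ?_ ?_ ?_ ?_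
    · rintro ⟨I, σ⟩ hI
      simp only [Finset.mem_product, Finset.mem_filter, Finset.mem_univ, true_and, and_true] at hI
      simpa using hI.injective.comp σ.injective
    · rintro ⟨I, σ⟩ hI ⟨J, ρ⟩ hJ hIJ
      simp only [Finset.mem_product, Finset.mem_filter, Finset.mem_univ, true_and, and_true]
        at hI hJ hIJ
      have hr : Set.range I = Set.range J := by
        rw [← σ.surjective.range_comp I, ← ρ.surjective.range_comp J, hIJ]
      obtain rfl := (StrictMono.range_inj hI hJ).1 hr
      congr 1
      ext1 a
      exact hI.injective (congrFun hIJ a)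
    · intro I hI
      simp only [Finset.mem_filter, Finset.mem_univ, true_and] at hI
      refine ⟨(I ∘ Tuple.sort I, (Tuple.sort I)⁻¹), ?_, ?_⟩
      · simpa using (Tuple.monotone_sort I).strictMono_of_injective
          (hI.comp (Tuple.sort I).injective)
      · funext a
        simp
    · rintro ⟨I, σ⟩ _
      exact (hf I σ).symm
  rw [← h2, Finset.sum_product]
  refine Finset.sum_congr rfl fun I _ => ?_
  simp [Fintype.card_perm]

theorem sum_strictMono_mul (e : Module.Basis (Fin n) ℝ V) (α β : Form V k) :
    open Classical in
    ∑ I : Fin k → Fin n with StrictMono I, α (fun a => e (I a)) * β (fun a => e (I a))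
      = (k.factorial : ℝ)⁻¹ * ∑ I : Fin k → Fin n, α (fun a => e (I a)) * β (fun a => e (I a)) := by
  rw [sum_strictMono, ← mul_assoc, inv_mul_cancel₀, one_mul]
  · exact_mod_cast k.factorial_ne_zero
  · intro I σ
    have h₁ := α.map_perm (fun a => e (I a)) σ
    have h₂ := β.map_perm (fun a => e (I a)) σ
    simp only [Function.comp_def] at h₁ h₂ ⊢
    rw [h₁, h₂]
    rcases Int.units_eq_one_or (Equiv.Perm.sign σ) with h | h <;> simp [h]
  · intro I hI
    obtain ⟨a, b, hab, hne⟩ := Function.not_injective_iff.1 hI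
    rw [α.map_eq_zero_of_eq _ (by simp only [hab]) hne, zero_mul]

/-- The inner product that makes a basis orthonormal. -/
def frameInner (e : Module.Basis (Fin n) ℝ V) (x y : V) : ℝ := ∑ i, e.repr x i * e.repr y i

theorem frameInner_basis (e : Module.Basis (Fin n) ℝ V) (i j : Fin n) :
    frameInner e (e i) (e j) = if i = j then 1 else 0 := by
  simp [frameInner, Finsupp.single_apply]

theorem frameInner_basis_left (e : Module.Basis (Fin n) ℝ V) (i : Fin n) (x : V) :
    frameInner e (e i) x = e.repr x i := by
  simp [frameInner, Finsupp.single_apply]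

theorem frameInner_basis_right (e : Module.Basis (Fin n) ℝ V) (i : Fin n) (x : V) :
    frameInner e x (e i) = e.repr x i := by
  simp [frameInner, Finsupp.single_apply]

theorem sum_repr_mul_repr {e e' : Module.Basis (Fin n) ℝ V}
    (h : ∀ x y, frameInner e x y = frameInner e' x y) (j l : Fin n) :
    ∑ i, e.repr (e' i) j * e.repr (e' i) l = if j = l then 1 else 0 := by
  rw [← frameInner_basis e, h, frameInner]
  refine Finset.sum_congr rfl fun i _ => ?_
  rw [← frameInner_basis_right, ← frameInner_basis_right, h, h, ← frameInner_basis_left,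
    ← frameInner_basis_left]

theorem form_apply_eq_sum (e : Module.Basis (Fin n) ℝ V) (α : Form V k) (v : Fin k → V) :
    α v = ∑ J : Fin k → Fin n, (∏ a, e.repr (v a) (J a)) * α (fun a => e (J a)) := by
  have hv : v = fun a => ∑ j, e.repr (v a) j • e j := by
    funext a
    exact (e.sum_repr (v a)).symm
  conv_lhs => rw [hv]
  change α.toMultilinearMap _ = _
  rw [MultilinearMap.map_sum]
  refine Finset.sum_congr rfl fun r _ => ?_
  rw [MultilinearMap.map_smul_univ]
  rfl

/-- The matrix between two frames orthonormal for the same inner product is orthogonal, and the sum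
over `I` of products of its entries factors over the `k` slots into orthogonality relations. -/
theorem sum_mul_basis_eq {e e' : Module.Basis (Fin n) ℝ V}
    (h : ∀ x y, frameInner e x y = frameInner e' x y) (α β : Form V k) :
    ∑ I : Fin k → Fin n, α (fun a => e' (I a)) * β (fun a => e' (I a))
      = ∑ I : Fin k → Fin n, α (fun a => e (I a)) * β (fun a => e (I a)) := by
  have key : ∀ J L : Fin k → Fin n, ∑ I : Fin k → Fin n,
      (∏ a, e.repr (e' (I a)) (J a)) * ∏ a, e.repr (e' (I a)) (L a) = if J = L then 1 else 0 := by
    intro J L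
    simp only [← Finset.prod_mul_distrib]
    rw [← Fintype.piFinset_univ, ← Finset.prod_univ_sum (fun _ => Finset.univ)
      (fun a i => e.repr (e' i) (J a) * e.repr (e' i) (L a))]
    simp only [sum_repr_mul_repr h]
    split_ifs with hJ
    · subst hJ; simp
    · obtain ⟨a, ha⟩ := Function.ne_iff.1 hJ
      exact Finset.prod_eq_zero (Finset.mem_univ a) (by simp [ha])
  calc _ = ∑ I : Fin k → Fin n, ∑ J : Fin k → Fin n, ∑ L : Fin k → Fin n,
        ((∏ a, e.repr (e' (I a)) (J a)) * ∏ a, e.repr (e' (I a)) (L a)) *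
          (α (fun a => e (J a)) * β (fun a => e (L a))) := by
        refine Finset.sum_congr rfl fun I _ => ?_
        rw [form_apply_eq_sum e α, form_apply_eq_sum e β, Finset.sum_mul_sum]
        refine Finset.sum_congr rfl fun J _ => Finset.sum_congr rfl fun L _ => ?_
        ring
    _ = ∑ J : Fin k → Fin n, ∑ L : Fin k → Fin n, (∑ I : Fin k → Fin n,
        ((∏ a, e.repr (e' (I a)) (J a)) * ∏ a, e.repr (e' (I a)) (L a))) *
          (α (fun a => e (J a)) * β (fun a => e (L a))) := by
        rw [Finset.sum_comm]
        refine Finset.sum_congr rfl fun J _ => ?_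
        rw [Finset.sum_comm]
        simp only [Finset.sum_mul]
    _ = _ := by
        simp only [key, ite_mul, one_mul, zero_mul, Finset.sum_ite_eq, Finset.mem_univ, if_true]

/-- The number `(∗α)(v)` is the inner product of `α` with the `k`-form `w ↦ vol(w, v)`, so it
depends only on the inner product and the volume form. -/
theorem hodgeOfBasis_eq {e e' : Module.Basis (Fin n) ℝ V}
    (h : ∀ x y, frameInner e x y = frameInner e' x y) (hd : e.det = e'.det) (hkm : k + m = n)
    (α : Form V k) : hodgeOfBasis e k m hkm α = hodgeOfBasis e' k m hkm α := by
  ext v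
  -- Insertion fills the leading slots, whereas `v` occupies the trailing ones; hence the flip of
  -- the two blocks.
  let β : Form V k := insertVectors (k := m)
    ((e.det.domDomCongr (finCongr hkm.symm)).domDomCongr finAddFlip) v
  have hβ : ∀ w : Fin k → V, β w = e.det (Fin.append w v ∘ Fin.cast hkm.symm) := by
    intro w
    change e.det _ = e.det _
    congr 1
    funext i
    change Fin.append v w (finAddFlip (Fin.cast hkm.symm i)) = Fin.append w v _
    generalize Fin.cast hkm.symm i = j
    refine Fin.addCases (fun a => ?_) (fun b => ?_) j <;> simp
  rw [hodgeOfBasis_apply, hodgeOfBasis_apply, ← hd]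
  simp only [← hβ]
  rw [sum_strictMono_mul, sum_strictMono_mul, sum_mul_basis_eq h]

theorem frameInner_eq_of_self {e e' : Module.Basis (Fin n) ℝ V} (c : ℝ)
    (h : ∀ x, frameInner e x x = c * frameInner e' x x) (x y : V) :
    frameInner e x y = c * frameInner e' x y := by
  have h1 := h (x + y)
  have h2 := h x
  have h3 := h y
  have hp : ∀ e : Module.Basis (Fin n) ℝ V, frameInner e (x + y) (x + y)
      = frameInner e x x + 2 * frameInner e x y + frameInner e y y := by
    intro e
    simp only [frameInner, map_add, Finsupp.add_apply, Finset.mul_sum, ← Finset.sum_add_distrib]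
    exact Finset.sum_congr rfl fun i _ => by ring
  rw [hp, hp] at h1
  linarith

/-- The identity `(ι_u φ)² ∧ φ = 6 |u|² vol`. -/
theorem curry_sq_wedge_assocForm (e : Module.Basis (Fin 7) ℝ V) (u : V) :
    wedge34 (assocForm e) (wedge22 ((assocForm e).curryLeft u) ((assocForm e).curryLeft u))
      = (6 * frameInner e u u) • e.det := by
  refine form_ext_seven e ?_
  have hv : ![e 0, e 1, e 2, e 3, e 4, e 5, e 6] = e := by
    simp [funext_iff, Fin.forall_fin_succ]
  have hd : e.det ![e 0, e 1, e 2, e 3, e 4, e 5, e 6] = 1 := by rw [hv, e.det_self]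
  have hc : ∀ x y, (assocForm e).curryLeft u ![x, y] = assocForm e ![u, x, y] := fun _ _ => rfl
  rw [AlternatingMap.smul_apply, hd, wedge34_apply e]
  simp [wedge22_apply e, hc, frameInner, Fin.sum_univ_seven]
  ring

/-- Two frames with the same `φ` give the same `(ι_u φ)² ∧ φ`, so `|u|² vol` is the same for both.
If the volume forms differ by the factor `d`, so do the metrics, and the determinant of the Gram
matrix of `e'` gives `1 = d⁷ · d²`. An odd power is injective, so `d = 1`; the orientation is
recovered along with the metric. -/
theorem det_eq_one_of_assocForm_eq {e e' : Module.Basis (Fin 7) ℝ V}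
    (h : assocForm e = assocForm e') : e.det e' = 1 := by
  set d := e.det e' with hd
  have hed : e.det = d • e'.det := AlternatingMap.eq_smul_basis_det e' e.det
  have h1 : ∀ x, frameInner e' x x = d * frameInner e x x := by
    intro x
    have h2 := curry_sq_wedge_assocForm e x
    rw [h, curry_sq_wedge_assocForm e' x, hed] at h2
    have := congrArg (fun f : Form V 7 => f e') h2
    simp only [AlternatingMap.smul_apply, e'.det_self, smul_eq_mul, mul_one] at this
    linarith
  have h3 := frameInner_eq_of_self d h1
  have h4 : (1 : Matrix (Fin 7) (Fin 7) ℝ) = d • ((e.toMatrix e').transpose * e.toMatrix e') := by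
    ext i j
    have := h3 (e' i) (e' j)
    rw [frameInner_basis] at this
    rw [Matrix.one_apply, this]
    simp [Matrix.mul_apply, frameInner, Module.Basis.toMatrix_apply]
  have h5 := congrArg Matrix.det h4
  rw [Matrix.det_one, Matrix.det_smul, Matrix.det_mul, Matrix.det_transpose,
    ← Module.Basis.det_apply, ← hd, Fintype.card_fin] at h5
  have h6 : d ^ 9 = 1 := by rw [h5]; ring
  exact (Odd.strictMono_pow (by decide : Odd 9)).injective (by simpa using h6)

theorem det_eq_of_assocForm_eq {e e' : Module.Basis (Fin 7) ℝ V}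
    (h : assocForm e = assocForm e') : e.det = e'.det := by
  have : e.det = e.det e' • e'.det := AlternatingMap.eq_smul_basis_det e' e.det
  rw [this, det_eq_one_of_assocForm_eq h, one_smul]

theorem frameInner_eq_of_assocForm_eq {e e' : Module.Basis (Fin 7) ℝ V}
    (h : assocForm e = assocForm e') (x y : V) : frameInner e x y = frameInner e' x y := by
  have h1 : ∀ x, frameInner e x x = 1 * frameInner e' x x := by
    intro x
    have h2 := curry_sq_wedge_assocForm e x
    rw [h, curry_sq_wedge_assocForm e' x, det_eq_of_assocForm_eq h] at h2
    have := congrArg (fun f : Form V 7 => f e') h2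
    simp only [AlternatingMap.smul_apply, e'.det_self, smul_eq_mul, mul_one] at this
    linarith
  simpa using frameInner_eq_of_self 1 h1 x y

theorem IsG2Form.assocForm_frame {φ : Form V 3} (h : IsG2Form φ) : assocForm h.frame = φ :=
  h.choose_spec.symm

theorem IsG2Form.metric_eq {φ : Form V 3} (h : IsG2Form φ) {e : Module.Basis (Fin 7) ℝ V}
    (he : φ = assocForm e) (x y : V) : h.metric x y = frameInner e x y := by
  rw [h.metric_apply]
  exact frameInner_eq_of_assocForm_eq (h.assocForm_frame.trans he) x y

theorem IsG2Form.star_eq {φ : Form V 3} (h : IsG2Form φ) {e : Module.Basis (Fin 7) ℝ V}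
    (he : φ = assocForm e) (k m : ℕ) (hkm : k + m = 7) (α : Form V k) :
    h.star k m hkm α = hodgeOfBasis e k m hkm α :=
  have hh := h.assocForm_frame.trans he
  hodgeOfBasis_eq (frameInner_eq_of_assocForm_eq hh) (det_eq_of_assocForm_eq hh) hkm α

theorem IsG2Form.coassocForm_eq {φ : Form V 3} (h : IsG2Form φ) {e : Module.Basis (Fin 7) ℝ V}
    (he : φ = assocForm e) : h.coassocForm = coassoc e := by
  rw [IsG2Form.coassocForm, h.star_eq he, he, hodge_assocForm]

theorem IsG2Form.sharp_eq {φ : Form V 3} (h : IsG2Form φ) {e : Module.Basis (Fin 7) ℝ V}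
    (he : φ = assocForm e) (α : Form V 1) : h.sharp α = ∑ i, α ![e i] • e i := by
  have key : ∀ e' : Module.Basis (Fin 7) ℝ V, ∀ y,
      frameInner e' (∑ i, α ![e' i] • e' i) y = α ![y] := by
    intro e' y
    have := form_apply_eq_sum e' α ![y]
    rw [this, ← (Equiv.funUnique (Fin 1) (Fin 7)).symm.sum_comp]
    simp only [frameInner, map_sum, map_smul]
    refine Finset.sum_congr rfl fun i _ => ?_
    have hv : (fun _ : Fin 1 => e' i) = ![e' i] := by simp [funext_iff]
    simp [Finsupp.single_apply, hv, mul_comm]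
  have hm := frameInner_eq_of_assocForm_eq (h.assocForm_frame.trans he)
  refine e.ext_elem fun j => ?_
  rw [← frameInner_basis_right, ← frameInner_basis_right, key e, ← hm, IsG2Form.sharp, key]

theorem IsG2Form.mem_lam14_iff {φ : Form V 3} (h : IsG2Form φ) {e : Module.Basis (Fin 7) ℝ V}
    (he : φ = assocForm e) (β : Form V 2) :
    β ∈ h.Lam14 ↔ hodgeOfBasis e 5 2 rfl (wedge32 (assocForm e) β) = -β := by
  subst he
  rw [← h.star_eq rfl]
  rfl

/-! ### Naturality -/

theorem assocForm_map {W : Type*} [AddCommGroup W] [Module ℝ W] (e : Module.Basis (Fin 7) ℝ V)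
    (L : W ≃ₗ[ℝ] V) :
    assocForm (e.map L.symm) = (assocForm e).compLinearMap L.toLinearMap := by
  ext v
  rfl

theorem coassoc_map {W : Type*} [AddCommGroup W] [Module ℝ W] (e : Module.Basis (Fin 7) ℝ V)
    (L : W ≃ₗ[ℝ] V) :
    coassoc (e.map L.symm) = (coassoc e).compLinearMap L.toLinearMap := by
  ext v
  rfl

theorem frameInner_map {W : Type*} [AddCommGroup W] [Module ℝ W] (e : Module.Basis (Fin n) ℝ V)
    (L : W ≃ₗ[ℝ] V) (x y : W) :
    frameInner (e.map L.symm) x y = frameInner e (L x) (L y) := by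
  simp [frameInner]

end FrameIndependence

section AdaptedFrame

variable {V : Type*} [AddCommGroup V] [Module ℝ V]

/-! ### The cross product and adapted frames -/

theorem assocForm_apply (e : Module.Basis (Fin 7) ℝ V) (u v w : V) :
    assocForm e ![u, v, w] =
      e.repr u 0 * (e.repr v 1 * e.repr w 2 - e.repr v 2 * e.repr w 1
        + (e.repr v 3 * e.repr w 4 - e.repr v 4 * e.repr w 3)
        + (e.repr v 5 * e.repr w 6 - e.repr v 6 * e.repr w 5))
      + e.repr u 1 * (e.repr v 2 * e.repr w 0 - e.repr v 0 * e.repr w 2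
        + (e.repr v 3 * e.repr w 5 - e.repr v 5 * e.repr w 3)
        - (e.repr v 4 * e.repr w 6 - e.repr v 6 * e.repr w 4))
      + e.repr u 2 * (e.repr v 0 * e.repr w 1 - e.repr v 1 * e.repr w 0
        - (e.repr v 3 * e.repr w 6 - e.repr v 6 * e.repr w 3)
        - (e.repr v 4 * e.repr w 5 - e.repr v 5 * e.repr w 4))
      + e.repr u 3 * (e.repr v 4 * e.repr w 0 - e.repr v 0 * e.repr w 4
        + (e.repr v 5 * e.repr w 1 - e.repr v 1 * e.repr w 5)
        - (e.repr v 6 * e.repr w 2 - e.repr v 2 * e.repr w 6))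
      + e.repr u 4 * (e.repr v 0 * e.repr w 3 - e.repr v 3 * e.repr w 0
        - (e.repr v 6 * e.repr w 1 - e.repr v 1 * e.repr w 6)
        - (e.repr v 5 * e.repr w 2 - e.repr v 2 * e.repr w 5))
      + e.repr u 5 * (e.repr v 6 * e.repr w 0 - e.repr v 0 * e.repr w 6
        + (e.repr v 1 * e.repr w 3 - e.repr v 3 * e.repr w 1)
        - (e.repr v 2 * e.repr w 4 - e.repr v 4 * e.repr w 2))
      + e.repr u 6 * (e.repr v 0 * e.repr w 5 - e.repr v 5 * e.repr w 0
        - (e.repr v 1 * e.repr w 4 - e.repr v 4 * e.repr w 1)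
        - (e.repr v 2 * e.repr w 3 - e.repr v 3 * e.repr w 2)) := by
  simp [assocForm, coordForm_apply_three]
  ring

/-- The cross product of the `G₂`-structure given by a frame. -/
def cross (e : Module.Basis (Fin 7) ℝ V) (u v : V) : V :=
  ∑ i, assocForm e ![u, v, e i] • e i

theorem repr_cross (e : Module.Basis (Fin 7) ℝ V) (u v : V) (i : Fin 7) :
    e.repr (cross e u v) i = assocForm e ![u, v, e i] := by
  simp [cross, Finsupp.single_apply]

theorem frameInner_cross (e : Module.Basis (Fin 7) ℝ V) (u v w : V) :
    frameInner e (cross e u v) w = assocForm e ![u, v, w] := by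
  simp only [frameInner, repr_cross, Fin.sum_univ_seven]
  simp [assocForm_apply]
  ring

theorem frameInner_comm {n : ℕ} (e : Module.Basis (Fin n) ℝ V) (u v : V) :
    frameInner e u v = frameInner e v u := by
  simp [frameInner, mul_comm]

theorem frameInner_neg_left {n : ℕ} (e : Module.Basis (Fin n) ℝ V) (u v : V) :
    frameInner e (-u) v = -frameInner e u v := by
  simp [frameInner]

theorem cross_anticomm (e : Module.Basis (Fin 7) ℝ V) (u v : V) :
    cross e u v = -cross e v u := by
  refine e.ext_elem fun i => ?_
  rw [map_neg, Finsupp.neg_apply, repr_cross, repr_cross]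
  simp only [assocForm_apply]
  ring

theorem cross_neg_right (e : Module.Basis (Fin 7) ℝ V) (u v : V) :
    cross e u (-v) = -cross e u v := by
  refine e.ext_elem fun i => ?_
  rw [map_neg, Finsupp.neg_apply, repr_cross, repr_cross]
  simp only [assocForm_apply, map_neg, Finsupp.neg_apply]
  ring

/-- Polarisation of `u × (u × w) = ⟨u, w⟩ u - |u|² w`. It is the only algebraic property of the
cross product behind the construction of frames: on orthogonal vectors it lets factors be exchanged
up to sign. -/
theorem cross_cross (e : Module.Basis (Fin 7) ℝ V) (u v w : V) :
    cross e u (cross e v w) + cross e v (cross e u w)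
      = (-2 * frameInner e u v) • w + frameInner e u w • v + frameInner e v w • u := by
  refine e.ext_elem fun i => ?_
  simp only [map_add, map_smul, Finsupp.add_apply, Finsupp.smul_apply, smul_eq_mul, repr_cross]
  simp only [assocForm_apply, repr_cross]
  simp only [frameInner, Fin.sum_univ_seven]
  fin_cases i <;>
  · simp
    ring

theorem cross_swap (e : Module.Basis (Fin 7) ℝ V) {u v w : V} (h₁ : frameInner e u v = 0)
    (h₂ : frameInner e u w = 0) (h₃ : frameInner e v w = 0) :
    cross e u (cross e v w) = -cross e v (cross e u w) := by
  have := cross_cross e u v w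
  rw [h₁, h₂, h₃] at this
  simpa using eq_neg_of_add_eq_zero_left (this.trans (by simp))

theorem cross_self_cross (e : Module.Basis (Fin 7) ℝ V) {u w : V} (h₁ : frameInner e u u = 1)
    (h₂ : frameInner e u w = 0) : cross e u (cross e u w) = -w := by
  have := cross_cross e u u w
  rw [h₁, h₂, ← two_smul ℝ (cross e u _)] at this
  have h3 : (2 : ℝ) • cross e u (cross e u w) = (2 : ℝ) • (-w) := by
    rw [this]; simp
  exact smul_right_injective V two_ne_zero h3

theorem cross_cross_self (e : Module.Basis (Fin 7) ℝ V) {u w : V} (h₁ : frameInner e u u = 1)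
    (h₂ : frameInner e u w = 0) : cross e u (cross e w u) = w := by
  rw [cross_anticomm e w, cross_neg_right, cross_self_cross e h₁ h₂, neg_neg]

theorem frameInner_cross_right (e : Module.Basis (Fin 7) ℝ V) (u v w : V) :
    frameInner e u (cross e v w) = frameInner e (cross e u v) w := by
  rw [frameInner_comm, frameInner_cross, frameInner_cross]
  simp only [assocForm_apply]
  ring

theorem frameInner_cross_self_left (e : Module.Basis (Fin 7) ℝ V) (u v : V) :
    frameInner e (cross e u v) u = 0 := by
  rw [frameInner_cross]
  simp only [assocForm_apply]
  ring

theorem frameInner_cross_self_right (e : Module.Basis (Fin 7) ℝ V) (u v : V) :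
    frameInner e (cross e u v) v = 0 := by
  rw [frameInner_cross]
  simp only [assocForm_apply]
  ring

theorem exists_basis_of_orthonormal (e : Module.Basis (Fin 7) ℝ V) (f : Fin 7 → V)
    (hf : ∀ i j, frameInner e (f i) (f j) = if i = j then 1 else 0) :
    ∃ b : Module.Basis (Fin 7) ℝ V, ⇑b = f := by
  have hli : LinearIndependent ℝ f := by
    rw [Fintype.linearIndependent_iff]
    intro g hg i
    have : frameInner e (∑ j, g j • f j) (f i) = g i := by
      have h2 : frameInner e (∑ j, g j • f j) (f i) = ∑ j, g j * frameInner e (f j) (f i) := by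
        simp only [frameInner, map_sum, map_smul, Finsupp.finsetSum_apply, Finsupp.smul_apply,
          smul_eq_mul, Finset.sum_mul, Finset.mul_sum]
        rw [Finset.sum_comm]
        simp only [mul_assoc]
      rw [h2]
      simp [hf]
    rw [← this, hg]
    simp [frameInner]
  have : Module.Finite ℝ V := Module.Finite.of_basis e
  refine ⟨basisOfLinearIndependentOfCardEqFinrank hli ?_, ?_⟩
  · rw [Module.finrank_eq_card_basis e]
  · simp

/-- Two orthonormal vectors and a third unit vector orthogonal to them and to their cross product
determine a frame. -/
theorem exists_frame_of_triple (e : Module.Basis (Fin 7) ℝ V) {a b c : V}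
    (haa : frameInner e a a = 1) (hbb : frameInner e b b = 1) (hcc : frameInner e c c = 1)
    (hab : frameInner e a b = 0) (hac : frameInner e a c = 0) (hbc : frameInner e b c = 0)
    (habc : frameInner e (cross e a b) c = 0) :
    ∃ f : Module.Basis (Fin 7) ℝ V, assocForm f = assocForm e ∧ f 0 = a ∧ f 1 = b ∧ f 3 = c ∧
      f 4 = cross e a c ∧ f 5 = cross e b c := by
  have hba := (frameInner_comm e b a).trans hab
  have hca := (frameInner_comm e c a).trans hac
  have hcb := (frameInner_comm e c b).trans hbc
  obtain ⟨d, hd⟩ : ∃ d, cross e a b = d := ⟨_, rfl⟩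
  obtain ⟨p, hp⟩ : ∃ p, cross e a c = p := ⟨_, rfl⟩
  obtain ⟨q, hq⟩ : ∃ q, cross e b c = q := ⟨_, rfl⟩
  -- The frame will be `(a, b, d, c, p, q, r)` with `d = a × b`, `p = a × c`, `q = b × c`. The sign
  -- in `r = -(d × c)` reflects the value `φ(e₂, e₃, e₆) = -1` of the standard form. The relations
  -- that follow complete the multiplication table and the orthogonality table of these seven
  -- vectors.
  obtain ⟨r, hr⟩ : ∃ r, cross e d c = -r := ⟨-cross e d c, by simp⟩
  rw [hd] at habc
  have hdc := habc
  have hcd := (frameInner_comm e c d).trans hdc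
  have hda : frameInner e d a = 0 := by rw [← hd, frameInner_cross_self_left]
  have hdb : frameInner e d b = 0 := by rw [← hd, frameInner_cross_self_right]
  have had := (frameInner_comm e a d).trans hda
  have hbd := (frameInner_comm e b d).trans hdb
  have ad : cross e a d = -b := by rw [← hd, cross_self_cross e haa hab]
  have bd : cross e b d = a := by rw [← hd, cross_cross_self e hbb hba]
  have hdd : frameInner e d d = 1 := by
    nth_rewrite 2 [← hd]
    rw [frameInner_cross_right, cross_anticomm, ad, neg_neg, hbb]
  have ap : cross e a p = -c := by rw [← hp, cross_self_cross e haa hac]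
  have cp : cross e c p = a := by rw [← hp, cross_cross_self e hcc hca]
  have bq : cross e b q = -c := by rw [← hq, cross_self_cross e hbb hbc]
  have cq : cross e c q = b := by rw [← hq, cross_cross_self e hcc hcb]
  have dr : cross e d r = c := by
    rw [← neg_neg r, ← hr, cross_neg_right, cross_self_cross e hdd hdc, neg_neg]
  have cr : cross e c r = -d := by
    rw [← neg_neg r, ← hr, cross_neg_right, cross_cross_self e hcc hcd]
  have aq : cross e a q = r := by
    rw [← hq, cross_anticomm e b c, cross_neg_right, cross_swap e hac hab hcb, hd, neg_neg,
      cross_anticomm, hr, neg_neg]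
  have bp : cross e b p = -r := by
    rw [← hp, cross_swap e hba hbc hac, hq, aq]
  have hpa : frameInner e p a = 0 := by rw [← hp, frameInner_cross_self_left]
  have hpc : frameInner e p c = 0 := by rw [← hp, frameInner_cross_self_right]
  have hqb : frameInner e q b = 0 := by rw [← hq, frameInner_cross_self_left]
  have hqc : frameInner e q c = 0 := by rw [← hq, frameInner_cross_self_right]
  have hrd : frameInner e r d = 0 := by
    rw [← neg_neg r, ← hr, frameInner_neg_left, frameInner_cross_self_left, neg_zero]
  have hrc : frameInner e r c = 0 := by
    rw [← neg_neg r, ← hr, frameInner_neg_left, frameInner_cross_self_right, neg_zero]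
  have hap := (frameInner_comm e a p).trans hpa
  have hcp := (frameInner_comm e c p).trans hpc
  have hbq := (frameInner_comm e b q).trans hqb
  have hcq := (frameInner_comm e c q).trans hqc
  have hdr := (frameInner_comm e d r).trans hrd
  have hcr := (frameInner_comm e c r).trans hrc
  have hra : frameInner e r a = 0 := by rw [← aq, frameInner_cross_self_left]
  have har := (frameInner_comm e a r).trans hra
  have hrq : frameInner e r q = 0 := by rw [← aq, frameInner_cross_self_right]
  have hqr := (frameInner_comm e q r).trans hrq
  have hrb : frameInner e r b = 0 := by
    rw [← neg_neg r, ← bp, frameInner_neg_left, frameInner_cross_self_left, neg_zero]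
  have hbr := (frameInner_comm e b r).trans hrb
  have hrp : frameInner e r p = 0 := by
    rw [← neg_neg r, ← bp, frameInner_neg_left, frameInner_cross_self_right, neg_zero]
  have hpr := (frameInner_comm e p r).trans hrp
  have ar : cross e a r = -q := by
    rw [← aq, cross_self_cross e haa]
    rw [← hq, frameInner_cross_right, hd, hdc]
  have haq : frameInner e a q = 0 := by rw [← hq, frameInner_cross_right, hd, hdc]
  have hqa := (frameInner_comm e q a).trans haq
  have hbp : frameInner e b p = 0 := by
    rw [← hp, frameInner_cross_right, cross_anticomm, hd, frameInner_neg_left, hdc, neg_zero]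
  have hpb := (frameInner_comm e p b).trans hbp
  have hdp : frameInner e d p = 0 := by
    rw [← hp, frameInner_cross_right, cross_anticomm, ad, neg_neg, hbc]
  have hpd := (frameInner_comm e p d).trans hdp
  have hdq : frameInner e d q = 0 := by
    rw [← hq, frameInner_cross_right, cross_anticomm, bd, frameInner_neg_left, hac, neg_zero]
  have hqd := (frameInner_comm e q d).trans hdq
  have br : cross e b r = p := by
    rw [← neg_neg r, ← bp, cross_neg_right, cross_self_cross e hbb hbp, neg_neg]
  have dp : cross e d p = -q := by
    rw [← hp, cross_swap e hda hdc hac, hr, cross_neg_right, neg_neg, ar]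
  have dq : cross e d q = p := by
    rw [← hq, cross_swap e hdb hdc hbc, hr, cross_neg_right, neg_neg, br]
  have pq : cross e p q = -d := by
    rw [← hq, cross_swap e hpb hpc hbc, cross_anticomm e p c, cp, cross_neg_right, neg_neg,
      cross_anticomm, hd]
  have pr : cross e p r = -b := by
    rw [← neg_neg r, ← hr, cross_neg_right, cross_swap e hpd hpc hdc, neg_neg,
      cross_anticomm e p c, cp, cross_neg_right, cross_anticomm, ad, neg_neg]
  have qr : cross e q r = a := by
    rw [← neg_neg r, ← hr, cross_neg_right, cross_swap e hqd hqc hdc, neg_neg,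
      cross_anticomm e q c, cq, cross_neg_right, cross_anticomm, bd, neg_neg]
  have hpp : frameInner e p p = 1 := by
    nth_rewrite 2 [← hp]
    rw [frameInner_cross_right, cross_anticomm, ap, neg_neg, hcc]
  have hqq : frameInner e q q = 1 := by
    nth_rewrite 2 [← hq]
    rw [frameInner_cross_right, cross_anticomm, bq, neg_neg, hcc]
  have hrr : frameInner e r r = 1 := by
    nth_rewrite 2 [← aq]
    rw [frameInner_cross_right, cross_anticomm, ar, neg_neg, hqq]
  have hpq : frameInner e p q = 0 := by
    rw [← hp, ← frameInner_cross_right, cq, hab]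
  have hqp := (frameInner_comm e q p).trans hpq
  obtain ⟨f, hf⟩ := exists_basis_of_orthonormal e ![a, b, d, c, p, q, r] (by
    intro i j
    fin_cases i <;> fin_cases j <;> simp [*])
  refine ⟨f, ?_, ?_⟩
  · refine form_ext_three f ?_
    simp only [← frameInner_cross e]
    simp only [assocForm_table_0, assocForm_table_1, assocForm_table_2, Module.Basis.repr_self]
    simp [*, frameInner_neg_left]
  · simp [hf, hp, hq]

end AdaptedFrame

/-! ### Frames adapted to a coassociative plane. -/

section AdaptedFrame

variable {V : Type*} [AddCommGroup V] [Module ℝ V]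

/-- The subspace `C` is spanned by the last four vectors of the frame `f`. -/
def IsAdapted (f : Module.Basis (Fin 7) ℝ V) (C : Submodule ℝ V) : Prop :=
  ∀ x, x ∈ C ↔ f.repr x 0 = 0 ∧ f.repr x 1 = 0 ∧ f.repr x 2 = 0

theorem exists_orthonormal_of_finrank_eq_four (e : Module.Basis (Fin 7) ℝ V) (C : Submodule ℝ V)
    (hC : Module.finrank ℝ C = 4) :
    ∃ c : Fin 4 → V, (∀ i, c i ∈ C) ∧
      ∀ i j, frameInner e (c i) (c j) = if i = j then 1 else 0 := by
  let L : V ≃ₗ[ℝ] Euc 7 := e.equivFun.trans (WithLp.linearEquiv 2 ℝ (Fin 7 → ℝ)).symm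
  let D := C.map L.toLinearMap
  have hD : Module.finrank ℝ D = 4 := (LinearEquiv.finrank_map_eq L C).trans hC
  let b := (stdOrthonormalBasis ℝ D).reindex (finCongr hD)
  refine ⟨fun i => L.symm (b i : Euc 7), fun i => ?_, fun i j => ?_⟩
  · obtain ⟨x, hx, hx2⟩ := (b i).2
    change L.symm (b i : Euc 7) ∈ C
    rw [← hx2]
    simpa using hx
  · have h := orthonormal_iff_ite.1 b.orthonormal i j
    rw [← h, Submodule.coe_inner, PiLp.inner_apply, frameInner]
    refine Finset.sum_congr rfl fun l _ => ?_
    have : ∀ y : Euc 7, e.repr (L.symm y) l = y l := by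
      intro y
      simp [L, Finsupp.single_apply]
    rw [this, this]
    simp only [RCLike.inner_apply, conj_trivial]
    ring

/-- Cross products of tangent vectors are normal, since `φ` vanishes on `C`. For an orthonormal
basis `c` of `C`, apply `exists_frame_of_triple` to `a = c₀ × c₁`, `b = c₀ × c₂` and `c₀`; the
double cross products give `a × c₀ = c₁` and `b × c₀ = c₂`, so three vectors of the frame are
tangent by construction. Only the last one needs a separate argument. -/
theorem exists_adapted_frame {φ : Form V 3} {C : Submodule ℝ V} (h : IsG2Form φ)
    (hC : IsCoassociative φ C) :
    ∃ f : Module.Basis (Fin 7) ℝ V, φ = assocForm f ∧ IsAdapted f C := by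
  obtain ⟨e, rfl⟩ := h
  obtain ⟨hfin, hφ⟩ := hC
  obtain ⟨c, hcC, hc⟩ := exists_orthonormal_of_finrank_eq_four e C hfin
  have hcc : ∀ i j, i ≠ j → frameInner e (c i) (c j) = 0 := fun i j hij => by simp [hc, hij]
  have hc1 : ∀ i, frameInner e (c i) (c i) = 1 := fun i => by simp [hc]
  have h10 := hcc 1 0 (by decide)
  have h01 := hcc 0 1 (by decide)
  have h02 := hcc 0 2 (by decide)
  have h20 := hcc 2 0 (by decide)
  have h12 := hcc 1 2 (by decide)
  obtain ⟨a, ha⟩ : ∃ a, cross e (c 0) (c 1) = a := ⟨_, rfl⟩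
  obtain ⟨b, hb⟩ : ∃ b, cross e (c 0) (c 2) = b := ⟨_, rfl⟩
  have hca : cross e (c 0) a = -c 1 := by rw [← ha, cross_self_cross e (hc1 0) h01]
  have hcb : cross e (c 0) b = -c 2 := by rw [← hb, cross_self_cross e (hc1 0) h02]
  obtain ⟨f, hf, f0, f1, f3, f4, f5⟩ := exists_frame_of_triple e (a := a) (b := b) (c := c 0)
    (by nth_rewrite 2 [← ha]
        rw [frameInner_cross_right, cross_anticomm, hca, neg_neg, hc1])
    (by nth_rewrite 2 [← hb]
        rw [frameInner_cross_right, cross_anticomm, hcb, neg_neg, hc1])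
    (hc1 0)
    (by rw [← hb, frameInner_cross_right, cross_anticomm, hca, neg_neg, h12])
    (by rw [← ha, frameInner_cross_self_left])
    (by rw [← hb, frameInner_cross_self_left])
    (by rw [frameInner_comm, frameInner_cross_right, hca, frameInner_neg_left, ← hb,
          frameInner_cross_right, frameInner_cross,
          hφ _ (hcC 1) _ (hcC 0) _ (hcC 2), neg_zero])
  rw [cross_anticomm, hca, neg_neg] at f4
  rw [cross_anticomm, hcb, neg_neg] at f5
  -- The coordinates `0`, `1`, `2` of `x` are, up to sign, the values of `φ` on `x` and two of the
  -- tangent vectors `f₃, f₄, f₅`.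
  have hle : ∀ x ∈ C, f.repr x 0 = 0 ∧ f.repr x 1 = 0 ∧ f.repr x 2 = 0 := by
    intro x hx
    have t0 := hφ _ hx _ (hcC 0) _ (hcC 1)
    have t1 := hφ _ hx _ (hcC 0) _ (hcC 2)
    have t2 := hφ _ hx _ (hcC 1) _ (hcC 2)
    rw [← hf, ← f3, ← f4] at t0
    rw [← hf, ← f3, ← f5] at t1
    rw [← hf, ← f4, ← f5] at t2
    simp at t0 t1 t2
    exact ⟨t0, t1, t2⟩
  have h3 := hle _ (hcC 3)
  have horth : ∀ i, i ≠ 3 → frameInner f (c 3) (c i) = 0 := fun i hi => by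
    rw [frameInner_eq_of_assocForm_eq hf, hcc _ _ hi.symm]
  have r3 : f.repr (c 3) 3 = 0 := by rw [← frameInner_basis_right, f3, horth 0 (by decide)]
  have r4 : f.repr (c 3) 4 = 0 := by rw [← frameInner_basis_right, f4, horth 1 (by decide)]
  have r5 : f.repr (c 3) 5 = 0 := by rw [← frameInner_basis_right, f5, horth 2 (by decide)]
  -- The vector `c₃` has no normal component and is orthogonal to `c₀, c₁, c₂`, which are `f₃, f₄,
  -- f₅`; hence it spans the line of `f₆`.
  have hc3 : c 3 = f.repr (c 3) 6 • f 6 := by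
    have hs := f.sum_repr (c 3)
    rw [Fin.sum_univ_seven, h3.1, h3.2.1, h3.2.2, r3, r4, r5] at hs
    simpa using hs.symm
  have hne : f.repr (c 3) 6 ≠ 0 := by
    intro h0
    have h1 := hc1 3
    rw [hc3, h0] at h1
    simp [frameInner] at h1
  have f6C : f 6 ∈ C := by
    have : f 6 = (f.repr (c 3) 6)⁻¹ • c 3 := by
      conv_rhs => rw [hc3]
      simp [smul_smul, hne]
    rw [this]
    exact C.smul_mem _ (hcC 3)
  refine ⟨f, hf.symm, fun x => ⟨hle x, fun hx => ?_⟩⟩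
  rw [← f.sum_repr x]
  simp only [Fin.sum_univ_seven, hx.1, hx.2.1, hx.2.2, zero_smul, zero_add]
  refine C.add_mem (C.add_mem (C.add_mem ?_ ?_) ?_) (C.smul_mem _ f6C)
  · exact C.smul_mem _ (f3 ▸ hcC 0)
  · exact C.smul_mem _ (f4 ▸ hcC 1)
  · exact C.smul_mem _ (f5 ▸ hcC 2)

end AdaptedFrame

section AdaptedSplitting

variable {V : Type*} [AddCommGroup V] [Module ℝ V]

/-! ### The splitting along a coassociative plane in an adapted frame -/

section

variable {φ : Form V 3} {h : IsG2Form φ} {f : Module.Basis (Fin 7) ℝ V}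
  {C : Submodule ℝ V}

theorem IsG2Form.mem_perp_iff (hf : φ = assocForm f) (hC : IsAdapted f C) (x : V) :
    x ∈ h.perp C ↔ f.repr x 3 = 0 ∧ f.repr x 4 = 0 ∧ f.repr x 5 = 0 ∧ f.repr x 6 = 0 := by
  rw [IsG2Form.perp, LinearMap.BilinForm.mem_orthogonal_iff]
  constructor
  · intro hx
    have key : ∀ i : Fin 7, 3 ≤ i → f.repr x i = 0 := by
      intro i hi
      have h1 : f i ∈ C := by
        rw [hC]
        revert hi
        fin_cases i <;> simp
      have := hx _ h1
      rwa [h.metric_eq hf, frameInner_basis_left] at this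
    exact ⟨key 3 (by decide), key 4 (by decide), key 5 (by decide), key 6 (by decide)⟩
  · intro hx n hn
    rw [hC] at hn
    change h.metric n x = 0
    rw [h.metric_eq hf, frameInner, Fin.sum_univ_seven]
    simp [hx, hn]

theorem IsG2Form.perpProj_eq (hf : φ = assocForm f) (hC : IsAdapted f C) (x : V) :
    h.perpProj C x = f.repr x 0 • f 0 + f.repr x 1 • f 1 + f.repr x 2 • f 2 := by
  have h1 : f.repr x 0 • f 0 + f.repr x 1 • f 1 + f.repr x 2 • f 2 ∈ h.perp C := by
    rw [h.mem_perp_iff hf hC]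
    simp
  have h2 : f.repr x 3 • f 3 + f.repr x 4 • f 4 + f.repr x 5 • f 5 + f.repr x 6 • f 6 ∈ C := by
    rw [hC]
    simp
  have hx : x = (f.repr x 0 • f 0 + f.repr x 1 • f 1 + f.repr x 2 • f 2)
      + (f.repr x 3 • f 3 + f.repr x 4 • f 4 + f.repr x 5 • f 5 + f.repr x 6 • f 6) := by
    have hs := f.sum_repr x
    rw [Fin.sum_univ_seven] at hs
    nth_rewrite 1 [← hs]
    abel
  nth_rewrite 1 [hx]
  rw [map_add, IsG2Form.perpProj, Submodule.projection_apply_of_mem_left _ h1,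
    (Submodule.projection_apply_eq_zero_iff _).2 h2, add_zero]

theorem IsG2Form.tanProj_eq (hf : φ = assocForm f) (hC : IsAdapted f C) (x : V) :
    h.tanProj C x
      = f.repr x 3 • f 3 + f.repr x 4 • f 4 + f.repr x 5 • f 5 + f.repr x 6 • f 6 := by
  have h1 : f.repr x 0 • f 0 + f.repr x 1 • f 1 + f.repr x 2 • f 2 ∈ h.perp C := by
    rw [h.mem_perp_iff hf hC]
    simp
  have h2 : f.repr x 3 • f 3 + f.repr x 4 • f 4 + f.repr x 5 • f 5 + f.repr x 6 • f 6 ∈ C := by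
    rw [hC]
    simp
  have hx : x = (f.repr x 0 • f 0 + f.repr x 1 • f 1 + f.repr x 2 • f 2)
      + (f.repr x 3 • f 3 + f.repr x 4 • f 4 + f.repr x 5 • f 5 + f.repr x 6 • f 6) := by
    have hs := f.sum_repr x
    rw [Fin.sum_univ_seven] at hs
    nth_rewrite 1 [← hs]
    abel
  nth_rewrite 1 [hx]
  rw [map_add, IsG2Form.tanProj, Submodule.projection_apply_of_mem_left _ h2,
    (Submodule.projection_apply_eq_zero_iff _).2 h1, zero_add]

theorem IsG2Form.perpProj_basis (hf : φ = assocForm f) (hC : IsAdapted f C) :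
    h.perpProj C (f 0) = f 0 ∧ h.perpProj C (f 1) = f 1 ∧ h.perpProj C (f 2) = f 2 ∧
      h.perpProj C (f 3) = 0 ∧ h.perpProj C (f 4) = 0 ∧ h.perpProj C (f 5) = 0 ∧
      h.perpProj C (f 6) = 0 := by
  simp [h.perpProj_eq hf hC]

theorem IsG2Form.tanProj_basis (hf : φ = assocForm f) (hC : IsAdapted f C) :
    h.tanProj C (f 0) = 0 ∧ h.tanProj C (f 1) = 0 ∧ h.tanProj C (f 2) = 0 ∧
      h.tanProj C (f 3) = f 3 ∧ h.tanProj C (f 4) = f 4 ∧ h.tanProj C (f 5) = f 5 ∧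
      h.tanProj C (f 6) = f 6 := by
  simp [h.tanProj_eq hf hC]

end

theorem one_form_apply_eq_sum (f : Module.Basis (Fin 7) ℝ V) (α : Form V 1) (x : V) :
    α ![x] = ∑ i, f.repr x i * α ![f i] := by
  rw [form_apply_eq_sum f, ← (Equiv.funUnique (Fin 1) (Fin 7)).symm.sum_comp]
  refine Finset.sum_congr rfl fun i _ => ?_
  have hv : (fun _ : Fin 1 => f i) = ![f i] := by simp [funext_iff]
  simp [hv]

theorem two_form_apply_eq_sum (f : Module.Basis (Fin 7) ℝ V) (β : Form V 2) (x y : V) :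
    β ![x, y] = ∑ i, ∑ j, f.repr x i * f.repr y j * β ![f i, f j] := by
  rw [form_apply_eq_sum f, ← (finTwoArrowEquiv (Fin 7)).symm.sum_comp, Fintype.sum_prod_type]
  refine Finset.sum_congr rfl fun i _ => Finset.sum_congr rfl fun j _ => ?_
  have hv : (fun a : Fin 2 => f ((![i, j] : Fin 2 → Fin 7) a)) = ![f i, f j] := by
    simp [funext_iff, Fin.forall_fin_two]
  simp [hv]

/-- Vectors of the frame that lie in the complement of an adapted plane. -/
theorem IsAdapted.mem_of_le {f : Module.Basis (Fin 7) ℝ V} {C : Submodule ℝ V}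
    (hC : IsAdapted f C) : f 3 ∈ C ∧ f 4 ∈ C ∧ f 5 ∈ C ∧ f 6 ∈ C := by
  simp [hC _]

theorem two_form_swap (β : Form V 2) (x y : V) : β ![x, y] = -β ![y, x] := by
  have := β.map_swap ![y, x] (i := 0) (j := 1) (by decide)
  rw [← this]
  congr 1
  funext a
  fin_cases a <;> rfl

theorem two_form_self (β : Form V 2) (x : V) : β ![x, x] = 0 :=
  β.map_eq_zero_of_eq _ (i := 0) (j := 1) rfl (by decide)

section

variable {φ : Form V 3} {h : IsG2Form φ} {f : Module.Basis (Fin 7) ℝ V}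
  {C : Submodule ℝ V}

theorem mem_lam2A_iff (hC : IsAdapted f C) (β : Form V 2) :
    β ∈ lam2A C ↔ ∀ i, β ![f 3, f i] = 0 ∧ β ![f 4, f i] = 0 ∧ β ![f 5, f i] = 0 ∧
      β ![f 6, f i] = 0 := by
  obtain ⟨h3, h4, h5, h6⟩ := hC.mem_of_le
  refine ⟨fun hb i => ⟨hb _ h3 _, hb _ h4 _, hb _ h5 _, hb _ h6 _⟩, fun hb x hx y => ?_⟩
  rw [hC] at hx
  rw [two_form_apply_eq_sum f]
  simp [Fin.sum_univ_seven (f := fun i => ∑ j, f.repr x i * _ * _), hx, hb]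

theorem IsG2Form.mem_lam2C_iff (hf : φ = assocForm f) (hC : IsAdapted f C) (β : Form V 2) :
    β ∈ h.lam2C C ↔ ∀ i, β ![f 0, f i] = 0 ∧ β ![f 1, f i] = 0 ∧ β ![f 2, f i] = 0 := by
  have hp := h.mem_perp_iff hf hC
  refine ⟨fun hb i => ⟨hb _ ((hp _).2 (by simp)) _, hb _ ((hp _).2 (by simp)) _,
    hb _ ((hp _).2 (by simp)) _⟩, fun hb x hx y => ?_⟩
  rw [hp] at hx
  rw [two_form_apply_eq_sum f]
  simp [Fin.sum_univ_seven (f := fun i => ∑ j, f.repr x i * _ * _), hx, hb]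

theorem IsG2Form.mem_lamAC_iff (hf : φ = assocForm f) (hC : IsAdapted f C) (β : Form V 2) :
    β ∈ h.lamAC C ↔ β ![f 0, f 1] = 0 ∧ β ![f 0, f 2] = 0 ∧ β ![f 1, f 2] = 0 ∧
      β ![f 3, f 4] = 0 ∧ β ![f 3, f 5] = 0 ∧ β ![f 3, f 6] = 0 ∧ β ![f 4, f 5] = 0 ∧
      β ![f 4, f 6] = 0 ∧ β ![f 5, f 6] = 0 := by
  have hp := h.mem_perp_iff hf hC
  obtain ⟨h3, h4, h5, h6⟩ := hC.mem_of_le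
  have h0 : f 0 ∈ h.perp C := (hp _).2 (by simp)
  have h1 : f 1 ∈ h.perp C := (hp _).2 (by simp)
  have h2 : f 2 ∈ h.perp C := (hp _).2 (by simp)
  constructor
  · rintro ⟨hb, hb'⟩
    exact ⟨hb' _ h0 _ h1, hb' _ h0 _ h2, hb' _ h1 _ h2, hb _ h3 _ h4, hb _ h3 _ h5, hb _ h3 _ h6,
      hb _ h4 _ h5, hb _ h4 _ h6, hb _ h5 _ h6⟩
  · intro hb
    refine ⟨fun x hx y hy => ?_, fun x hx y hy => ?_⟩
    · rw [hC] at hx hy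
      rw [two_form_apply_eq_sum f]
      simp only [Fin.sum_univ_seven]
      simp [hx, hy, hb, two_form_self, two_form_swap β (f 4) (f 3), two_form_swap β (f 5) (f 3),
        two_form_swap β (f 6) (f 3), two_form_swap β (f 5) (f 4), two_form_swap β (f 6) (f 4),
        two_form_swap β (f 6) (f 5)]
    · rw [hp] at hx hy
      rw [two_form_apply_eq_sum f]
      simp only [Fin.sum_univ_seven]
      simp [hx, hy, hb, two_form_self, two_form_swap β (f 1) (f 0), two_form_swap β (f 2) (f 0),
        two_form_swap β (f 2) (f 1)]

theorem compLinearMap_apply_two {W : Type*} [AddCommGroup W] [Module ℝ W] (β : Form V 2)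
    (L : W →ₗ[ℝ] V) (x y : W) : β.compLinearMap L ![x, y] = β ![L x, L y] := by
  rw [AlternatingMap.compLinearMap_apply]
  congr 1
  funext a
  fin_cases a <;> rfl

theorem compLinearMap_apply_three {W : Type*} [AddCommGroup W] [Module ℝ W] (β : Form V 3)
    (L : W →ₗ[ℝ] V) (x y z : W) : β.compLinearMap L ![x, y, z] = β ![L x, L y, L z] := by
  rw [AlternatingMap.compLinearMap_apply]
  congr 1
  funext a
  fin_cases a <;> rfl

theorem form_two_zero_left (β : Form V 2) (x : V) : β ![0, x] = 0 :=
  β.map_coord_zero (m := ![0, x]) 0 rfl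

theorem form_two_zero_right (β : Form V 2) (x : V) : β ![x, 0] = 0 :=
  β.map_coord_zero (m := ![x, 0]) 1 rfl

theorem form_three_zero_mid (β : Form V 3) (x y : V) : β ![x, 0, y] = 0 :=
  β.map_coord_zero (m := ![x, 0, y]) 1 rfl

theorem form_three_zero_right (β : Form V 3) (x y : V) : β ![x, y, 0] = 0 :=
  β.map_coord_zero (m := ![x, y, 0]) 2 rfl

/-- The volume form of the associative plane in an adapted frame. -/
theorem IsG2Form.comp_perpProj_basis (hf : φ = assocForm f) (hC : IsAdapted f C) :
    φ.compLinearMap (h.perpProj C) ![f 0, f 1, f 2] = 1 ∧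
      (∀ x y, φ.compLinearMap (h.perpProj C) ![x, y, f 3] = 0) ∧
      (∀ x y, φ.compLinearMap (h.perpProj C) ![x, y, f 4] = 0) ∧
      (∀ x y, φ.compLinearMap (h.perpProj C) ![x, y, f 5] = 0) ∧
      (∀ x y, φ.compLinearMap (h.perpProj C) ![x, y, f 6] = 0) := by
  obtain ⟨p0, p1, p2, p3, p4, p5, p6⟩ := h.perpProj_basis hf hC
  simp only [compLinearMap_apply_three, p0, p1, p2, p3, p4, p5, p6, form_three_zero_right]
  simp [hf]

theorem IsG2Form.starC_table (hf : φ = assocForm f) (hC : IsAdapted f C) (β : Form V 2) :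
    h.starC C β ![f 3, f 4] = β ![f 5, f 6] ∧ h.starC C β ![f 3, f 5] = -β ![f 4, f 6] ∧
      h.starC C β ![f 3, f 6] = β ![f 4, f 5] ∧ h.starC C β ![f 4, f 5] = β ![f 3, f 6] ∧
      h.starC C β ![f 4, f 6] = -β ![f 3, f 5] ∧ h.starC C β ![f 5, f 6] = β ![f 3, f 4] := by
  have hs : h.starC C β = hodgeOfBasis f 5 2 rfl (wedge32 (φ.compLinearMap (h.perpProj C)) β) :=
    h.star_eq hf 5 2 rfl _
  have hv := h.comp_perpProj_basis hf hC
  rw [hs]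
  generalize φ.compLinearMap (h.perpProj C) = θ at hv
  simp [wedge32_apply f, hv]

theorem IsG2Form.starC_mem_lam2C (hf : φ = assocForm f) (hC : IsAdapted f C) {β : Form V 2}
    (hβ : β ∈ h.lam2C C) : h.starC C β ∈ h.lam2C C := by
  have hb := (h.mem_lam2C_iff hf hC β).1 hβ
  have hs : h.starC C β = hodgeOfBasis f 5 2 rfl (wedge32 (φ.compLinearMap (h.perpProj C)) β) :=
    h.star_eq hf 5 2 rfl _
  have hv := h.comp_perpProj_basis hf hC
  rw [h.mem_lam2C_iff hf hC, hs]
  have key : ∀ β' : Form V 2, (β' ![f 0, f 1] = 0 ∧ β' ![f 0, f 2] = 0 ∧ β' ![f 0, f 3] = 0 ∧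
      β' ![f 0, f 4] = 0 ∧ β' ![f 0, f 5] = 0 ∧ β' ![f 0, f 6] = 0 ∧ β' ![f 1, f 2] = 0 ∧
      β' ![f 1, f 3] = 0 ∧ β' ![f 1, f 4] = 0 ∧ β' ![f 1, f 5] = 0 ∧ β' ![f 1, f 6] = 0 ∧
      β' ![f 2, f 3] = 0 ∧ β' ![f 2, f 4] = 0 ∧ β' ![f 2, f 5] = 0 ∧ β' ![f 2, f 6] = 0) →
      ∀ i, β' ![f 0, f i] = 0 ∧ β' ![f 1, f i] = 0 ∧ β' ![f 2, f i] = 0 := by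
    intro β' hβ' i
    fin_cases i <;> simp [hβ', two_form_self, two_form_swap β' (f 1) (f 0),
      two_form_swap β' (f 2) (f 0), two_form_swap β' (f 2) (f 1)]
  refine key _ ?_
  generalize φ.compLinearMap (h.perpProj C) = θ at hv
  simp [wedge32_apply f, hv, hb]

theorem IsG2Form.mapW_apply (α : Form V 1) (x y : V) :
    h.mapW C α ![x, y] = 2 * φ ![h.sharp α, h.perpProj C x, h.perpProj C y]
      - φ ![h.sharp α, h.tanProj C x, h.tanProj C y] := by
  rw [IsG2Form.mapW, AlternatingMap.sub_apply, AlternatingMap.smul_apply,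
    compLinearMap_apply_two, compLinearMap_apply_two]
  rfl

theorem IsG2Form.repr_sharp (hf : φ = assocForm f) (α : Form V 1) (i : Fin 7) :
    f.repr (h.sharp α) i = α ![f i] := by
  rw [h.sharp_eq hf]
  simp [Finsupp.single_apply]

/-- The values of `W(α)` on an adapted frame. -/
theorem IsG2Form.mapW_table (hf : φ = assocForm f) (hC : IsAdapted f C) (α : Form V 1) :
    (h.mapW C α ![f 0, f 1] = 2 * α ![f 2] ∧ h.mapW C α ![f 0, f 2] = -(2 * α ![f 1]) ∧
      h.mapW C α ![f 1, f 2] = 2 * α ![f 0]) ∧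
    (h.mapW C α ![f 3, f 4] = -α ![f 0] ∧ h.mapW C α ![f 3, f 5] = -α ![f 1] ∧
      h.mapW C α ![f 3, f 6] = α ![f 2] ∧ h.mapW C α ![f 4, f 5] = α ![f 2] ∧
      h.mapW C α ![f 4, f 6] = α ![f 1] ∧ h.mapW C α ![f 5, f 6] = -α ![f 0]) ∧
    (h.mapW C α ![f 0, f 3] = 0 ∧ h.mapW C α ![f 0, f 4] = 0 ∧ h.mapW C α ![f 0, f 5] = 0 ∧
      h.mapW C α ![f 0, f 6] = 0) ∧
    (h.mapW C α ![f 1, f 3] = 0 ∧ h.mapW C α ![f 1, f 4] = 0 ∧ h.mapW C α ![f 1, f 5] = 0 ∧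
      h.mapW C α ![f 1, f 6] = 0) ∧
    (h.mapW C α ![f 2, f 3] = 0 ∧ h.mapW C α ![f 2, f 4] = 0 ∧ h.mapW C α ![f 2, f 5] = 0 ∧
      h.mapW C α ![f 2, f 6] = 0) := by
  obtain ⟨p0, p1, p2, p3, p4, p5, p6⟩ := h.perpProj_basis hf hC
  obtain ⟨q0, q1, q2, q3, q4, q5, q6⟩ := h.tanProj_basis hf hC
  simp only [h.mapW_apply, p0, p1, p2, p3, p4, p5, p6, q0, q1, q2, q3, q4, q5, q6,
    form_three_zero_mid, form_three_zero_right]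
  have hs := fun i => h.repr_sharp hf α i
  generalize h.sharp α = z at hs
  subst hf
  simp [hs]

theorem mem_formsA_iff (hC : IsAdapted f C) (α : Form V 1) :
    α ∈ formsA C ↔ α ![f 3] = 0 ∧ α ![f 4] = 0 ∧ α ![f 5] = 0 ∧ α ![f 6] = 0 := by
  obtain ⟨h3, h4, h5, h6⟩ := hC.mem_of_le
  refine ⟨fun hb => ⟨hb _ h3, hb _ h4, hb _ h5, hb _ h6⟩, fun hb x hx => ?_⟩
  rw [hC] at hx
  rw [one_form_apply_eq_sum f]
  simp [Fin.sum_univ_seven, hx, hb]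

/-- On an element of `(Λ²₁₄)_A`, the inverse of `W` reads off the component in `Λ²(A)`. -/
theorem IsG2Form.natural_eq (hf : φ = assocForm f) (hC : IsAdapted f C) {b : Form V 2}
    (hb : b ∈ h.lam14A C) :
    h.natural C b = (√6 / 2) • (b ![f 1, f 2] • f 0 - b ![f 0, f 2] • f 1
      + b ![f 0, f 1] • f 2) := by
  obtain ⟨h14, a, ha, c, ⟨hc, hcs⟩, rfl⟩ := hb
  rw [h.mem_lam14_iff hf, G2Geom.mem_lam14_iff] at h14
  have ha' := (mem_lam2A_iff hC a).1 ha
  have hc' := (h.mem_lam2C_iff hf hC c).1 hc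
  have hst := h.starC_table hf hC c
  rw [hcs] at hst
  have ha'' : ∀ i, a ![f i, f 3] = 0 ∧ a ![f i, f 4] = 0 ∧ a ![f i, f 5] = 0 ∧
      a ![f i, f 6] = 0 := fun i => by
    simp [two_form_swap a (f i), ha']
  -- The halves invert the factor `2` of `W` on `Λ²(A)`. The part in `Λ²(C)` then agrees
  -- automatically: self-duality makes paired components equal up to sign, and the `Λ²₁₄` equations
  -- fix their sum, for instance `c₃₄ = c₅₆ = -a₁₂ / 2`.
  have hex : ∃ α, α ∈ formsA C ∧ h.mapW C α = a + c := by
    refine ⟨oneForm f ![a ![f 1, f 2] / 2, -a ![f 0, f 2] / 2, a ![f 0, f 1] / 2, 0, 0, 0, 0],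
      ?_, ?_⟩
    · rw [mem_formsA_iff hC]
      simp [oneForm_apply]
    · refine form_ext_two f ?_
      have ht := h.mapW_table hf hC (oneForm f
        ![a ![f 1, f 2] / 2, -a ![f 0, f 2] / 2, a ![f 0, f 1] / 2, 0, 0, 0, 0])
      simp only [oneForm_apply] at ht
      simp [AlternatingMap.add_apply, ha', ha'', hc'] at h14 ⊢
      simp [ht]
      and_intros <;> linarith
  have hsp := Classical.epsilon_spec hex
  rw [IsG2Form.natural]
  generalize Classical.epsilon (fun α => α ∈ formsA C ∧ h.mapW C α = a + c) = α at hsp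
  obtain ⟨h1, h2⟩ := hsp
  rw [mem_formsA_iff hC] at h1
  have ht := (h.mapW_table hf hC α).1
  rw [h2] at ht
  rw [h.sharp_eq hf, ht.1, ht.2.1, ht.2.2, Fin.sum_univ_seven]
  simp only [h1]
  module

/-- The first summand is `W(α)`, with `α` chosen to match `β` on `Λ²(A)`; the second is the mixed
part of `β`; the third is the part of `β - W(α)` in `Λ²(C)`. The last is anti-self-dual because the
`Λ²₁₄` equations determine the self-dual part of `β` in `Λ²(C)` from its part in `Λ²(A)`, which `β`
shares with `W(α)`. -/
theorem IsG2Form.exists_decomposition (hf : φ = assocForm f) (hC : IsAdapted f C) {β : Form V 2}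
    (hβ : β ∈ h.Lam14) :
    ∃ b, b ∈ h.lam14A C ∧ ∃ b' ∈ h.lam14AC C, ∃ b'' ∈ h.lam14C C, β = b + b' + b'' := by
  obtain ⟨p0, p1, p2, p3, p4, p5, p6⟩ := h.perpProj_basis hf hC
  obtain ⟨q0, q1, q2, q3, q4, q5, q6⟩ := h.tanProj_basis hf hC
  have h14 := hβ
  rw [h.mem_lam14_iff hf, G2Geom.mem_lam14_iff] at h14
  obtain ⟨α, hα⟩ : ∃ α : Form V 1, ∀ i, α ![f i] =
      ![β ![f 1, f 2] / 2, -β ![f 0, f 2] / 2, β ![f 0, f 1] / 2, 0, 0, 0, 0] i :=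
    ⟨_, oneForm_apply f _⟩
  have ht := h.mapW_table hf hC α
  simp only [hα] at ht
  generalize h.mapW C α = b at ht
  obtain ⟨βA, hA⟩ : ∃ βA, βA = β.compLinearMap (h.perpProj C) := ⟨_, rfl⟩
  obtain ⟨βC, hCC⟩ : ∃ βC, βC = β.compLinearMap (h.tanProj C) := ⟨_, rfl⟩
  have vA := fun x y => (congrArg (fun γ : Form V 2 => γ ![x, y]) hA).trans
    (compLinearMap_apply_two β (h.perpProj C) x y)
  have vC := fun x y => (congrArg (fun γ : Form V 2 => γ ![x, y]) hCC).trans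
    (compLinearMap_apply_two β (h.tanProj C) x y)
  obtain ⟨bA, hbA⟩ : ∃ bA, bA = b.compLinearMap (h.perpProj C) := ⟨_, rfl⟩
  obtain ⟨bC, hbC⟩ : ∃ bC, bC = b.compLinearMap (h.tanProj C) := ⟨_, rfl⟩
  have wA := fun x y => (congrArg (fun γ : Form V 2 => γ ![x, y]) hbA).trans
    (compLinearMap_apply_two b (h.perpProj C) x y)
  have wC := fun x y => (congrArg (fun γ : Form V 2 => γ ![x, y]) hbC).trans
    (compLinearMap_apply_two b (h.tanProj C) x y)
  have hlA : bA ∈ lam2A C := by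
    rw [mem_lam2A_iff hC]
    simp [wA, p3, p4, p5, p6, form_two_zero_left]
  have hlC : bC ∈ h.lam2C C := by
    rw [h.mem_lam2C_iff hf hC]
    simp [wC, q0, q1, q2, form_two_zero_left]
  have hmC : βC - bC ∈ h.lam2C C := by
    rw [h.mem_lam2C_iff hf hC]
    simp [wC, vC, q0, q1, q2, form_two_zero_left]
  have hb : b = bA + bC := by
    refine form_ext_two f ?_
    simp [wA, wC, p0, p1, p2, p3, p4, p5, p6, q0, q1, q2, q3, q4, q5, q6, form_two_zero_left,
      form_two_zero_right, ht]
  refine ⟨b, ⟨?_, bA, hlA, bC, ⟨hlC, ?_⟩, hb⟩, β - βA - βC, ⟨?_, ?_⟩, βC - bC, ⟨?_, hmC, ?_⟩, ?_⟩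
  · rw [h.mem_lam14_iff hf, G2Geom.mem_lam14_iff]
    simp [ht]
    and_intros <;> ring
  · have s := h.starC_table hf hC bC
    have s' := (h.mem_lam2C_iff hf hC _).1 (h.starC_mem_lam2C hf hC hlC)
    refine form_ext_two f ?_
    simp [s, s', wC, q0, q1, q2, q3, q4, q5, q6, form_two_zero_left, ht]
  · rw [h.mem_lam14_iff hf, G2Geom.mem_lam14_iff]
    simp [vA, vC, p0, p1, p2, p3, p4, p5, p6, q0, q1, q2, q3, q4, q5, q6, form_two_zero_left,
      form_two_zero_right, h14]
  · rw [h.mem_lamAC_iff hf hC]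
    simp [vA, vC, p0, p1, p2, p3, p4, p5, p6, q0, q1, q2, q3, q4, q5, q6, form_two_zero_right]
  · rw [h.mem_lam14_iff hf, G2Geom.mem_lam14_iff]
    simp [vC, wC, q0, q1, q2, q3, q4, q5, q6, form_two_zero_left, ht]
    and_intros <;> linarith
  · have s := h.starC_table hf hC (βC - bC)
    have s' := (h.mem_lam2C_iff hf hC _).1 (h.starC_mem_lam2C hf hC hmC)
    refine form_ext_two f ?_
    simp only [AlternatingMap.neg_apply, s, s']
    simp [vC, wC, q0, q1, q2, q3, q4, q5, q6, form_two_zero_left, ht]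
    and_intros <;> linarith
  · refine form_ext_two f ?_
    simp [vA, vC, wC, p0, p1, p2, p3, p4, p5, p6, q0, q1, q2, q3, q4, q5, q6, form_two_zero_left,
      form_two_zero_right, ht]
    and_intros <;> ring

/-- The right-hand side of the mean curvature formula in an adapted frame. -/
theorem IsG2Form.sharp_add_natural (hf : φ = assocForm f) (hC : IsAdapted f C) (α : Form V 1)
    {β : Form V 2} (hβ : β ∈ h.Lam14) :
    (-4 : ℝ) • h.sharp (h.oneA C α) + (√6 / 3) • h.natural C (h.twoA C β) =
      (β ![f 1, f 2] - 4 * α ![f 0]) • f 0 + (-β ![f 0, f 2] - 4 * α ![f 1]) • f 1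
        + (β ![f 0, f 1] - 4 * α ![f 2]) • f 2 := by
  obtain ⟨p0, p1, p2, p3, p4, p5, p6⟩ := h.perpProj_basis hf hC
  have hp := h.mem_perp_iff hf hC
  have h0 : f 0 ∈ h.perp C := (hp _).2 (by simp)
  have h1 : f 1 ∈ h.perp C := (hp _).2 (by simp)
  have h2 : f 2 ∈ h.perp C := (hp _).2 (by simp)
  have hsp := Classical.epsilon_spec (h.exists_decomposition hf hC hβ)
  rw [IsG2Form.twoA]
  generalize Classical.epsilon (fun b => b ∈ h.lam14A C ∧
    ∃ b' ∈ h.lam14AC C, ∃ b'' ∈ h.lam14C C, β = b + b' + b'') = b at hsp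
  obtain ⟨hb, b', ⟨-, -, hb'⟩, b'', ⟨-, hb'', -⟩, rfl⟩ := hsp
  -- The other two summands vanish on pairs of normal vectors, so any first summand has the same
  -- normal components as `β`. Since `natural_eq` reads only these, uniqueness of the decomposition
  -- is not needed.
  have key : ∀ x ∈ h.perp C, ∀ y ∈ h.perp C, (b + b' + b'') ![x, y] = b ![x, y] :=
    fun x hx y hy => by simp [hb' x hx y hy, hb'' x hx y]
  have hα : ∀ x, h.oneA C α ![x] = α ![h.perpProj C x] := fun x => by
    refine congrArg α (funext fun a => ?_)
    fin_cases a
    rfl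
  have hz : α ![(0 : V)] = 0 := α.map_coord_zero (m := ![0]) 0 rfl
  -- One factor is the coefficient in the theorem; the other is `√6` from the normalisation of `♮`
  -- divided by the `2` in `W`.
  have h6 : √6 / 3 * (√6 / 2) = 1 := by
    rw [div_mul_div_comm, Real.mul_self_sqrt (by norm_num)]
    norm_num
  rw [h.natural_eq hf hC hb, smul_smul, h6, h.sharp_eq hf, key _ h1 _ h2, key _ h0 _ h2,
    key _ h0 _ h1, Fin.sum_univ_seven]
  simp only [hα, p0, p1, p2, p3, p4, p5, p6, hz]
  module

end

end AdaptedSplitting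

section LocalCoframe

open Topology

/-! ### Local coframes adapted to a `G₂`-structure -/

/-- The coefficients `∑_{c < d} φ_{mcd} α_{jcd}` of a `3`-form `α` contracted with the associative
form. -/
def contrThree (a : Fin 7 → Fin 7 → Fin 7 → ℝ) : Fin 7 → Fin 7 → ℝ :=
    ![![a 0 1 2 + a 0 3 4 + a 0 5 6, a 1 3 4 + a 1 5 6, a 2 3 4 + a 2 5 6, a 1 2 3 + a 3 5 6,
        a 1 2 4 + a 4 5 6, a 1 2 5 + a 3 4 5, a 1 2 6 + a 3 4 6],
      ![a 0 3 5 - a 0 4 6, a 0 1 2 + a 1 3 5 - a 1 4 6, a 2 3 5 - a 2 4 6, -a 0 2 3 - a 3 4 6,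
        -a 0 2 4 - a 3 4 5, -a 0 2 5 + a 4 5 6, -a 0 2 6 + a 3 5 6],
      ![-a 0 3 6 - a 0 4 5, -a 1 3 6 - a 1 4 5, a 0 1 2 - a 2 3 6 - a 2 4 5, a 0 1 3 - a 3 4 5,
        a 0 1 4 + a 3 4 6, a 0 1 5 + a 3 5 6, a 0 1 6 - a 4 5 6],
      ![-a 0 1 5 + a 0 2 6, a 0 1 4 + a 1 2 6, a 0 2 4 + a 1 2 5, a 0 3 4 + a 1 3 5 - a 2 3 6,
        a 1 4 5 - a 2 4 6, -a 0 4 5 - a 2 5 6, -a 0 4 6 - a 1 5 6],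
      ![a 0 1 6 + a 0 2 5, -a 0 1 3 + a 1 2 5, -a 0 2 3 - a 1 2 6, -a 1 3 6 - a 2 3 5,
        a 0 3 4 - a 1 4 6 - a 2 4 5, a 0 3 5 - a 1 5 6, a 0 3 6 + a 2 5 6],
      ![a 0 1 3 - a 0 2 4, a 0 1 6 - a 1 2 4, a 0 2 6 - a 1 2 3, a 0 3 6 + a 2 3 4,
        a 0 4 6 + a 1 3 4, a 0 5 6 + a 1 3 5 - a 2 4 5, a 1 3 6 - a 2 4 6],
      ![-a 0 1 4 - a 0 2 3, -a 0 1 5 - a 1 2 3, -a 0 2 5 + a 1 2 4, -a 0 3 5 + a 1 3 4,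
        -a 0 4 5 - a 2 3 4, -a 1 4 5 - a 2 3 5, a 0 5 6 - a 1 4 6 - a 2 3 6]]

/-- The infinitesimal action of `End V` on the associative form is onto `Λ³`. -/
theorem exists_action_eq {V : Type*} [AddCommGroup V] [Module ℝ V] (e : Module.Basis (Fin 7) ℝ V)
    (α : Form V 3) : ∃ A : V →ₗ[ℝ] V, ∀ β : Form V 3,
      (∀ u v w, β ![u, v, w] = assocForm e ![A u, v, w] + assocForm e ![u, A v, w]
        + assocForm e ![u, v, A w]) → β = α := by
  -- The contraction of `A · φ` with `φ` is a `G₂`-equivariant function of `A`: multiplication by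
  -- `9` on multiples of the identity, by `2` on traceless symmetric matrices, and by `6` on the
  -- `7`-dimensional module of skew matrices. The coefficients `1/3`, `1/6`, `-1/18` invert this,
  -- since `1/3 + 1/6 = 1/2`, `1/3 - 1/6 = 1/6` and `1/2 - 7/18 = 1/9`.
  let B := contrThree fun i j k => α ![e i, e j, e k]
  let t : ℝ := ∑ i, B i i
  refine ⟨e.constr ℝ fun i => ∑ m, ((1 / 3) * B m i + (1 / 6) * B i m
    - (1 / 18) * (if m = i then t else 0)) • e m, fun β hβ => ?_⟩
  have hr : ∀ i m, e.repr ((e.constr ℝ fun i => ∑ m, ((1 / 3) * B m i + (1 / 6) * B i m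
    - (1 / 18) * (if m = i then t else 0)) • e m) (e i)) m
      = (1 / 3) * B m i + (1 / 6) * B i m - (1 / 18) * (if m = i then t else 0) := by
    intro i m
    rw [e.constr_basis]
    exact congrFun (e.repr_sum_self _) m
  refine form_ext_three e ?_
  simp only [hβ, assocForm_apply, hr]
  simp [B, t, contrThree, Fin.sum_univ_seven]
  and_intros <;> ring

theorem fderivComp_three {W : Type*} [NormedAddCommGroup W] [NormedSpace ℝ W]
    (f : Euc 7 [⋀^Fin 3]→L[ℝ] ℝ) (g A : W →L[ℝ] Euc 7) (u v w : W) :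
    f.fderivCompContinuousLinearMap g A ![u, v, w]
      = f ![A u, g v, g w] + f ![g u, A v, g w] + f ![g u, g v, A w] := by
  rw [ContinuousAlternatingMap.fderivCompContinuousLinearMap_apply, Fin.sum_univ_three]
  congr 1
  · congr 1
    all_goals
      refine congrArg f (funext fun a => ?_)
      fin_cases a <;> simp
  · refine congrArg f (funext fun a => ?_)
    fin_cases a <;> simp

theorem fderivComp_four (f : Euc 7 [⋀^Fin 4]→L[ℝ] ℝ)
    (A : Euc 7 →L[ℝ] Euc 7) (u v w z : Euc 7) :
    f.fderivCompContinuousLinearMap (1 : Euc 7 →L[ℝ] Euc 7) A ![u, v, w, z]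
      = f ![A u, v, w, z] + f ![u, A v, w, z] + f ![u, v, A w, z] + f ![u, v, w, A z] := by
  rw [ContinuousAlternatingMap.fderivCompContinuousLinearMap_apply, Fin.sum_univ_four]
  congr 1
  · congr 1
    · congr 1
      all_goals
        refine congrArg f (funext fun a => ?_)
        fin_cases a <;> simp
    · refine congrArg f (funext fun a => ?_)
      fin_cases a <;> simp
  · refine congrArg f (funext fun a => ?_)
    fin_cases a <;> simp

/-- Finite dimension makes a linear section of the infinitesimal action continuous and supplies the
completeness required by the inverse function theorem. -/
theorem finiteDimensional_form (k : ℕ) : FiniteDimensional ℝ (Euc 7 [⋀^Fin k]→L[ℝ] ℝ) := by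
  let b := (EuclideanSpace.basisFun (Fin 7) ℝ).toBasis
  let ev : (Euc 7 [⋀^Fin k]→L[ℝ] ℝ) →ₗ[ℝ] ((Fin k → Fin 7) → ℝ) :=
    { toFun := fun f I => f fun a => b (I a)
      map_add' := fun _ _ => rfl
      map_smul' := fun _ _ => rfl }
  refine Module.Finite.of_injective ev fun f g hfg => ?_
  have : f.toAlternatingMap = g.toAlternatingMap :=
    Module.Basis.ext_alternating b fun I _ => congrFun hfg I
  ext v
  exact congrArg (fun h : Form (Euc 7) k => h v) this

theorem toCont_apply {k : ℕ} (a : Form (Euc 7) k) (v : Fin k → Euc 7) : toCont a v = a v := rfl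

/-- Near a point, a differentiable family of `3`-forms is the pullback of its value at the point,
if the latter is an associative form, by a differentiable family of endomorphisms. -/
theorem exists_pullback_eq (b : Module.Basis (Fin 7) ℝ (Euc 7))
    {Φ : Euc 7 → Euc 7 [⋀^Fin 3]→L[ℝ] ℝ} {y₀ : Euc 7} (hΦ : DifferentiableAt ℝ Φ y₀)
    (h₀ : Φ y₀ = toCont (assocForm b)) :
    ∃ (L : Euc 7 → Euc 7 →L[ℝ] Euc 7) (T : Euc 7 →L[ℝ] Euc 7 →L[ℝ] Euc 7), L y₀ = 1 ∧
      HasFDerivAt L T y₀ ∧ ∀ᶠ y in 𝓝 y₀, Φ y = (Φ y₀).compContinuousLinearMap (L y) := by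
  have := finiteDimensional_form 3
  let D := (Φ y₀).fderivCompContinuousLinearMap (1 : Euc 7 →L[ℝ] Euc 7)
  have hsurj : Function.Surjective D := by
    intro α
    obtain ⟨A, hA⟩ := exists_action_eq b α.toAlternatingMap
    refine ⟨LinearMap.toContinuousLinearMap A, ?_⟩
    have := hA (D (LinearMap.toContinuousLinearMap A)).toAlternatingMap fun u v w => by
      have := fderivComp_three (Φ y₀) 1
        (LinearMap.toContinuousLinearMap A) u v w
      refine this.trans ?_
      rw [h₀]
      rfl
    ext v
    exact congrArg (fun h : Form (Euc 7) 3 => h v) this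
  -- A linear section of the infinitesimal action selects a slice of endomorphisms transverse to the
  -- stabiliser of the form.
  obtain ⟨R, hR⟩ := LinearMap.exists_rightInverse_of_surjective D.toLinearMap
    (LinearMap.range_eq_top.2 hsurj)
  let R' := LinearMap.toContinuousLinearMap R
  -- Restricted to the slice `1 + R' ξ`, the action has derivative the identity at `ξ = 0`. A local
  -- inverse of `P`, composed with `Φ`, yields the required family `L`.
  let P : (Euc 7 [⋀^Fin 3]→L[ℝ] ℝ) → (Euc 7 [⋀^Fin 3]→L[ℝ] ℝ) := fun ξ =>
    (Φ y₀).compContinuousLinearMap (1 + R' ξ)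
  have hP : HasStrictFDerivAt P ((ContinuousLinearEquiv.refl ℝ
      (Euc 7 [⋀^Fin 3]→L[ℝ] ℝ)) : _ →L[ℝ] _) 0 := by
    have h1 := (hasStrictFDerivAt_const (Φ y₀) (0 : Euc 7 [⋀^Fin 3]→L[ℝ] ℝ)
      (𝕜 := ℝ)).continuousAlternatingMapCompContinuousLinearMap
      ((R'.hasStrictFDerivAt (x := 0)).const_add (1 : Euc 7 →L[ℝ] Euc 7))
    convert! h1 using 1
    ext1 ξ
    have := LinearMap.congr_fun hR ξ
    simp only [map_zero, add_zero, ContinuousLinearMap.comp_zero, zero_add]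
    exact this.symm
  have hP0 : P 0 = Φ y₀ := by
    ext v
    simp only [P, map_zero, add_zero]
    rfl
  have hg := hP.to_localInverse
  have hr := hP.eventually_right_inverse
  have hg0 := hP.localInverse_apply_image
  rw [hP0] at hg hr hg0
  have hL := ((R'.hasFDerivAt (x := hP.localInverse P _ 0 (Φ y₀))).comp y₀
    (hg.hasFDerivAt.comp y₀ hΦ.hasFDerivAt)).const_add (1 : Euc 7 →L[ℝ] Euc 7)
  refine ⟨_, _, ?_, hL, ?_⟩
  · simp only [Function.comp_apply, hg0, map_zero, add_zero]
  · filter_upwards [hΦ.continuousAt.eventually hr] with y hy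
    exact hy.symm

theorem eventually_isUnit {L : Euc 7 → Euc 7 →L[ℝ] Euc 7} {y₀ : Euc 7} (h₀ : L y₀ = 1)
    (hL : ContinuousAt L y₀) :
    ∀ᶠ y in 𝓝 y₀, ∃ A : Euc 7 ≃ₗ[ℝ] Euc 7, ∀ v, A v = L y v := by
  have h1 : ∀ᶠ y in 𝓝 y₀, IsUnit (L y) :=
    hL.eventually_mem (Units.isOpen.mem_nhds (by rw [h₀]; exact isUnit_one))
  filter_upwards [h1] with y ⟨u, hu⟩
  exact ⟨(ContinuousLinearEquiv.unitsEquiv ℝ (Euc 7) u).toLinearEquiv, fun v => by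
    rw [← hu]; rfl⟩

end LocalCoframe

section Charts

open Topology

/-! ### The preferred charts and adapted coframes -/

theorem coassoc_eq_of_assocForm_eq {V : Type*} [AddCommGroup V] [Module ℝ V]
    {e e' : Module.Basis (Fin 7) ℝ V} (h : assocForm e = assocForm e') :
    coassoc e = coassoc e' := by
  rw [← hodge_assocForm, ← hodge_assocForm, h]
  exact hodgeOfBasis_eq (frameInner_eq_of_assocForm_eq h) (det_eq_of_assocForm_eq h) rfl _

variable {M : Type*} [TopologicalSpace M] [ChartedSpace (Euc 7) M]

theorem isManifold_one [IsManifold (𝓡 7) ∞ M] : IsManifold (𝓡 7) 1 M :=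
  IsManifold.of_le (n := ∞) (by exact_mod_cast le_top)

theorem target_mem_nhds (x : M) :
    (extChartAt (𝓡 7) x).target ∈ 𝓝 (extChartAt (𝓡 7) x x) :=
  extChartAt_target_mem_nhds x

theorem exists_chartFrame_eq [IsManifold (𝓡 7) ∞ M] (x : M) {y : Euc 7}
    (hy : y ∈ (extChartAt (𝓡 7) x).target) :
    ∃ A : Euc 7 ≃ₗ[ℝ] TangentSpace (𝓡 7) ((extChartAt (𝓡 7) x).symm y),
      A.toLinearMap = chartFrame x y := by
  have := isManifold_one (M := M)
  have h := isInvertible_mfderivWithin_extChartAt_symm (I := 𝓡 7) hy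
  rw [ModelWithCorners.Boundaryless.range_eq_univ, mfderivWithin_univ] at h
  obtain ⟨B, hB⟩ := h
  refine ⟨((NormedSpace.fromTangentSpace (𝕜 := ℝ) y).symm.toLinearEquiv).trans B.toLinearEquiv, ?_⟩
  ext1 v
  rw [chartFrame, ← hB]
  rfl

/-- The derivative of the preferred chart at `x`, as an isomorphism. -/
theorem exists_coframeEquiv [IsManifold (𝓡 7) ∞ M] (x : M) :
    ∃ A : TangentSpace (𝓡 7) x ≃ₗ[ℝ] Euc 7, A.toLinearMap = chartCoframe x ∧
      A.symm.toLinearMap = coordVec x := by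
  have := isManifold_one (M := M)
  obtain ⟨B, hB⟩ := isInvertible_mfderiv_extChartAt (I := 𝓡 7) (mem_extChartAt_source (I := 𝓡 7) x)
  refine ⟨B.toLinearEquiv.trans (NormedSpace.fromTangentSpace (𝕜 := ℝ) _).toLinearEquiv, ?_, ?_⟩
  · ext1 v
    rw [chartCoframe, ← hB]
    rfl
  · ext1 v
    rw [coordVec, ← hB, ContinuousLinearMap.inverse_equiv]
    rfl

/-- The derivative of the preferred chart at `x`, as an isomorphism. -/
def coframeEquiv [IsManifold (𝓡 7) ∞ M] (x : M) : TangentSpace (𝓡 7) x ≃ₗ[ℝ] Euc 7 :=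
  (exists_coframeEquiv x).choose

theorem coframeEquiv_eq [IsManifold (𝓡 7) ∞ M] (x : M) :
    (coframeEquiv x).toLinearMap = chartCoframe x :=
  (exists_coframeEquiv x).choose_spec.1

theorem coframeEquiv_symm_eq [IsManifold (𝓡 7) ∞ M] (x : M) :
    (coframeEquiv x).symm.toLinearMap = coordVec x :=
  (exists_coframeEquiv x).choose_spec.2

/-- Tangent spaces at points that are only provably equal are different types, but each unfolds to
the model space; the two maps are compared there. -/
theorem compLinearMap_eq_of_point_eq {W : Type*} [AddCommGroup W] [Module ℝ W] {k : ℕ}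
    (a : FormField M k) {x z : M} (hz : z = x)
    (A : W →ₗ[ℝ] TangentSpace (𝓡 7) z) (B : W →ₗ[ℝ] TangentSpace (𝓡 7) x)
    (hAB : ∀ v, (show Euc 7 from A v) = (show Euc 7 from B v)) :
    (a z).compLinearMap A = (a x).compLinearMap B := by
  subst hz
  have : A = B := LinearMap.ext hAB
  rw [this]

theorem chartFrame_apply_eq_coordVec [IsManifold (𝓡 7) ∞ M] (x : M) (v : Euc 7) :
    (show Euc 7 from chartFrame x (extChartAt (𝓡 7) x x) v)
      = (show Euc 7 from coordVec x v) := by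
  have := isManifold_one (M := M)
  have h := mfderiv_extChartAt_comp_mfderivWithin_extChartAt_symm' (I := 𝓡 7)
    (mem_extChartAt_source (I := 𝓡 7) x)
  rw [ModelWithCorners.Boundaryless.range_eq_univ, mfderivWithin_univ] at h
  have h1 : chartCoframe x (show TangentSpace (𝓡 7) x from
      chartFrame x (extChartAt (𝓡 7) x x) v) = v := by
    exact congrArg (fun A : Euc 7 →L[ℝ] Euc 7 => A v) h
  rw [← coframeEquiv_eq] at h1
  rw [← coframeEquiv_symm_eq]
  exact (LinearEquiv.eq_symm_apply _).2 h1

theorem chartForm_self [IsManifold (𝓡 7) ∞ M] {k : ℕ} (a : FormField M k) (x : M) :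
    chartForm a x (extChartAt (𝓡 7) x x)
      = toCont ((a x).compLinearMap (coframeEquiv x).symm.toLinearMap) := by
  rw [chartForm, coframeEquiv_symm_eq]
  congr 1
  exact compLinearMap_eq_of_point_eq a (extChartAt_to_inv (I := 𝓡 7) x) _ _
    (chartFrame_apply_eq_coordVec x)

/-- `L` is a coframe near `x`, in the preferred chart at `x`, that expresses the `G₂`-structure
through the frame `b`, is the identity at `x`, and has derivative `T` at `x`. -/
structure IsCoframe (φ : G2Structure M) (x : M) (b : Module.Basis (Fin 7) ℝ (Euc 7))
    (L : Euc 7 → Euc 7 →L[ℝ] Euc 7) (T : Euc 7 →L[ℝ] Euc 7 →L[ℝ] Euc 7) : Prop where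
  eq_one : L (extChartAt (𝓡 7) x x) = 1
  hasFDerivAt : HasFDerivAt L T (extChartAt (𝓡 7) x x)
  form_eq : ∀ᶠ y in 𝓝 (extChartAt (𝓡 7) x x),
    chartForm φ.form x y = (toCont (assocForm b)).compContinuousLinearMap (L y)
  coassoc_eq : ∀ᶠ y in 𝓝 (extChartAt (𝓡 7) x x),
    chartForm φ.coassoc x y = (toCont (coassoc b)).compContinuousLinearMap (L y)
  gram_eq : ∀ᶠ y in 𝓝 (extChartAt (𝓡 7) x x), ∀ i j, φ.gram x y i j =
    frameInner b (L y (EuclideanSpace.single i 1)) (L y (EuclideanSpace.single j 1))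

/-- The metric and `∗φ` are functions of `φ`, so any frame that represents `φ` in the chart
represents them too, with no need to relate it to the frame chosen at each point. -/
theorem G2Structure.chart_eq_of_frame [IsManifold (𝓡 7) ∞ M] (φ : G2Structure M) (x : M)
    {y : Euc 7} (hy : y ∈ (extChartAt (𝓡 7) x).target) {c : Module.Basis (Fin 7) ℝ (Euc 7)}
    (hc : (chartForm φ.form x y).toAlternatingMap = assocForm c) :
    chartForm φ.coassoc x y = toCont (G2Geom.coassoc c) ∧ ∀ i j, φ.gram x y i j =
      frameInner c (EuclideanSpace.single i 1) (EuclideanSpace.single j 1) := by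
  obtain ⟨B, hB⟩ := exists_chartFrame_eq x hy
  have h := φ.isG2 ((extChartAt (𝓡 7) x).symm y)
  have h1 : assocForm (h.frame.map B.symm) = assocForm c := by
    rw [← hc, assocForm_map, h.assocForm_frame, hB]
    rfl
  constructor
  · rw [← coassoc_eq_of_assocForm_eq h1, coassoc_map, hB, chartForm]
    congr 2
    exact h.coassocForm_eq h.assocForm_frame.symm
  · intro i j
    rw [← frameInner_eq_of_assocForm_eq h1, frameInner_map]
    change h.metric (chartFrame x y _) (chartFrame x y _) = _
    rw [← hB, h.metric_eq h.assocForm_frame.symm]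
    rfl

theorem toCont_compContinuousLinearMap {k : ℕ} (a : Form (Euc 7) k) (L : Euc 7 →L[ℝ] Euc 7)
    (A : Euc 7 →ₗ[ℝ] Euc 7) (hA : ∀ v, A v = L v) :
    (toCont a).compContinuousLinearMap L = toCont (a.compLinearMap A) := by
  ext v
  have : (fun i => L (v i)) = fun i => A (v i) := funext fun i => (hA (v i)).symm
  change a (fun i => L (v i)) = a (fun i => A (v i))
  rw [this]

/-- Near the centre `L` is invertible, invertibility being an open condition, so it pulls the frame
`b` back to a frame representing `φ`. That frame carries `∗φ` and the metric along. -/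
theorem IsCoframe.of_form_eq [IsManifold (𝓡 7) ∞ M] {φ : G2Structure M} {x : M}
    {b : Module.Basis (Fin 7) ℝ (Euc 7)} {L : Euc 7 → Euc 7 →L[ℝ] Euc 7}
    {T : Euc 7 →L[ℝ] Euc 7 →L[ℝ] Euc 7} (hL1 : L (extChartAt (𝓡 7) x x) = 1)
    (hLT : HasFDerivAt L T (extChartAt (𝓡 7) x x))
    (hform : ∀ᶠ y in 𝓝 (extChartAt (𝓡 7) x x),
      chartForm φ.form x y = (toCont (assocForm b)).compContinuousLinearMap (L y)) :
    IsCoframe φ x b L T := by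
  have key : ∀ᶠ y in 𝓝 (extChartAt (𝓡 7) x x), y ∈ (extChartAt (𝓡 7) x).target ∧
      ∃ A : Euc 7 ≃ₗ[ℝ] Euc 7, (∀ v, A v = L y v) ∧
        (chartForm φ.form x y).toAlternatingMap = assocForm (b.map A.symm) := by
    filter_upwards [hform, target_mem_nhds x, eventually_isUnit hL1 hLT.continuousAt]
      with y hy hyt ⟨A, hA⟩
    refine ⟨hyt, A, hA, ?_⟩
    rw [hy, assocForm_map, toCont_compContinuousLinearMap _ _ A.toLinearMap hA]
    rfl
  refine ⟨hL1, hLT, hform, ?_, ?_⟩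
  · filter_upwards [key] with y ⟨hyt, A, hA, hy⟩
    rw [(φ.chart_eq_of_frame x hyt hy).1, coassoc_map,
      toCont_compContinuousLinearMap _ _ A.toLinearMap hA]
  · filter_upwards [key] with y ⟨hyt, A, hA, hy⟩ i j
    rw [(φ.chart_eq_of_frame x hyt hy).2, frameInner_map, hA, hA]

theorem G2Structure.exists_isCoframe [IsManifold (𝓡 7) ∞ M] (φ : G2Structure M) (x : M)
    {e : Module.Basis (Fin 7) ℝ (TangentSpace (𝓡 7) x)} (he : φ.form x = assocForm e) :
    ∃ L T, IsCoframe φ x (e.map (coframeEquiv x)) L T := by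
  have hd : DifferentiableAt ℝ (chartForm φ.form x) (extChartAt (𝓡 7) x x) :=
    ((φ.smooth x).contDiffAt (target_mem_nhds x)).differentiableAt (by simp)
  have h0 : chartForm φ.form x (extChartAt (𝓡 7) x x)
      = toCont (assocForm (e.map (coframeEquiv x))) := by
    rw [chartForm_self, he]
    exact congrArg toCont (assocForm_map e (coframeEquiv x).symm).symm
  obtain ⟨L, T, hL1, hLT, hL⟩ := exists_pullback_eq _ hd h0
  rw [h0] at hL
  exact ⟨L, T, .of_form_eq hL1 hLT hL⟩

end Charts

section Torsion

open Topology

/-! ### Exterior derivatives in an adapted coframe, and torsion forms -/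

theorem form_apply_three_perm {V : Type*} [AddCommGroup V] [Module ℝ V] (a : Form V 3)
    (u v w : V) : a ![v, u, w] = -a ![u, v, w] ∧ a ![v, w, u] = a ![u, v, w] := by
  have h1 : ∀ u v w, a ![v, u, w] = -a ![u, v, w] := fun u v w => by
    rw [← a.map_swap ![u, v, w] (i := 0) (j := 1) (by decide)]
    refine congrArg a (funext fun i => ?_)
    fin_cases i <;> rfl
  have h2 : a ![v, w, u] = -a ![v, u, w] := by
    rw [← a.map_swap ![v, u, w] (i := 1) (j := 2) (by decide)]
    refine congrArg a (funext fun i => ?_)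
    fin_cases i <;> rfl
  exact ⟨h1 u v w, by rw [h2, h1, neg_neg]⟩

theorem form_apply_four_perm {V : Type*} [AddCommGroup V] [Module ℝ V] (a : Form V 4)
    (u v w z : V) : a ![v, u, w, z] = -a ![u, v, w, z] ∧ a ![v, w, u, z] = a ![u, v, w, z] ∧
      a ![v, w, z, u] = -a ![u, v, w, z] := by
  have h1 : ∀ u v w z, a ![v, u, w, z] = -a ![u, v, w, z] := fun u v w z => by
    rw [← a.map_swap ![u, v, w, z] (i := 0) (j := 1) (by decide)]
    refine congrArg a (funext fun i => ?_)
    fin_cases i <;> rfl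
  have h2 : ∀ u v w z, a ![v, w, u, z] = -a ![v, u, w, z] := fun u v w z => by
    rw [← a.map_swap ![v, u, w, z] (i := 1) (j := 2) (by decide)]
    refine congrArg a (funext fun i => ?_)
    fin_cases i <;> rfl
  have h3 : a ![v, w, z, u] = -a ![v, w, u, z] := by
    rw [← a.map_swap ![v, w, u, z] (i := 2) (j := 3) (by decide)]
    refine congrArg a (funext fun i => ?_)
    fin_cases i <;> rfl
  refine ⟨h1 u v w z, by rw [h2, h1, neg_neg], by rw [h3, h2, h1, neg_neg]⟩

theorem fderiv_pullback {k : ℕ} {Φ : Euc 7 → Euc 7 [⋀^Fin k]→L[ℝ] ℝ} {y₀ : Euc 7}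
    {L : Euc 7 → Euc 7 →L[ℝ] Euc 7} {T : Euc 7 →L[ℝ] Euc 7 →L[ℝ] Euc 7}
    {a : Euc 7 [⋀^Fin k]→L[ℝ] ℝ} (h1 : L y₀ = 1) (hT : HasFDerivAt L T y₀)
    (hΦ : ∀ᶠ y in 𝓝 y₀, Φ y = a.compContinuousLinearMap (L y)) :
    HasFDerivAt Φ (a.fderivCompContinuousLinearMap 1 ∘L T) y₀ := by
  have h := (hasFDerivAt_const a y₀ (𝕜 := ℝ)).continuousAlternatingMapCompContinuousLinearMap hT
  rw [h1, ContinuousLinearMap.comp_zero, zero_add] at h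
  exact h.congr_of_eventuallyEq hΦ

/-- At a point where `L = 1`, the derivative of the pullback is the derivation action of `T` on `a`,
and `d` alternates it. The slot acted upon is moved to the front, to match the tables with a free
first argument. -/
theorem extDeriv_pullback_three {Φ : Euc 7 → Euc 7 [⋀^Fin 3]→L[ℝ] ℝ} {y₀ : Euc 7}
    {L : Euc 7 → Euc 7 →L[ℝ] Euc 7} {T : Euc 7 →L[ℝ] Euc 7 →L[ℝ] Euc 7}
    {a : Form (Euc 7) 3} (h1 : L y₀ = 1) (hT : HasFDerivAt L T y₀)
    (hΦ : ∀ᶠ y in 𝓝 y₀, Φ y = (toCont a).compContinuousLinearMap (L y)) (u v w z : Euc 7) :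
    extDeriv Φ y₀ ![u, v, w, z] =
      (a ![T u v, w, z] - a ![T u w, v, z] + a ![T u z, v, w])
      - (a ![T v u, w, z] - a ![T v w, u, z] + a ![T v z, u, w])
      + (a ![T w u, v, z] - a ![T w v, u, z] + a ![T w z, u, v])
      - (a ![T z u, v, w] - a ![T z v, u, w] + a ![T z w, u, v]) := by
  have key : ∀ p u v w : Euc 7, fderiv ℝ Φ y₀ p ![u, v, w]
      = a ![T p u, v, w] - a ![T p v, u, w] + a ![T p w, u, v] := by
    intro p u v w
    rw [(fderiv_pullback h1 hT hΦ).fderiv]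
    refine (fderivComp_three (toCont a) 1 (T p) u v w).trans ?_
    change a ![T p u, v, w] + a ![u, T p v, w] + a ![u, v, T p w] = _
    rw [(form_apply_three_perm a (T p v) u w).1, (form_apply_three_perm a (T p w) u v).2]
    ring
  have e0 : (0 : Fin 4).removeNth ![u, v, w, z] = ![v, w, z] := by
    funext i; fin_cases i <;> rfl
  have e1 : (1 : Fin 4).removeNth ![u, v, w, z] = ![u, w, z] := by
    funext i; fin_cases i <;> rfl
  have e2 : (2 : Fin 4).removeNth ![u, v, w, z] = ![u, v, z] := by
    funext i; fin_cases i <;> rfl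
  have e3 : (3 : Fin 4).removeNth ![u, v, w, z] = ![u, v, w] := by
    funext i; fin_cases i <;> rfl
  rw [extDeriv, ContinuousAlternatingMap.alternatizeUncurryFin_apply, Fin.sum_univ_four]
  simp only [e0, e1, e2, e3]
  simp [key]
  ring

theorem extDeriv_pullback_four {Φ : Euc 7 → Euc 7 [⋀^Fin 4]→L[ℝ] ℝ} {y₀ : Euc 7}
    {L : Euc 7 → Euc 7 →L[ℝ] Euc 7} {T : Euc 7 →L[ℝ] Euc 7 →L[ℝ] Euc 7}
    {a : Form (Euc 7) 4} (h1 : L y₀ = 1) (hT : HasFDerivAt L T y₀)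
    (hΦ : ∀ᶠ y in 𝓝 y₀, Φ y = (toCont a).compContinuousLinearMap (L y)) (u v w z q : Euc 7) :
    extDeriv Φ y₀ ![u, v, w, z, q] =
      (a ![T u v, w, z, q] - a ![T u w, v, z, q] + a ![T u z, v, w, q] - a ![T u q, v, w, z])
      - (a ![T v u, w, z, q] - a ![T v w, u, z, q] + a ![T v z, u, w, q] - a ![T v q, u, w, z])
      + (a ![T w u, v, z, q] - a ![T w v, u, z, q] + a ![T w z, u, v, q] - a ![T w q, u, v, z])
      - (a ![T z u, v, w, q] - a ![T z v, u, w, q] + a ![T z w, u, v, q] - a ![T z q, u, v, w])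
      + (a ![T q u, v, w, z] - a ![T q v, u, w, z] + a ![T q w, u, v, z]
        - a ![T q z, u, v, w]) := by
  have key : ∀ p u v w z : Euc 7, fderiv ℝ Φ y₀ p ![u, v, w, z]
      = a ![T p u, v, w, z] - a ![T p v, u, w, z] + a ![T p w, u, v, z]
        - a ![T p z, u, v, w] := by
    intro p u v w z
    rw [(fderiv_pullback h1 hT hΦ).fderiv]
    refine (fderivComp_four (toCont a) (T p) u v w z).trans ?_
    simp only [toCont_apply]
    rw [(form_apply_four_perm a (T p v) u w z).1, (form_apply_four_perm a (T p w) u v z).2.1,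
      (form_apply_four_perm a (T p z) u v w).2.2]
    ring
  have e0 : (0 : Fin 5).removeNth ![u, v, w, z, q] = ![v, w, z, q] := by
    funext i; fin_cases i <;> rfl
  have e1 : (1 : Fin 5).removeNth ![u, v, w, z, q] = ![u, w, z, q] := by
    funext i; fin_cases i <;> rfl
  have e2 : (2 : Fin 5).removeNth ![u, v, w, z, q] = ![u, v, z, q] := by
    funext i; fin_cases i <;> rfl
  have e3 : (3 : Fin 5).removeNth ![u, v, w, z, q] = ![u, v, w, q] := by
    funext i; fin_cases i <;> rfl
  have e4 : (4 : Fin 5).removeNth ![u, v, w, z, q] = ![u, v, w, z] := by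
    funext i; fin_cases i <;> rfl
  rw [extDeriv, ContinuousAlternatingMap.alternatizeUncurryFin_apply, Fin.sum_univ_five]
  simp only [e0, e1, e2, e3, e4]
  simp [key]
  ring

/-- The reason why one form `τ₁` serves in both `dφ` and `d∗φ`. Both sides are linear in the
components of `D` on the frame and agree coefficient by coefficient, with no symmetry of `D`
required. -/
theorem contrAssoc_eq_contrCoassoc {V : Type*} [AddCommGroup V] [Module ℝ V]
    (e : Module.Basis (Fin 7) ℝ V) (D : V → V → V) (ξ : Form V 4) (ζ : Form V 5)
    (h1 : ∀ u v w z, ξ ![u, v, w, z] =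
      (assocForm e ![D u v, w, z] - assocForm e ![D u w, v, z]
        + assocForm e ![D u z, v, w])
      - (assocForm e ![D v u, w, z] - assocForm e ![D v w, u, z]
        + assocForm e ![D v z, u, w])
      + (assocForm e ![D w u, v, z] - assocForm e ![D w v, u, z]
        + assocForm e ![D w z, u, v])
      - (assocForm e ![D z u, v, w] - assocForm e ![D z v, u, w]
        + assocForm e ![D z w, u, v]))
    (h2 : ∀ u v w z q, ζ ![u, v, w, z, q] =
      (coassoc e ![D u v, w, z, q] - coassoc e ![D u w, v, z, q]
        + coassoc e ![D u z, v, w, q] - coassoc e ![D u q, v, w, z])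
      - (coassoc e ![D v u, w, z, q] - coassoc e ![D v w, u, z, q]
        + coassoc e ![D v z, u, w, q] - coassoc e ![D v q, u, w, z])
      + (coassoc e ![D w u, v, z, q] - coassoc e ![D w v, u, z, q]
        + coassoc e ![D w z, u, v, q] - coassoc e ![D w q, u, v, z])
      - (coassoc e ![D z u, v, w, q] - coassoc e ![D z v, u, w, q]
        + coassoc e ![D z w, u, v, q] - coassoc e ![D z q, u, v, w])
      + (coassoc e ![D q u, v, w, z] - coassoc e ![D q v, u, w, z]
        + coassoc e ![D q w, u, v, z]
        - coassoc e ![D q z, u, v, w])) (i : Fin 7) : contrAssoc e ξ i = contrCoassoc e ζ i := by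
  fin_cases i <;>
  · simp only [contrAssoc, contrCoassoc, Fin.mk_one, Fin.zero_eta, Fin.isValue, Fin.reduceFinMk,
      Matrix.cons_val]
    simp only [h1, h2]
    simp only [assocForm_table_0, assocForm_table_1, assocForm_table_2, coassoc_table_0,
      coassoc_table_1, coassoc_table_2, coassoc_table_3, coassoc_table_4]
    ring

theorem G2Structure.IsTorsion.isTorsionAt {M : Type*} [TopologicalSpace M]
    [ChartedSpace (Euc 7) M] {φ : G2Structure M} {τ : ∀ x : M, TorsionForms (TangentSpace (𝓡 7) x)}
    (h : φ.IsTorsion τ) {x : M} {e : Module.Basis (Fin 7) ℝ (TangentSpace (𝓡 7) x)}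
    (he : φ.form x = assocForm e) :
    IsTorsionAt e (extD φ.form x) (extD φ.coassoc x) (τ x) := by
  have hc : φ.coassoc x = G2Geom.coassoc e := (φ.isG2 x).coassocForm_eq he
  have h1 := h.d_form x
  have h2 := h.d_coassoc x
  have h4 := h.mem_three x
  rw [(φ.isG2 x).star_eq he, hc, he] at h1
  rw [hc, he] at h2 h4
  exact ⟨h1, h2, ((φ.isG2 x).mem_lam14_iff he _).1 (h.mem_two x), h4⟩

theorem G2Structure.isTorsion_iff {M : Type*} [TopologicalSpace M]
    [ChartedSpace (Euc 7) M] (φ : G2Structure M)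
    (e : ∀ x, Module.Basis (Fin 7) ℝ (TangentSpace (𝓡 7) x))
    (he : ∀ x, φ.form x = assocForm (e x)) (τ : ∀ x : M, TorsionForms (TangentSpace (𝓡 7) x)) :
    φ.IsTorsion τ ↔ ∀ x, IsTorsionAt (e x) (extD φ.form x) (extD φ.coassoc x) (τ x) := by
  have hc : ∀ x, φ.coassoc x = G2Geom.coassoc (e x) := fun x => (φ.isG2 x).coassocForm_eq (he x)
  refine ⟨fun h x => h.isTorsionAt (he x), ?_⟩
  intro h
  refine ⟨fun x => ?_, fun x => ?_, fun x => ?_, fun x => ?_⟩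
  · rw [(φ.isG2 x).star_eq (he x), hc, he x]
    exact (h x).d_form
  · rw [hc, he x]
    exact (h x).d_coassoc
  · exact ((φ.isG2 x).mem_lam14_iff (he x) _).2 (h x).mem_two
  · rw [hc, he x]
    exact (h x).mem_three

variable {M : Type*} [TopologicalSpace M] [ChartedSpace (Euc 7) M] [IsManifold (𝓡 7) ∞ M]

/-- The derivative at `x` of a coframe, as a bilinear map on the tangent space. -/
def coframeDeriv (x : M) (T : Euc 7 →L[ℝ] Euc 7 →L[ℝ] Euc 7) (u v : TangentSpace (𝓡 7) x) :
    TangentSpace (𝓡 7) x :=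
  (coframeEquiv x).symm (T (coframeEquiv x u) (coframeEquiv x v))

theorem assocForm_map_coframeEquiv {x : M} (e : Module.Basis (Fin 7) ℝ (TangentSpace (𝓡 7) x))
    (u v w : Euc 7) : assocForm (e.map (coframeEquiv x)) ![u, v, w] = assocForm e
      ![(coframeEquiv x).symm u, (coframeEquiv x).symm v, (coframeEquiv x).symm w] := by
  rw [show e.map (coframeEquiv x) = e.map ((coframeEquiv x).symm).symm from rfl, assocForm_map,
    compLinearMap_apply_three]
  rfl

theorem coassoc_map_coframeEquiv {x : M} (e : Module.Basis (Fin 7) ℝ (TangentSpace (𝓡 7) x))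
    (u v w z : Euc 7) : coassoc (e.map (coframeEquiv x)) ![u, v, w, z] = coassoc e
      ![(coframeEquiv x).symm u, (coframeEquiv x).symm v, (coframeEquiv x).symm w,
        (coframeEquiv x).symm z] := by
  rw [show e.map (coframeEquiv x) = e.map ((coframeEquiv x).symm).symm from rfl, coassoc_map,
    AlternatingMap.compLinearMap_apply]
  refine congrArg (coassoc e) (funext fun i => ?_)
  fin_cases i <;> rfl

section

variable {φ : G2Structure M} {x : M} {e : Module.Basis (Fin 7) ℝ (TangentSpace (𝓡 7) x)}
  {L : Euc 7 → Euc 7 →L[ℝ] Euc 7} {T : Euc 7 →L[ℝ] Euc 7 →L[ℝ] Euc 7}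

theorem IsCoframe.extD_form_apply (h : IsCoframe φ x (e.map (coframeEquiv x)) L T)
    (u v w z : TangentSpace (𝓡 7) x) :
    DFunLike.coe (F := Form _ 4) (extD φ.form x) ![u, v, w, z] =
      (assocForm e ![coframeDeriv x T u v, w, z] - assocForm e ![coframeDeriv x T u w, v, z]
        + assocForm e ![coframeDeriv x T u z, v, w])
      - (assocForm e ![coframeDeriv x T v u, w, z] - assocForm e ![coframeDeriv x T v w, u, z]
        + assocForm e ![coframeDeriv x T v z, u, w])
      + (assocForm e ![coframeDeriv x T w u, v, z] - assocForm e ![coframeDeriv x T w v, u, z]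
        + assocForm e ![coframeDeriv x T w z, u, v])
      - (assocForm e ![coframeDeriv x T z u, v, w] - assocForm e ![coframeDeriv x T z v, u, w]
        + assocForm e ![coframeDeriv x T z w, u, v]) := by
  have h1 : DFunLike.coe (F := Form _ 4) (extD φ.form x) ![u, v, w, z]
      = extDeriv (chartForm φ.form x) (extChartAt (𝓡 7) x x) ![coframeEquiv x u,
        coframeEquiv x v, coframeEquiv x w, coframeEquiv x z] := by
    rw [extD, ← coframeEquiv_eq]
    refine congrArg (extDeriv (chartForm φ.form x) (extChartAt (𝓡 7) x x)) (funext fun i => ?_)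
    fin_cases i <;> rfl
  rw [h1, extDeriv_pullback_three h.eq_one h.hasFDerivAt h.form_eq]
  simp only [coframeDeriv, assocForm_map_coframeEquiv, LinearEquiv.symm_apply_apply]

theorem IsCoframe.extD_coassoc_apply (h : IsCoframe φ x (e.map (coframeEquiv x)) L T)
    (u v w z q : TangentSpace (𝓡 7) x) :
    DFunLike.coe (F := Form _ 5) (extD φ.coassoc x) ![u, v, w, z, q] =
      (coassoc e ![coframeDeriv x T u v, w, z, q] - coassoc e ![coframeDeriv x T u w, v, z, q]
        + coassoc e ![coframeDeriv x T u z, v, w, q] - coassoc e ![coframeDeriv x T u q, v, w, z])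
      - (coassoc e ![coframeDeriv x T v u, w, z, q] - coassoc e ![coframeDeriv x T v w, u, z, q]
        + coassoc e ![coframeDeriv x T v z, u, w, q] - coassoc e ![coframeDeriv x T v q, u, w, z])
      + (coassoc e ![coframeDeriv x T w u, v, z, q] - coassoc e ![coframeDeriv x T w v, u, z, q]
        + coassoc e ![coframeDeriv x T w z, u, v, q] - coassoc e ![coframeDeriv x T w q, u, v, z])
      - (coassoc e ![coframeDeriv x T z u, v, w, q] - coassoc e ![coframeDeriv x T z v, u, w, q]
        + coassoc e ![coframeDeriv x T z w, u, v, q] - coassoc e ![coframeDeriv x T z q, u, v, w])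
      + (coassoc e ![coframeDeriv x T q u, v, w, z] - coassoc e ![coframeDeriv x T q v, u, w, z]
        + coassoc e ![coframeDeriv x T q w, u, v, z]
        - coassoc e ![coframeDeriv x T q z, u, v, w]) := by
  have h1 : DFunLike.coe (F := Form _ 5) (extD φ.coassoc x) ![u, v, w, z, q]
      = extDeriv (chartForm φ.coassoc x) (extChartAt (𝓡 7) x x) ![coframeEquiv x u,
        coframeEquiv x v, coframeEquiv x w, coframeEquiv x z, coframeEquiv x q] := by
    rw [extD, ← coframeEquiv_eq]
    refine congrArg (extDeriv (chartForm φ.coassoc x) (extChartAt (𝓡 7) x x))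
      (funext fun i => ?_)
    fin_cases i <;> rfl
  rw [h1, extDeriv_pullback_four h.eq_one h.hasFDerivAt h.coassoc_eq]
  simp only [coframeDeriv, coassoc_map_coframeEquiv, LinearEquiv.symm_apply_apply]

/-- The exterior derivatives of `φ` and `∗φ` determine the same `1`-form. -/
theorem IsCoframe.contr_extD_eq (h : IsCoframe φ x (e.map (coframeEquiv x)) L T) (i : Fin 7) :
    contrAssoc e (extD φ.form x) i = contrCoassoc e (extD φ.coassoc x) i :=
  contrAssoc_eq_contrCoassoc e (coframeDeriv x T) _ _ h.extD_form_apply h.extD_coassoc_apply i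

end

/-- The torsion forms of a `G₂`-structure exist and are unique. -/
theorem G2Structure.existsUnique_isTorsion (φ : G2Structure M) : ∃! τ, φ.IsTorsion τ := by
  have hex : ∀ x, ∃! t, IsTorsionAt (φ.isG2 x).frame (extD φ.form x) (extD φ.coassoc x) t := by
    intro x
    obtain ⟨L, T, hLT⟩ := φ.exists_isCoframe x (φ.isG2 x).assocForm_frame.symm
    exact existsUnique_isTorsionAt _ _ _ hLT.contr_extD_eq
  have hiff := φ.isTorsion_iff _ fun x => (φ.isG2 x).assocForm_frame.symm
  refine ⟨fun x => (hex x).choose, (hiff _).2 fun x => (hex x).choose_spec.1, fun τ hτ => ?_⟩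
  funext x
  exact (hex x).choose_spec.2 _ ((hiff τ).1 hτ x)

end Torsion

section Immersion

open Topology

/-! ### Coassociative immersions in coordinates -/

variable {M : Type*} [TopologicalSpace M] [ChartedSpace (Euc 7) M] [IsManifold (𝓡 7) ∞ M]
  {S : Type*} [TopologicalSpace S] [ChartedSpace (Euc 4) S] [IsManifold (𝓡 4) ∞ S]

theorem extChartAt_injective_mfderiv (p : S) :
    ∃ A : TangentSpace (𝓡 4) p ≃ₗ[ℝ] Euc 4, ∀ v, A v =
      (show Euc 4 from mfderiv (𝓡 4) 𝓘(ℝ, Euc 4) (extChartAt (𝓡 4) p) p v) := by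
  have : IsManifold (𝓡 4) 1 S := IsManifold.of_le (n := ∞) (by exact_mod_cast le_top)
  obtain ⟨B, hB⟩ := isInvertible_mfderiv_extChartAt (I := 𝓡 4) (mem_extChartAt_source (I := 𝓡 4) p)
  refine ⟨B.toLinearEquiv.trans (NormedSpace.fromTangentSpace (𝕜 := ℝ) _).toLinearEquiv,
    fun v => ?_⟩
  rw [← hB]
  rfl

variable {f : S → M}

theorem contDiffAt_writtenInExtChartAt {M : Type*} [TopologicalSpace M] [ChartedSpace (Euc 7) M]
    {S : Type*} [TopologicalSpace S] [ChartedSpace (Euc 4) S] {f : S → M}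
    (hf : ContMDiff (𝓡 4) (𝓡 7) ∞ f) (p : S) :
    ContDiffAt ℝ ∞ (writtenInExtChartAt (𝓡 4) (𝓡 7) p f) (extChartAt (𝓡 4) p p) := by
  have h := (contMDiffAt_iff.1 (hf p)).2
  rw [ModelWithCorners.Boundaryless.range_eq_univ, contDiffWithinAt_univ] at h
  exact h

theorem writtenInExtChartAt_apply_self {M : Type*} [TopologicalSpace M]
    [ChartedSpace (Euc 7) M] {S : Type*} [TopologicalSpace S] [ChartedSpace (Euc 4) S] {f : S → M}
    (p : S) :
    writtenInExtChartAt (𝓡 4) (𝓡 7) p f (extChartAt (𝓡 4) p p) = extChartAt (𝓡 7) (f p) (f p) := by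
  simp [writtenInExtChartAt]

/-- The derivative of the coordinate representation is the coordinate representation of the
derivative. -/
theorem coframeEquiv_mfderiv (hf : ContMDiff (𝓡 4) (𝓡 7) ∞ f) (p : S) :
    ∃ A : TangentSpace (𝓡 4) p ≃ₗ[ℝ] Euc 4, ∀ v,
      coframeEquiv (f p) (mfderiv (𝓡 4) (𝓡 7) f p v) =
        fderiv ℝ (writtenInExtChartAt (𝓡 4) (𝓡 7) p f) (extChartAt (𝓡 4) p p) (A v) := by
  have i4 : IsManifold (𝓡 4) 1 S := IsManifold.of_le (n := ∞) (by exact_mod_cast le_top)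
  have i7 := isManifold_one (M := M)
  obtain ⟨A, hA⟩ := extChartAt_injective_mfderiv p
  refine ⟨A, fun v => ?_⟩
  set F := writtenInExtChartAt (𝓡 4) (𝓡 7) p f
  have hF : DifferentiableAt ℝ F (extChartAt (𝓡 4) p p) :=
    (contDiffAt_writtenInExtChartAt hf p).differentiableAt (by simp)
  have hfd : MDifferentiableAt (𝓡 4) (𝓡 7) f p := (hf p).mdifferentiableAt (by simp)
  have heq : extChartAt (𝓡 7) (f p) ∘ f =ᶠ[𝓝 p] F ∘ extChartAt (𝓡 4) p := by
    filter_upwards [extChartAt_source_mem_nhds (I := 𝓡 4) p] with q hq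
    simp only [F, writtenInExtChartAt, Function.comp_apply, (extChartAt (𝓡 4) p).left_inv hq]
  have h1 := heq.mfderiv_eq (I := 𝓡 4) (I' := 𝓘(ℝ, Euc 7))
  rw [mfderiv_comp p (mdifferentiableAt_extChartAt (I := 𝓡 7) (mem_chart_source _ (f p))) hfd,
    mfderiv_comp p hF.mdifferentiableAt
      (mdifferentiableAt_extChartAt (I := 𝓡 4) (mem_chart_source _ p)), mfderiv_eq_fderiv] at h1
  have h2 : chartCoframe (f p) (mfderiv (𝓡 4) (𝓡 7) f p v) = fderiv ℝ F (extChartAt (𝓡 4) p p)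
      (show Euc 4 from mfderiv (𝓡 4) 𝓘(ℝ, Euc 4) (extChartAt (𝓡 4) p) p v) :=
    congrArg (fun B : TangentSpace (𝓡 4) p →L[ℝ] Euc 7 => B v) h1
  rw [← coframeEquiv_eq, ← hA] at h2
  exact h2

/-- The condition `F^*φ = 0` is needed in coordinates on a neighbourhood, not merely at the point,
because it is going to be differentiated. -/
theorem eventually_chartForm_eq_zero {φ : G2Structure M} (hf : φ.IsCoassociativeImmersion f)
    (p : S) : ∀ᶠ u in 𝓝 (extChartAt (𝓡 4) p p),
      (chartForm φ.form (f p) (writtenInExtChartAt (𝓡 4) (𝓡 7) p f u)).compContinuousLinearMap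
        (fderiv ℝ (writtenInExtChartAt (𝓡 4) (𝓡 7) p f) u) = 0 := by
  have i4 : IsManifold (𝓡 4) 1 S := IsManifold.of_le (n := ∞) (by exact_mod_cast le_top)
  have i7 := isManifold_one (M := M)
  set F := writtenInExtChartAt (𝓡 4) (𝓡 7) p f with hFdef
  set u₀ := extChartAt (𝓡 4) p p with hu₀
  have hc : ContDiffAt ℝ 1 F u₀ := (contDiffAt_writtenInExtChartAt hf.smooth p).of_le (by
    exact_mod_cast le_top)
  have hd : ∀ᶠ u in 𝓝 u₀, DifferentiableAt ℝ F u :=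
    (hc.eventually (by simp)).mono fun u hu => hu.differentiableAt (by simp)
  have hsrc : ∀ᶠ q in 𝓝 p, f q ∈ (extChartAt (𝓡 7) (f p)).source :=
    (hf.smooth.continuous.continuousAt).eventually_mem (extChartAt_source_mem_nhds (I := 𝓡 7) (f p))
  have hsrc' : ∀ᶠ u in 𝓝 u₀, f ((extChartAt (𝓡 4) p).symm u) ∈
      (extChartAt (𝓡 7) (f p)).source := by
    have hcs := continuousAt_extChartAt_symm (I := 𝓡 4) p
    rw [ContinuousAt, extChartAt_to_inv] at hcs
    exact hcs.eventually hsrc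
  filter_upwards [hd, hsrc'.eventually_nhds, extChartAt_target_mem_nhds (I := 𝓡 4) p]
    with u hdu hu hut
  set q := (extChartAt (𝓡 4) p).symm u with hq
  have hus := hu.self_of_nhds
  have hFu : F u ∈ (extChartAt (𝓡 7) (f p)).target := (extChartAt (𝓡 7) (f p)).map_source hus
  have hz : (extChartAt (𝓡 7) (f p)).symm (F u) = f q := (extChartAt (𝓡 7) (f p)).left_inv hus
  -- This identity of germs at `u`, with the chain rule, identifies the coordinate derivative of `F`
  -- with the derivative of `f` at the nearby point `q`, where coassociativity applies.
  have heq : (extChartAt (𝓡 7) (f p)).symm ∘ F =ᶠ[𝓝 u] f ∘ (extChartAt (𝓡 4) p).symm := by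
    filter_upwards [hu] with w hw
    exact (extChartAt (𝓡 7) (f p)).left_inv hw
  have h7 : MDifferentiableAt 𝓘(ℝ, Euc 7) (𝓡 7) (extChartAt (𝓡 7) (f p)).symm (F u) := by
    have := mdifferentiableWithinAt_extChartAt_symm (I := 𝓡 7) hFu
    rwa [ModelWithCorners.Boundaryless.range_eq_univ, mdifferentiableWithinAt_univ] at this
  have h4 : MDifferentiableAt 𝓘(ℝ, Euc 4) (𝓡 4) (extChartAt (𝓡 4) p).symm u := by
    have := mdifferentiableWithinAt_extChartAt_symm (I := 𝓡 4) hut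
    rwa [ModelWithCorners.Boundaryless.range_eq_univ, mdifferentiableWithinAt_univ] at this
  have hfd : MDifferentiableAt (𝓡 4) (𝓡 7) f q := (hf.smooth q).mdifferentiableAt (by simp)
  have h1 := heq.mfderiv_eq (I := 𝓘(ℝ, Euc 4)) (I' := 𝓡 7)
  have e1 := mfderiv_comp u h7 hdu.mdifferentiableAt
  have e2 := mfderiv_comp u hfd h4
  rw [mfderiv_eq_fderiv] at e1
  let B : Euc 4 →ₗ[ℝ] TangentSpace (𝓡 7) (f q) :=
    ((mfderiv (𝓡 4) (𝓡 7) f q).comp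
      (mfderiv 𝓘(ℝ, Euc 4) (𝓡 4) (extChartAt (𝓡 4) p).symm u)).toLinearMap
  have h2 := compLinearMap_eq_of_point_eq φ.form hz
    ((chartFrame (f p) (F u)).comp (fderiv ℝ F u).toLinearMap) B fun v =>
      (congrArg (fun D : Euc 4 →L[ℝ] Euc 7 => D v) e1).symm.trans <|
        (congrArg (fun D : Euc 4 →L[ℝ] Euc 7 => D v) h1).trans
          (congrArg (fun D : Euc 4 →L[ℝ] Euc 7 => D v) e2)
  have h3 : (φ.form (f q)).compLinearMap B = 0 := by
    ext v
    have hv := (hf.coassociative q).2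
    have hm : ∀ i, B (v i) ∈ G2Structure.tangentPlane f q := fun i => ⟨_, rfl⟩
    have := hv _ (hm 0) _ (hm 1) _ (hm 2)
    refine Eq.trans (congrArg (φ.form (f q)) (funext fun i => ?_)) this
    fin_cases i <;> rfl
  rw [h3] at h2
  ext v
  exact congrArg (fun a : Form (Euc 4) 3 => a v) h2

end Immersion

section Christoffel

open Topology

/-! ### The Levi-Civita connection in an adapted coframe -/

section

variable {V : Type*} [AddCommGroup V] [Module ℝ V] {n : ℕ}

theorem frameInner_add_left (e : Module.Basis (Fin n) ℝ V) (x y z : V) :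
    frameInner e (x + y) z = frameInner e x z + frameInner e y z := by
  simp [frameInner, add_mul, Finset.sum_add_distrib]

theorem frameInner_add_right (e : Module.Basis (Fin n) ℝ V) (x y z : V) :
    frameInner e x (y + z) = frameInner e x y + frameInner e x z := by
  simp [frameInner, mul_add, Finset.sum_add_distrib]

theorem frameInner_smul_left (e : Module.Basis (Fin n) ℝ V) (c : ℝ) (x y : V) :
    frameInner e (c • x) y = c * frameInner e x y := by
  simp [frameInner, Finset.mul_sum, mul_assoc]

theorem frameInner_smul_right (e : Module.Basis (Fin n) ℝ V) (c : ℝ) (x y : V) :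
    frameInner e x (c • y) = c * frameInner e x y := by
  simp [frameInner, Finset.mul_sum, mul_left_comm]

end

theorem eq_sum_single {n : ℕ} (v : Euc n) : v = ∑ i, v i • EuclideanSpace.single i (1 : ℝ) := by
  ext j
  simp [Finset.sum_apply, Pi.single_apply]

theorem isLinearMap_eq_sum {n : ℕ} {g : Euc n → ℝ} (hg : IsLinearMap ℝ g) (v : Euc n) :
    g v = ∑ i, v i * g (EuclideanSpace.single i 1) := by
  have := congrArg (hg.mk' g) (eq_sum_single v)
  rw [map_sum] at this
  simpa using this

theorem frameInner_eq_sum (b : Module.Basis (Fin 7) ℝ (Euc 7)) (v w : Euc 7) :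
    frameInner b v w = ∑ k, ∑ m, v k * (w m *
      frameInner b (EuclideanSpace.single k 1) (EuclideanSpace.single m 1)) := by
  rw [isLinearMap_eq_sum (g := fun v => frameInner b v w)
    ⟨fun x y => frameInner_add_left b x y w, fun c x => frameInner_smul_left b c x w⟩]
  refine Finset.sum_congr rfl fun k _ => ?_
  rw [isLinearMap_eq_sum (g := fun w => frameInner b (EuclideanSpace.single k 1) w)
    ⟨fun x y => frameInner_add_right b _ x y, fun c x => frameInner_smul_right b c _ x⟩,
    Finset.mul_sum]

theorem fderiv_frameInner (b : Module.Basis (Fin 7) ℝ (Euc 7)) {L : Euc 7 → Euc 7 →L[ℝ] Euc 7}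
    {T : Euc 7 →L[ℝ] Euc 7 →L[ℝ] Euc 7} {y₀ : Euc 7} (hT : HasFDerivAt L T y₀) (v w d : Euc 7) :
    fderiv ℝ (fun y => frameInner b (L y v) (L y w)) y₀ d
      = frameInner b (T d v) (L y₀ w) + frameInner b (L y₀ v) (T d w) := by
  let c : Fin 7 → Euc 7 →L[ℝ] ℝ := fun k => LinearMap.toContinuousLinearMap (b.coord k)
  have hk : ∀ (v : Euc 7) (k : Fin 7), HasFDerivAt (fun y => b.repr (L y v) k)
      ((c k).comp (T.flip v)) y₀ := by
    intro v k
    have h1 : HasFDerivAt (fun y => L y v) (T.flip v) y₀ := by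
      have := hT.clm_apply (hasFDerivAt_const v y₀)
      simpa using this
    exact (c k).hasFDerivAt.comp y₀ h1
  have h : HasFDerivAt (fun y => ∑ k, b.repr (L y v) k * b.repr (L y w) k)
      (∑ k, (b.repr (L y₀ v) k • (c k).comp (T.flip w) + b.repr (L y₀ w) k • (c k).comp (T.flip v)))
      y₀ := HasFDerivAt.fun_sum fun k _ => (hk v k).mul (hk w k)
  refine (congrArg (fun D : Euc 7 →L[ℝ] ℝ => D d) h.fderiv).trans ?_
  have hc : ∀ k z, c k z = b.repr z k := fun k z => rfl
  simp only [frameInner, ← Finset.sum_add_distrib, _root_.sum_apply, _root_.add_apply,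
    _root_.smul_apply, ContinuousLinearMap.comp_apply, ContinuousLinearMap.flip_apply, hc,
    smul_eq_mul]
  exact Finset.sum_congr rfl fun k _ => by ring

variable {M : Type*} [TopologicalSpace M] [ChartedSpace (Euc 7) M]
  {φ : G2Structure M} {x : M} {b : Module.Basis (Fin 7) ℝ (Euc 7)}
  {L : Euc 7 → Euc 7 →L[ℝ] Euc 7} {T : Euc 7 →L[ℝ] Euc 7 →L[ℝ] Euc 7}

/-- The derivative of the metric in a coframe with derivative `T`. -/
def metricDeriv (b : Module.Basis (Fin 7) ℝ (Euc 7)) (T : Euc 7 →L[ℝ] Euc 7 →L[ℝ] Euc 7)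
    (u v w : Euc 7) : ℝ :=
  frameInner b (T u v) w + frameInner b v (T u w)

theorem IsCoframe.gram_self (h : IsCoframe φ x b L T) (i j : Fin 7) :
    φ.gram x (extChartAt (𝓡 7) x x) i j =
      frameInner b (EuclideanSpace.single i 1) (EuclideanSpace.single j 1) := by
  rw [h.gram_eq.self_of_nhds, h.eq_one]
  rfl

theorem IsCoframe.dGram_self (h : IsCoframe φ x b L T) (l i j : Fin 7) :
    φ.dGram x (extChartAt (𝓡 7) x x) l i j = metricDeriv b T (EuclideanSpace.single l 1)
      (EuclideanSpace.single i 1) (EuclideanSpace.single j 1) := by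
  have h1 : (fun z => φ.gram x z i j) =ᶠ[𝓝 (extChartAt (𝓡 7) x x)] fun y =>
      frameInner b (L y (EuclideanSpace.single i 1)) (L y (EuclideanSpace.single j 1)) :=
    h.gram_eq.mono fun y hy => hy i j
  rw [G2Structure.dGram, h1.fderiv_eq, fderiv_frameInner b h.hasFDerivAt, h.eq_one]
  rfl

/-- Lowering the upper index cancels the inverse Gram matrix in the definition of the Christoffel
symbols. The Gram matrix is invertible, being `Aᵀ A` for a change of basis `A`. -/
theorem IsCoframe.sum_christoffel_mul_gram (h : IsCoframe φ x b L T) (i j m : Fin 7) :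
    ∑ k, φ.christoffel x (extChartAt (𝓡 7) x x) k i j *
      frameInner b (EuclideanSpace.single k 1) (EuclideanSpace.single m 1) =
    (1 / 2) * (φ.dGram x (extChartAt (𝓡 7) x x) i j m + φ.dGram x (extChartAt (𝓡 7) x x) j i m
      - φ.dGram x (extChartAt (𝓡 7) x x) m i j) := by
  set G := φ.gram x (extChartAt (𝓡 7) x x) with hG
  have hGs : ∀ i j, G i j = G j i := fun i j => by
    rw [hG, h.gram_self, h.gram_self, frameInner_comm]
  have hdet : IsUnit G.det := by
    let b' := (EuclideanSpace.basisFun (Fin 7) ℝ).toBasis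
    have hGA : G = (b.toMatrix b').transpose * b.toMatrix b' := by
      ext i j
      rw [hG, h.gram_self]
      simp [Matrix.mul_apply, frameInner, Module.Basis.toMatrix_apply, b']
    have hA : IsUnit (b.toMatrix b').det :=
      (Matrix.isUnit_iff_isUnit_det _).1 (IsUnit.of_mul_eq_one _ (b.toMatrix_mul_toMatrix_flip b'))
    rw [hGA, Matrix.det_mul, Matrix.det_transpose]
    exact hA.mul hA
  have hinv : ∀ l, ∑ k, G⁻¹ k l * G k m = if m = l then 1 else 0 := by
    intro l
    have := congrFun (congrFun (Matrix.mul_nonsing_inv G hdet) m) l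
    rw [Matrix.mul_apply, Matrix.one_apply] at this
    rw [← this]
    exact Finset.sum_congr rfl fun k _ => by rw [hGs m k, mul_comm]
  simp only [← h.gram_self, ← hG, G2Structure.christoffel]
  generalize φ.dGram x (extChartAt (𝓡 7) x x) = dg
  calc _ = ∑ l, (1 / 2) * (dg i j l + dg j i l - dg l i j) * ∑ k, G⁻¹ k l * G k m := by
        simp only [Finset.mul_sum, Finset.sum_mul]
        rw [Finset.sum_comm]
        refine Finset.sum_congr rfl fun l _ => Finset.sum_congr rfl fun k _ => ?_
        ring
    _ = _ := by simp [hinv]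

theorem metricDeriv_eq_sum (u v w : Euc 7) :
    metricDeriv b T u v w = ∑ i, ∑ j, ∑ m, u i * (v j * (w m * metricDeriv b T
      (EuclideanSpace.single i 1) (EuclideanSpace.single j 1) (EuclideanSpace.single m 1))) := by
  rw [isLinearMap_eq_sum (g := fun u => metricDeriv b T u v w)
    ⟨fun x y => by simp [metricDeriv, frameInner_add_left, frameInner_add_right]; ring,
      fun c x => by simp [metricDeriv, frameInner_smul_left, frameInner_smul_right]; ring⟩]
  refine Finset.sum_congr rfl fun i _ => ?_
  rw [isLinearMap_eq_sum (g := fun v => metricDeriv b T (EuclideanSpace.single i 1) v w)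
    ⟨fun x y => by simp [metricDeriv, frameInner_add_left]; ring,
      fun c x => by simp [metricDeriv, frameInner_smul_left]; ring⟩,
    Finset.mul_sum]
  refine Finset.sum_congr rfl fun j _ => ?_
  rw [isLinearMap_eq_sum (g := fun w => metricDeriv b T (EuclideanSpace.single i 1)
      (EuclideanSpace.single j 1) w)
    ⟨fun x y => by simp [metricDeriv, frameInner_add_right]; ring,
      fun c x => by simp [metricDeriv, frameInner_smul_right]; ring⟩,
    Finset.mul_sum, Finset.mul_sum]

/-- The Koszul formula. -/
theorem IsCoframe.frameInner_christoffel (h : IsCoframe φ x b L T) (u v w : Euc 7) :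
    frameInner b (WithLp.toLp 2 fun k => ∑ i, ∑ j,
      φ.christoffel x (extChartAt (𝓡 7) x x) k i j * u i * v j) w =
    (1 / 2) * (metricDeriv b T u v w + metricDeriv b T v u w - metricDeriv b T w u v) := by
  have h1 : frameInner b (WithLp.toLp 2 fun k => ∑ i, ∑ j,
      φ.christoffel x (extChartAt (𝓡 7) x x) k i j * u i * v j) w =
      ∑ i, ∑ j, ∑ m, u i * (v j * (w m * ((1 / 2) * (φ.dGram x (extChartAt (𝓡 7) x x) i j m
        + φ.dGram x (extChartAt (𝓡 7) x x) j i m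
        - φ.dGram x (extChartAt (𝓡 7) x x) m i j)))) := by
    simp only [← h.sum_christoffel_mul_gram]
    rw [frameInner_eq_sum]
    simp only [Finset.sum_mul, Finset.mul_sum]
    rw [Finset.sum_comm]
    refine (Finset.sum_congr rfl fun m _ => (Finset.sum_comm.trans
      (Finset.sum_congr rfl fun i _ => Finset.sum_comm))).trans ?_
    rw [Finset.sum_comm]
    refine Finset.sum_congr rfl fun i _ => ?_
    rw [Finset.sum_comm]
    refine Finset.sum_congr rfl fun j _ => Finset.sum_congr rfl fun m _ =>
      Finset.sum_congr rfl fun k _ => ?_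
    ring
  have h2 : metricDeriv b T v u w = ∑ i, ∑ j, ∑ m, u i * (v j * (w m * metricDeriv b T
      (EuclideanSpace.single j 1) (EuclideanSpace.single i 1) (EuclideanSpace.single m 1))) := by
    rw [metricDeriv_eq_sum, Finset.sum_comm]
    refine Finset.sum_congr rfl fun i _ => Finset.sum_congr rfl fun j _ =>
      Finset.sum_congr rfl fun m _ => ?_
    ring
  have h3 : metricDeriv b T w u v = ∑ i, ∑ j, ∑ m, u i * (v j * (w m * metricDeriv b T
      (EuclideanSpace.single m 1) (EuclideanSpace.single i 1) (EuclideanSpace.single j 1))) := by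
    rw [metricDeriv_eq_sum, Finset.sum_comm]
    refine Finset.sum_congr rfl fun i _ => ?_
    rw [Finset.sum_comm]
    refine Finset.sum_congr rfl fun j _ => Finset.sum_congr rfl fun m _ => ?_
    ring
  rw [h1, metricDeriv_eq_sum u v w, h2, h3]
  simp only [← Finset.sum_add_distrib, ← Finset.sum_sub_distrib, Finset.mul_sum, h.dGram_self]
  refine Finset.sum_congr rfl fun i _ => Finset.sum_congr rfl fun j _ =>
    Finset.sum_congr rfl fun m _ => ?_
  ring

end Christoffel

section MeanCurvature

open Topology

/-! ### The mean curvature of a coassociative immersion -/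

/-- The trace of a bilinear form with respect to a metric, in an orthonormal frame `s`. -/
theorem sum_inv_mul_eq_sum {n : ℕ} (h : Matrix (Fin n) (Fin n) ℝ) (P : Matrix (Fin n) (Fin n) ℝ)
    (hP : P * h * P.transpose = 1) (K : Fin n → Fin n → ℝ) :
    ∑ a, ∑ b, h⁻¹ a b * K a b = ∑ c, ∑ a, ∑ b, P c a * (P c b * K a b) := by
  -- A right inverse of a square matrix is a left inverse, so `P` can be moved around the product,
  -- which shows `h⁻¹ = Pᵀ P`.
  have h1 : h * (P.transpose * P) = 1 := by
    rw [← mul_assoc]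
    exact mul_eq_one_comm.1 (by rwa [← mul_assoc])
  rw [Matrix.inv_eq_right_inv h1]
  simp only [Matrix.mul_apply, Matrix.transpose_apply, Finset.sum_mul, mul_assoc]
  exact (Finset.sum_congr rfl fun a _ => Finset.sum_comm).trans Finset.sum_comm

/-- The linear identity behind the mean curvature formula: `s` is the second fundamental form in
the frame `b`, whose last four vectors are tangent, and `D` is the derivative of the coframe. -/
theorem sum_secondFundamentalForm_eq {V : Type*} [AddCommGroup V] [Module ℝ V]
    (b : Module.Basis (Fin 7) ℝ V) (D : V → V → V) (s : Fin 4 → Fin 4 → V) (X : Fin 4 → V)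
    (hX : X = ![b 3, b 4, b 5, b 6])
    (hs : ∀ c d, s c d - D (X c) (X d) = s d c - D (X d) (X c))
    (hc : ∀ d i j k, assocForm b ![s d i, X j, X k] - assocForm b ![s d j, X i, X k]
      + assocForm b ![s d k, X i, X j] = 0) (ζ : V → ℝ)
    (hζ : ∀ u, ζ u =
      (coassoc b ![D u (b 3), b 4, b 5, b 6] - coassoc b ![D u (b 4), b 3, b 5, b 6]
        + coassoc b ![D u (b 5), b 3, b 4, b 6] - coassoc b ![D u (b 6), b 3, b 4, b 5])
      - (coassoc b ![D (b 3) u, b 4, b 5, b 6] - coassoc b ![D (b 3) (b 4), u, b 5, b 6]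
        + coassoc b ![D (b 3) (b 5), u, b 4, b 6] - coassoc b ![D (b 3) (b 6), u, b 4, b 5])
      + (coassoc b ![D (b 4) u, b 3, b 5, b 6] - coassoc b ![D (b 4) (b 3), u, b 5, b 6]
        + coassoc b ![D (b 4) (b 5), u, b 3, b 6] - coassoc b ![D (b 4) (b 6), u, b 3, b 5])
      - (coassoc b ![D (b 5) u, b 3, b 4, b 6] - coassoc b ![D (b 5) (b 3), u, b 4, b 6]
        + coassoc b ![D (b 5) (b 4), u, b 3, b 6] - coassoc b ![D (b 5) (b 6), u, b 3, b 4])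
      + (coassoc b ![D (b 6) u, b 3, b 4, b 5] - coassoc b ![D (b 6) (b 3), u, b 4, b 5]
        + coassoc b ![D (b 6) (b 4), u, b 3, b 5] - coassoc b ![D (b 6) (b 5), u, b 3, b 4]))
    (j : Fin 7) (hj : j = 0 ∨ j = 1 ∨ j = 2) :
    ∑ c, (b.repr (s c c) j + frameInner b (X c) (D (X c) (b j))
      - frameInner b (X c) (D (b j) (X c))) = -ζ (b j) := by
  -- Second derivatives of the immersion commute, so the asymmetry of `s` is that of `D` alone; this
  -- is used in components.
  have hs' : ∀ c d k, b.repr (s c d) k - b.repr (D (X c) (X d)) k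
      = b.repr (s d c) k - b.repr (D (X d) (X c)) k := fun c d k => by
    simpa using congrArg (fun v => b.repr v k) (hs c d)
  have h01 := hs' 0 1
  have h02 := hs' 0 2
  have h03 := hs' 0 3
  have h12 := hs' 1 2
  have h13 := hs' 1 3
  have h23 := hs' 2 3
  have c0 := fun d => hc d 0 1 2
  have c1 := fun d => hc d 0 1 3
  have c2 := fun d => hc d 0 2 3
  have c3 := fun d => hc d 1 2 3
  subst hX
  simp only [Matrix.cons_val, Matrix.cons_val_zero, Matrix.cons_val_one]
    at h01 h02 h03 h12 h13 h23 c0 c1 c2 c3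
  simp only [assocForm_table_2] at c0 c1 c2 c3
  simp only [Fin.sum_univ_four, Matrix.cons_val, Matrix.cons_val_zero, Matrix.cons_val_one,
    frameInner_basis_left]
  rcases hj with rfl | rfl | rfl
  all_goals
    rw [hζ]
    simp only [coassoc_table_1, coassoc_table_2, coassoc_table_3, coassoc_table_4]
  -- For each normal direction the identity is a linear combination of these commutation relations
  -- and of the differentiated coassociativity relations. Only the normal components `0`, `1`, `2`
  -- of `s` enter.
  · linarith [h01 0, h02 0, h03 0, h12 0, h13 0, h23 0, h01 1, h02 1, h03 1, h12 1, h13 1, h23 1,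
      h01 2, h02 2, h03 2, h12 2, h13 2, h23 2, c0 0, c0 1, c0 2, c0 3, c1 0, c1 1, c1 2, c1 3,
      c2 0, c2 1, c2 2, c2 3, c3 0, c3 1, c3 2, c3 3]
  · linarith [h01 0, h02 0, h03 0, h12 0, h13 0, h23 0, h01 1, h02 1, h03 1, h12 1, h13 1, h23 1,
      h01 2, h02 2, h03 2, h12 2, h13 2, h23 2, c0 0, c0 1, c0 2, c0 3, c1 0, c1 1, c1 2, c1 3,
      c2 0, c2 1, c2 2, c2 3, c3 0, c3 1, c3 2, c3 3]
  · linarith [h01 0, h02 0, h03 0, h12 0, h13 0, h23 0, h01 1, h02 1, h03 1, h12 1, h13 1, h23 1,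
      h01 2, h02 2, h03 2, h12 2, h13 2, h23 2, c0 0, c0 1, c0 2, c0 3, c1 0, c1 1, c1 2, c1 3,
      c2 0, c2 1, c2 2, c2 3, c3 0, c3 1, c3 2, c3 3]

/-- The derivative of the condition that a `3`-form, expressed in a coframe `L`, vanishes along an
immersion `F`. -/
theorem sum_secondDeriv_eq_zero {F : Euc 4 → Euc 7} {u₀ : Euc 4}
    (hF : ContDiffAt ℝ 2 F u₀) {L : Euc 7 → Euc 7 →L[ℝ] Euc 7}
    {T : Euc 7 →L[ℝ] Euc 7 →L[ℝ] Euc 7} (h1 : L (F u₀) = 1) (hT : HasFDerivAt L T (F u₀))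
    {a : Form (Euc 7) 3} (ha : ∀ᶠ u in 𝓝 u₀,
      (toCont a).compContinuousLinearMap ((L (F u)).comp (fderiv ℝ F u)) = 0) (d u v w : Euc 4) :
    a ![fderiv ℝ (fderiv ℝ F) u₀ d u + T (fderiv ℝ F u₀ d) (fderiv ℝ F u₀ u),
        fderiv ℝ F u₀ v, fderiv ℝ F u₀ w]
      - a ![fderiv ℝ (fderiv ℝ F) u₀ d v + T (fderiv ℝ F u₀ d) (fderiv ℝ F u₀ v),
        fderiv ℝ F u₀ u, fderiv ℝ F u₀ w]
      + a ![fderiv ℝ (fderiv ℝ F) u₀ d w + T (fderiv ℝ F u₀ d) (fderiv ℝ F u₀ w),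
        fderiv ℝ F u₀ u, fderiv ℝ F u₀ v] = 0 := by
  have hd : HasFDerivAt F (fderiv ℝ F u₀) u₀ := (hF.differentiableAt (by simp)).hasFDerivAt
  have hd2 : HasFDerivAt (fderiv ℝ F) (fderiv ℝ (fderiv ℝ F) u₀) u₀ :=
    ((hF.fderiv_right (m := 1) (by norm_num)).differentiableAt (by simp)).hasFDerivAt
  -- By the product rule for `L(F u) ∘ dF_u`, the derivative at `u₀` is `D²F + T(dF ·, dF ·)`: the
  -- second derivative of the immersion corrected by the derivative of the coframe.
  have hB := (hT.comp u₀ hd).clm_comp hd2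
  have h := (hasFDerivAt_const (toCont a) u₀
    (𝕜 := ℝ)).continuousAlternatingMapCompContinuousLinearMap hB
  have h0 := (h.congr_of_eventuallyEq (f₁ := fun _ => 0) (ha.mono fun u hu => hu.symm)).unique
    (hasFDerivAt_const _ u₀)
  have h2 := congrArg (fun A : Euc 4 →L[ℝ] Euc 4 [⋀^Fin 3]→L[ℝ] ℝ => A d ![u, v, w]) h0
  rw [ContinuousLinearMap.comp_zero, zero_add] at h2
  have h3 := (fderivComp_three (toCont a) _ _ u v w).symm.trans h2
  simp only [Function.comp_apply, h1] at h3
  change a ![fderiv ℝ (fderiv ℝ F) u₀ d u + T (fderiv ℝ F u₀ d) (fderiv ℝ F u₀ u),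
        fderiv ℝ F u₀ v, fderiv ℝ F u₀ w]
      + a ![fderiv ℝ F u₀ u, fderiv ℝ (fderiv ℝ F) u₀ d v + T (fderiv ℝ F u₀ d) (fderiv ℝ F u₀ v),
        fderiv ℝ F u₀ w]
      + a ![fderiv ℝ F u₀ u, fderiv ℝ F u₀ v,
        fderiv ℝ (fderiv ℝ F) u₀ d w + T (fderiv ℝ F u₀ d) (fderiv ℝ F u₀ w)] = 0 at h3
  rw [(form_apply_three_perm a (fderiv ℝ (fderiv ℝ F) u₀ d v
      + T (fderiv ℝ F u₀ d) (fderiv ℝ F u₀ v)) _ _).1, (form_apply_three_perm a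
    (fderiv ℝ (fderiv ℝ F) u₀ d w + T (fderiv ℝ F u₀ d) (fderiv ℝ F u₀ w)) _ _).2] at h3
  linarith

theorem bilinear_eq_sum {n : ℕ} {g : Euc n → Euc n → ℝ} (h1 : ∀ v, IsLinearMap ℝ fun u => g u v)
    (h2 : ∀ u, IsLinearMap ℝ (g u)) (u v : Euc n) :
    g u v = ∑ i, ∑ j, u i * (v j * g (EuclideanSpace.single i 1) (EuclideanSpace.single j 1)) := by
  rw [isLinearMap_eq_sum (h1 v)]
  refine Finset.sum_congr rfl fun i _ => ?_
  rw [isLinearMap_eq_sum (h2 _), Finset.mul_sum]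

variable {M : Type*} [TopologicalSpace M] [ChartedSpace (Euc 7) M] [IsManifold (𝓡 7) ∞ M]
  {S : Type*} [TopologicalSpace S] [ChartedSpace (Euc 4) S] [IsManifold (𝓡 4) ∞ S]

theorem repr_map_coframeEquiv {x : M} (e : Module.Basis (Fin 7) ℝ (TangentSpace (𝓡 7) x))
    (v : Euc 7) (j : Fin 7) :
    e.repr (coordVec x v) j = (e.map (coframeEquiv x)).repr v j := by
  rw [← coframeEquiv_symm_eq]
  rfl

/-- The mean curvature of a coassociative immersion in terms of `d∗φ`. -/
theorem G2Structure.meanCurvature_eq_extD (φ : G2Structure M) {f : S → M}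
    (hf : φ.IsCoassociativeImmersion f) (p : S)
    {e : Module.Basis (Fin 7) ℝ (TangentSpace (𝓡 7) (f p))} (he : φ.form (f p) = assocForm e)
    (hC : IsAdapted e (tangentPlane f p)) :
    φ.meanCurvature f p =
      -DFunLike.coe (F := Form _ 5) (extD φ.coassoc (f p)) ![e 0, e 3, e 4, e 5, e 6] • e 0
      + -DFunLike.coe (F := Form _ 5) (extD φ.coassoc (f p)) ![e 1, e 3, e 4, e 5, e 6] • e 1
      + -DFunLike.coe (F := Form _ 5) (extD φ.coassoc (f p)) ![e 2, e 3, e 4, e 5, e 6] • e 2 := by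
  obtain ⟨L, T, hLT⟩ := φ.exists_isCoframe (f p) he
  obtain ⟨A, hA⟩ := coframeEquiv_mfderiv hf.smooth p
  set F := writtenInExtChartAt (𝓡 4) (𝓡 7) p f with hF
  set u₀ := extChartAt (𝓡 4) p p with hu₀
  set b := e.map (coframeEquiv (f p)) with hb
  have hFu₀ : F u₀ = extChartAt (𝓡 7) (f p) (f p) := writtenInExtChartAt_apply_self p
  have hFs : ContDiffAt ℝ 2 F u₀ :=
    contDiffAt_infty.1 (contDiffAt_writtenInExtChartAt hf.smooth p) 2
  have hd2 : HasFDerivAt (fderiv ℝ F) (fderiv ℝ (fderiv ℝ F) u₀) u₀ :=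
    ((hFs.fderiv_right (m := 1) (by norm_num)).differentiableAt (by simp)).hasFDerivAt
  have hsymm : ∀ u v, fderiv ℝ (fderiv ℝ F) u₀ u v = fderiv ℝ (fderiv ℝ F) u₀ v u :=
    fun u v => hFs.isSymmSndFDerivAt (by simp) u v
  set Q := fderiv ℝ F u₀ with hQ
  set Q2 := fderiv ℝ (fderiv ℝ F) u₀ with hQ2
  -- tangent vectors that are mapped to the frame
  have hmem := hC.mem_of_le
  have hex : ∀ c : Fin 4, ∃ s : Euc 4, Q s = b (![3, 4, 5, 6] c) := by
    intro c
    have : e (![3, 4, 5, 6] c) ∈ tangentPlane f p := by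
      fin_cases c
      exacts [hmem.1, hmem.2.1, hmem.2.2.1, hmem.2.2.2]
    obtain ⟨v, hv⟩ := this
    refine ⟨A v, ?_⟩
    rw [← hA, hb, Module.Basis.map_apply]
    exact congrArg _ hv
  choose s hs using hex
  have hzero := sum_secondDeriv_eq_zero (L := L) (T := T) (a := assocForm b) hFs
    (by rw [hFu₀, hLT.eq_one])
    (by rw [hFu₀]; exact hLT.hasFDerivAt) (by
      filter_upwards [eventually_chartForm_eq_zero hf p,
        (hFu₀ ▸ hFs.continuousAt.tendsto).eventually hLT.form_eq] with u h1 h2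
      rw [← h1, h2]
      rfl)
  have hind : ∀ a c, φ.inducedMetric f p a c
      = frameInner b (Q (EuclideanSpace.single a 1)) (Q (EuclideanSpace.single c 1)) := by
    intro a c
    rw [inducedMetric, (φ.isG2 (f p)).metric_eq he, ← coframeEquiv_symm_eq]
    rfl
  -- The vectors `s c` map to the orthonormal tangent frame, so their coordinates bring the induced
  -- metric to the identity; the trace with `h⁻¹` becomes the plain sum over this frame.
  have hP : Matrix.of (fun c a => s c a) * φ.inducedMetric f p
      * (Matrix.of fun c a => s c a).transpose = 1 := by
    ext c d
    have := bilinear_eq_sum (g := fun u v => frameInner b (Q u) (Q v))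
      (fun v => ⟨fun x y => by simp [frameInner_add_left], fun r x => by
        simp [frameInner_smul_left]⟩) (fun v => ⟨fun x y => by simp [frameInner_add_right],
        fun r x => by simp [frameInner_smul_right]⟩) (s c) (s d)
    simp only [hs, frameInner_basis] at this
    simp only [Matrix.mul_apply, Matrix.transpose_apply, Matrix.of_apply, hind, Finset.sum_mul]
    rw [Finset.sum_comm, Matrix.one_apply]
    rw [show (if c = d then (1 : ℝ) else 0)
      = if ![(3 : Fin 7), 4, 5, 6] c = ![(3 : Fin 7), 4, 5, 6] d then 1 else 0 by
        fin_cases c <;> fin_cases d <;> rfl, this]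
    exact Finset.sum_congr rfl fun a _ => Finset.sum_congr rfl fun c _ => by ring
  -- The `j`-th frame component of the covariant Hessian, with the connection term written by the
  -- Koszul formula. Being bilinear, it can be evaluated on the `s c` instead of the coordinate
  -- vectors.
  let K : Fin 7 → Euc 4 → Euc 4 → ℝ := fun j u v => b.repr (Q2 u v) j
    + (1 / 2) * (metricDeriv b T (Q u) (Q v) (b j) + metricDeriv b T (Q v) (Q u) (b j)
      - metricDeriv b T (b j) (Q u) (Q v))
  have hcov : ∀ j a c, e.repr (φ.covHessian f p a c) j
      = K j (EuclideanSpace.single a 1) (EuclideanSpace.single c 1) := by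
    intro j a c
    rw [covHessian, repr_map_coframeEquiv, ← hb]
    have h1 : ∀ k, fderiv ℝ (fun u => partialRep f p u c) u₀ (EuclideanSpace.single a 1) k
        = Q2 (EuclideanSpace.single a 1) (EuclideanSpace.single c 1) k := by
      intro k
      have := hd2.clm_apply (hasFDerivAt_const (EuclideanSpace.single c (1 : ℝ)) u₀)
      exact congrArg (fun D : Euc 4 →L[ℝ] Euc 7 => D (EuclideanSpace.single a 1) k)
        (this.fderiv.trans (by simp; rfl))
    have h2 : (WithLp.toLp 2 fun k =>
        fderiv ℝ (fun u => partialRep f p u c) u₀ (EuclideanSpace.single a 1) k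
          + ∑ i, ∑ j, φ.christoffel (f p) (extChartAt (𝓡 7) (f p) (f p)) k i j
            * partialRep f p u₀ a i * partialRep f p u₀ c j : Euc 7) =
        Q2 (EuclideanSpace.single a 1) (EuclideanSpace.single c 1) + WithLp.toLp 2 fun k =>
          ∑ i, ∑ j, φ.christoffel (f p) (extChartAt (𝓡 7) (f p) (f p)) k i j
            * Q (EuclideanSpace.single a 1) i * Q (EuclideanSpace.single c 1) j := by
      ext k
      simp only [h1]
      rfl
    rw [h2, map_add, Finsupp.add_apply]
    refine congrArg (b.repr _ j + ·) ?_
    rw [← frameInner_basis_right]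
    exact hLT.frameInner_christoffel _ _ _
  have hK : ∀ j, ∑ a, ∑ c, (φ.inducedMetric f p)⁻¹ a c * e.repr (φ.covHessian f p a c) j
      = ∑ c, K j (s c) (s c) := by
    intro j
    rw [sum_inv_mul_eq_sum _ _ hP]
    refine Finset.sum_congr rfl fun c _ => ?_
    rw [bilinear_eq_sum (g := K j) _ _ (s c) (s c)]
    · simp only [hcov, Matrix.of_apply]
    · intro v
      constructor <;> intros <;>
      simp only [K, metricDeriv, map_add, map_smul, frameInner_add_left, frameInner_add_right,
        frameInner_smul_left, frameInner_smul_right, Finsupp.add_apply, Finsupp.smul_apply,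
        _root_.add_apply, _root_.smul_apply, smul_eq_mul] <;> ring
    · intro v
      constructor <;> intros <;>
      simp only [K, metricDeriv, map_add, map_smul, frameInner_add_left, frameInner_add_right,
        frameInner_smul_left, frameInner_smul_right, Finsupp.add_apply, Finsupp.smul_apply,
        _root_.add_apply, _root_.smul_apply, smul_eq_mul] <;> ring
  have hfin : ∀ j : Fin 7, j = 0 ∨ j = 1 ∨ j = 2 → ∑ c, K j (s c) (s c)
      = -DFunLike.coe (F := Form _ 5) (extD φ.coassoc (f p)) ![e j, e 3, e 4, e 5, e 6] := by
    intro j hj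
    -- The argument `s` is the corrected second derivative. Its asymmetry comes from `T` alone
    -- because `Q2` is symmetric, and the coassociativity relations are `hzero` in the tangent
    -- frame.
    have key := sum_secondFundamentalForm_eq b (fun u v => T u v)
      (fun c d => Q2 (s c) (s d) + T (Q (s c)) (Q (s d))) ![b 3, b 4, b 5, b 6] rfl ?_ ?_
      (fun u => extDeriv (chartForm φ.coassoc (f p)) (extChartAt (𝓡 7) (f p) (f p))
        ![u, b 3, b 4, b 5, b 6])
      (fun u => extDeriv_pullback_four hLT.eq_one hLT.hasFDerivAt hLT.coassoc_eq _ _ _ _ _) j hj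
    · have h1 : DFunLike.coe (F := Form _ 5) (extD φ.coassoc (f p)) ![e j, e 3, e 4, e 5, e 6]
        = extDeriv (chartForm φ.coassoc (f p)) (extChartAt (𝓡 7) (f p) (f p))
          ![b j, b 3, b 4, b 5, b 6] := by
        rw [extD, ← coframeEquiv_eq]
        refine congrArg (extDeriv (chartForm φ.coassoc (f p)) _) (funext fun i => ?_)
        fin_cases i <;> rfl
      rw [h1, ← key]
      refine Finset.sum_congr rfl fun c _ => ?_
      have hX : ![b 3, b 4, b 5, b 6] c = Q (s c) := by
        rw [hs]
        fin_cases c <;> rfl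
      rw [hX]
      simp only [K, metricDeriv, map_add, Finsupp.add_apply, frameInner_basis_right]
      rw [frameInner_comm b (T (b j) (Q (s c)))]
      ring
    · intro c d
      have hX : ∀ c, ![b 3, b 4, b 5, b 6] c = Q (s c) := fun c => by
        rw [hs]
        fin_cases c <;> rfl
      simp only [hX, hsymm (s c) (s d), add_sub_cancel_right]
    · intro d i j k
      have hX : ∀ c, ![b 3, b 4, b 5, b 6] c = Q (s c) := fun c => by
        rw [hs]
        fin_cases c <;> rfl
      simp only [hX]
      exact hzero (s d) (s i) (s j) (s k)
  have h0 := (hK 0).trans (hfin 0 (by simp))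
  have h1 := (hK 1).trans (hfin 1 (by simp))
  have h2 := (hK 2).trans (hfin 2 (by simp))
  rw [← h0, ← h1, ← h2, meanCurvature]
  simp only [(φ.isG2 (f p)).perpProj_eq he hC, smul_add, smul_smul, Finset.sum_add_distrib,
    Finset.sum_smul]

end MeanCurvature

section TorsionClasses

/-! ### The mean curvature formula, and torsion classes -/

variable {M : Type*} [TopologicalSpace M] [ChartedSpace (Euc 7) M] [IsManifold (𝓡 7) ∞ M]
  {S : Type*} [TopologicalSpace S] [ChartedSpace (Euc 4) S] [IsManifold (𝓡 4) ∞ S]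

/-- On `e₀` and the tangent frame, `τ₂ ∧ φ` is `τ₂(e₃, e₄) + τ₂(e₅, e₆)`, which is `-τ₂(e₁, e₂)` by
the `Λ²₁₄` equations; the other two cases are similar. Only the part of `τ₂` in `Λ²(A)` thus
remains. -/
theorem IsTorsionAt.apply_normal {V : Type*} [AddCommGroup V] [Module ℝ V]
    {e : Module.Basis (Fin 7) ℝ V} {ξ : Form V 4} {ζ : Form V 5} {t : TorsionForms V}
    (h : IsTorsionAt e ξ ζ t) :
    ζ ![e 0, e 3, e 4, e 5, e 6] = 4 * t.τ₁ ![e 0] - t.τ₂ ![e 1, e 2] ∧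
    ζ ![e 1, e 3, e 4, e 5, e 6] = 4 * t.τ₁ ![e 1] + t.τ₂ ![e 0, e 2] ∧
    ζ ![e 2, e 3, e 4, e 5, e 6] = 4 * t.τ₁ ![e 2] - t.τ₂ ![e 0, e 1] := by
  have hl := (mem_lam14_iff e _).1 h.mem_two
  rw [h.d_coassoc]
  refine ⟨?_, ?_, ?_⟩ <;>
  · simp [wedge14_apply e, wedge23_apply e]
    linarith

/-- The mean curvature of a coassociative immersion in terms of the torsion forms. -/
theorem G2Structure.meanCurvature_eq (φ : G2Structure M) {f : S → M}
    (hf : φ.IsCoassociativeImmersion f) {τ : ∀ x : M, TorsionForms (TangentSpace (𝓡 7) x)}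
    (hτ : φ.IsTorsion τ) (p : S) :
    φ.meanCurvature f p =
      (-4 : ℝ) • (φ.isG2 (f p)).sharp ((φ.isG2 (f p)).oneA (tangentPlane f p) (τ (f p)).τ₁)
        + (√6 / 3) • (φ.isG2 (f p)).natural (tangentPlane f p)
          ((φ.isG2 (f p)).twoA (tangentPlane f p) (τ (f p)).τ₂) := by
  obtain ⟨e, he, hC⟩ := exists_adapted_frame (φ.isG2 (f p)) (hf.coassociative p)
  obtain ⟨h0, h1, h2⟩ := (hτ.isTorsionAt he).apply_normal
  rw [φ.meanCurvature_eq_extD hf p he hC,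
    (φ.isG2 (f p)).sharp_add_natural he hC _ (hτ.mem_two (f p)), h0, h1, h2]
  congr 3 <;> ring

theorem G2Structure.hasTorsionClass_mono {M : Type*} [TopologicalSpace M]
    [ChartedSpace (Euc 7) M] {φ : G2Structure M} {A B : Set TorsionModule} (hAB : A ⊆ B)
    (h : φ.HasTorsionClass A) : φ.HasTorsionClass B := by
  obtain ⟨τ, hτ, h⟩ := h
  exact ⟨τ, hτ, fun x => ⟨fun hB => (h x).1 fun hA => hB (hAB hA),
    fun hB => (h x).2.1 fun hA => hB (hAB hA), fun hB => (h x).2.2.1 fun hA => hB (hAB hA),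
    fun hB => (h x).2.2.2 fun hA => hB (hAB hA)⟩⟩

section

variable {V : Type*} [AddCommGroup V] [Module ℝ V] {e : Module.Basis (Fin 7) ℝ V} {ξ : Form V 4}
  {ζ : Form V 5} {t : TorsionForms V}

/-- If `ζ = 0`, contraction kills `τ₁`; then `τ₂ ∧ φ = 0`, and its star is `-τ₂`. -/
theorem IsTorsionAt.d_coassoc_eq_zero_iff (h : IsTorsionAt e ξ ζ t) :
    ζ = 0 ↔ t.τ₁ = 0 ∧ t.τ₂ = 0 := by
  constructor
  · rintro rfl
    have h1 : t.τ₁ = 0 := by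
      refine one_form_ext e fun i => ?_
      have := h.tau_one_apply i
      have h0 : contrCoassoc e 0 i = 0 := by
        fin_cases i <;> simp [contrCoassoc]
      rw [h0] at this
      change t.τ₁ ![e i] = 0
      linarith
    refine ⟨h1, ?_⟩
    have h2 := h.d_coassoc
    have h3 : (4 : ℝ) • wedge14 t.τ₁ (coassoc e) = 0 := by
      refine form_ext_five e ?_
      simp [wedge14_apply e, h1]
    rw [h3, zero_add, wedge_assocForm_comm] at h2
    have h4 := h.mem_two
    rw [← h2] at h4
    have h5 : hodgeOfBasis e 5 2 rfl 0 = 0 := by simp [hodgeOfBasis]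
    exact neg_eq_zero.1 (h4.symm.trans h5)
  · rintro ⟨h1, h2⟩
    rw [h.d_coassoc, h1, h2]
    refine form_ext_five e ?_
    simp [wedge14_apply e, wedge23_apply e]

/-- Contraction with `∗φ` removes `τ₀`; then `∗τ₃ = 0`, and the star is involutive. Used for closed
`G₂`-structures. -/
theorem IsTorsionAt.eq_zero_of_d_form_eq_zero (h : IsTorsionAt e 0 ζ t) (h1 : t.τ₁ = 0) :
    t.τ₀ = 0 ∧ t.τ₃ = 0 := by
  have h0 : t.τ₀ = 0 := by
    have := h.tau_zero_eq
    simp [innerCoassoc] at this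
    linarith
  refine ⟨h0, ?_⟩
  have h2 := h.d_form
  have h3 : (3 : ℝ) • wedge13 t.τ₁ (assocForm e) = 0 := by
    refine form_ext_four e ?_
    simp [wedge13_apply e, h1]
  rw [h0, zero_smul, h3, zero_add, zero_add] at h2
  rw [← hodge_hodge_three e t.τ₃, ← h2]
  simp [hodgeOfBasis]

end

/-- The class `W₁ ⊕ W₂₇` is the class of `G₂`-structures with `d∗φ = 0`. -/
theorem G2Structure.hasTorsionClass_iff (φ : G2Structure M) :
    φ.HasTorsionClass {.W1, .W27} ↔ ∀ x, extD φ.coassoc x = 0 := by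
  constructor
  · rintro ⟨τ, hτ, h⟩ x
    refine (hτ.isTorsionAt (φ.isG2 x).assocForm_frame.symm).d_coassoc_eq_zero_iff.2 ⟨?_, ?_⟩
    · exact (h x).2.1 (by simp)
    · exact (h x).2.2.1 (by simp)
  · intro h
    obtain ⟨τ, hτ, -⟩ := φ.existsUnique_isTorsion
    refine ⟨τ, hτ, fun x => ?_⟩
    obtain ⟨h1, h2⟩ :=
      (hτ.isTorsionAt (φ.isG2 x).assocForm_frame.symm).d_coassoc_eq_zero_iff.1 (h x)
    simp [h1, h2]

/-- Immediate from the formula for `H` through `d∗φ`: with `∗φ` closed, coassociative `4`-folds are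
calibrated. -/
theorem G2Structure.coassociativesMinimal_of_extD_eq_zero (φ : G2Structure M)
    (h : ∀ x, extD φ.coassoc x = 0) : φ.CoassociativesMinimal := by
  intro S _ _ _ _ _ f hf p
  obtain ⟨e, he, hC⟩ := exists_adapted_frame (φ.isG2 (f p)) (hf.coassociative p)
  rw [φ.meanCurvature_eq_extD hf p he hC, h (f p)]
  change -(0 : ℝ) • e 0 + -(0 : ℝ) • e 1 + -(0 : ℝ) • e 2 = 0
  simp

end TorsionClasses

section Diagonal

open Topology

/-! ### Diagonal `G₂`-structures on `ℝ⁷` -/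

theorem extChartAt_euc (x : Euc 7) : extChartAt (𝓡 7) x = PartialEquiv.refl (Euc 7) :=
  extChartAt_model_space_eq_id ℝ x

theorem chartFrame_euc (x y v : Euc 7) : (show Euc 7 from chartFrame x y v) = v := by
  have h : mfderiv 𝓘(ℝ, Euc 7) (𝓡 7) (extChartAt (𝓡 7) x).symm y
    = mfderiv 𝓘(ℝ, Euc 7) (𝓡 7) id y := by
    congr 1
  change (show Euc 7 from mfderiv 𝓘(ℝ, Euc 7) (𝓡 7) (extChartAt (𝓡 7) x).symm y v) = v
  rw [h, mfderiv_id]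
  rfl

theorem coframeEquiv_euc (x v : Euc 7) : coframeEquiv x v = v := by
  have h : mfderiv (𝓡 7) 𝓘(ℝ, Euc 7) (extChartAt (𝓡 7) x) x = mfderiv (𝓡 7) 𝓘(ℝ, Euc 7) id x := by
    congr 1
  change (coframeEquiv x).toLinearMap v = v
  rw [coframeEquiv_eq]
  change (show Euc 7 from mfderiv (𝓡 7) 𝓘(ℝ, Euc 7) (extChartAt (𝓡 7) x) x v) = v
  rw [h, mfderiv_id]
  rfl

theorem coframeEquiv_symm_euc (x v : Euc 7) : (coframeEquiv x).symm v = v :=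
  (LinearEquiv.symm_apply_eq _).2 (coframeEquiv_euc x v).symm

/-- The frame `exp(-wᵢ y₀) ∂ᵢ` on `ℝ⁷`. -/
def diagFrame (w : Fin 7 → ℝ) (y : Euc 7) : Module.Basis (Fin 7) ℝ (Euc 7) :=
  (EuclideanSpace.basisFun (Fin 7) ℝ).toBasis.isUnitSMul (w := fun i => Real.exp (-w i * y 0))
    fun _ => (Real.exp_pos _).ne'.isUnit

theorem diagFrame_repr (w : Fin 7 → ℝ) (y v : Euc 7) (i : Fin 7) :
    (diagFrame w y).repr v i = Real.exp (w i * y 0) * v i := by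
  rw [diagFrame, Module.Basis.repr_isUnitSMul, Units.smul_def, Units.val_inv_eq_inv_val,
    IsUnit.unit_spec, neg_mul, Real.exp_neg, inv_inv]
  rfl

theorem diagFrame_apply (w : Fin 7 → ℝ) (y : Euc 7) (i : Fin 7) :
    diagFrame w y i = Real.exp (-w i * y 0) • EuclideanSpace.single i (1 : ℝ) := by
  simp [diagFrame, Module.Basis.isUnitSMul_apply]

/-- The dual coframe is `exp(wᵢ y₀) dyᵢ`, so weights add in products. Smoothness of the structure
reduces to that of an exponential times a constant form. -/
theorem coordForm_diagFrame (w : Fin 7 → ℝ) (y : Euc 7) (I : Fin 3 → Fin 7) :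
    coordForm (diagFrame w y) I = Real.exp ((w (I 0) + w (I 1) + w (I 2)) * y 0) •
      coordForm (EuclideanSpace.basisFun (Fin 7) ℝ).toBasis I := by
  ext v
  have : v = ![v 0, v 1, v 2] := by
    funext i; fin_cases i <;> rfl
  rw [this]
  simp only [coordForm_apply_three, AlternatingMap.smul_apply, add_mul, Real.exp_add]
  have h0 : ∀ u : Euc 7, ∀ i, (EuclideanSpace.basisFun (Fin 7) ℝ).toBasis.coord i u = u i :=
    fun u i => rfl
  have h : ∀ u i, (diagFrame w y).coord i u = Real.exp (w i * y 0) * u i :=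
    fun u i => diagFrame_repr w y u i
  simp only [h0, smul_eq_mul, h]
  ring

theorem toCont_add {k : ℕ} (a b : Form (Euc 7) k) : toCont (a + b) = toCont a + toCont b := rfl

theorem toCont_sub {k : ℕ} (a b : Form (Euc 7) k) : toCont (a - b) = toCont a - toCont b := rfl

theorem toCont_smul {k : ℕ} (c : ℝ) (a : Form (Euc 7) k) : toCont (c • a) = c • toCont a := rfl

theorem chartForm_euc {k : ℕ} (a : Euc 7 → Form (Euc 7) k) (x y : Euc 7) :
    chartForm (M := Euc 7) a x y = toCont (a y) := by
  ext v
  have h : (extChartAt (𝓡 7) x).symm y = y := by rw [extChartAt_euc]; rfl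
  refine (congrArg (fun v' : Fin k → Euc 7 => a ((extChartAt (𝓡 7) x).symm y) v')
    (funext fun i => chartFrame_euc x y (v i))).trans ?_
  rw [h]
  rfl

/-- The `G₂`-structure on `ℝ⁷` for which the frame `exp(-wᵢ y₀) ∂ᵢ` is adapted. -/
def diagStructure (w : Fin 7 → ℝ) : G2Structure (Euc 7) where
  form := fun y => assocForm (V := Euc 7) (diagFrame w y)
  smooth := by
    intro x
    have h : ∀ I : Fin 3 → Fin 7, ContDiff ℝ ∞ fun y : Euc 7 =>
        toCont (coordForm (diagFrame w y) I) := by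
      intro I
      simp only [coordForm_diagFrame, toCont_smul]
      have h1 : ContDiff ℝ ∞ fun y : Euc 7 => Real.exp ((w (I 0) + w (I 1) + w (I 2)) * y 0) := by
        fun_prop
      exact h1.smul contDiff_const
    have : chartForm (M := Euc 7) (fun y => assocForm (V := Euc 7) (diagFrame w y)) x
      = fun y => toCont (assocForm (diagFrame w y)) := funext fun y => chartForm_euc _ x y
    rw [this]
    simp only [assocForm, toCont_add, toCont_sub]
    exact (((((((h ![0, 1, 2]).add (h _)).add (h _)).add (h _)).sub (h _)).sub (h _)).sub
      (h _)).contDiffOn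
  isG2 := fun y => ⟨diagFrame w y, rfl⟩

/-- The frame `diagFrame w`, as a frame of the tangent space. -/
def tangentFrame (w : Fin 7 → ℝ) (x : Euc 7) : Module.Basis (Fin 7) ℝ (TangentSpace (𝓡 7) x) :=
  diagFrame w x

theorem diagStructure_form (w : Fin 7 → ℝ) (x : Euc 7) :
    (diagStructure w).form x = assocForm (tangentFrame w x) := rfl

theorem tangentFrame_repr_eq_zero_iff (w : Fin 7 → ℝ) (x : Euc 7) (v : TangentSpace (𝓡 7) x)
    (i : Fin 7) : (tangentFrame w x).repr v i = 0 ↔ (show Euc 7 from v) i = 0 := by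
  rw [show (tangentFrame w x).repr v i = _ from diagFrame_repr w x v i]
  exact mul_eq_zero_iff_left (Real.exp_ne_zero _)

/-- Multiplication of the coordinates by `w`. -/
def diagMap (w : Fin 7 → ℝ) : Euc 7 →L[ℝ] Euc 7 :=
  LinearMap.toContinuousLinearMap
    { toFun := fun v => WithLp.toLp 2 fun i => w i * v i
      map_add' := fun x y => by ext i; simp [mul_add]
      map_smul' := fun c x => by ext i; simp [mul_left_comm] }

theorem diagMap_apply (w : Fin 7 → ℝ) (v : Euc 7) (i : Fin 7) : diagMap w v i = w i * v i := rfl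

/-- Writes a diagonal map as scalar coefficients times constant projections, so that a family of
diagonal maps can be differentiated coefficient by coefficient. -/
theorem diagMap_eq_sum (w : Fin 7 → ℝ) : diagMap w = ∑ j, w j • diagMap (Pi.single j 1) := by
  ext v i
  simp [diagMap_apply, _root_.sum_apply, Finset.sum_apply, Pi.single_apply]

/-- The derivative of the coframe of `diagStructure w`. -/
def diagDeriv (w : Fin 7 → ℝ) : Euc 7 →L[ℝ] Euc 7 →L[ℝ] Euc 7 :=
  (EuclideanSpace.proj (0 : Fin 7) : Euc 7 →L[ℝ] ℝ).smulRight (diagMap w)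

/-- The coframe is explicit here: dividing `exp(wᵢ y₀)` by its value at `x` leaves a diagonal family
equal to `1` at `x`, with derivative `dy₀ ⊗ diag(w)`. -/
theorem isCoframe_diagStructure (w : Fin 7 → ℝ) (x : Euc 7) :
    IsCoframe (diagStructure w) x ((tangentFrame w x).map (coframeEquiv x))
      (fun y => diagMap fun i => Real.exp (w i * (y 0 - x 0))) (diagDeriv w) := by
  have hx : extChartAt (𝓡 7) x x = x := rfl
  refine .of_form_eq ?_ ?_ ?_
  · rw [hx]
    ext v i
    simp [diagMap_apply]
  · rw [hx]
    have h : ∀ j, HasFDerivAt (fun y : Euc 7 => Real.exp (w j * (y 0 - x 0)) •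
        diagMap (Pi.single j 1))
        ((w j • (EuclideanSpace.proj (0 : Fin 7) : Euc 7 →L[ℝ] ℝ)).smulRight
          (diagMap (Pi.single j 1))) x := by
      intro j
      have h1 : HasFDerivAt (fun y : Euc 7 => w j * (y 0 - x 0))
          (w j • (EuclideanSpace.proj (0 : Fin 7) : Euc 7 →L[ℝ] ℝ)) x :=
        ((EuclideanSpace.proj (0 : Fin 7) : Euc 7 →L[ℝ] ℝ).hasFDerivAt.sub_const
          (x 0)).const_mul _
      have h2 := h1.exp.smul_const (diagMap (Pi.single j 1))
      simpa using h2
    have h3 := HasFDerivAt.fun_sum (u := Finset.univ) fun j _ => h j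
    have h4 : (∑ j, (w j • (EuclideanSpace.proj (0 : Fin 7) : Euc 7 →L[ℝ] ℝ)).smulRight
          (diagMap (Pi.single j 1))) = diagDeriv w := by
      ext u v i
      rw [diagDeriv, diagMap_eq_sum w]
      simp [_root_.sum_apply, Finset.sum_apply, Finset.mul_sum, mul_assoc, mul_left_comm]
    rw [h4] at h3
    refine h3.congr_of_eventuallyEq (.of_forall fun y => ?_)
    exact diagMap_eq_sum _
  · refine .of_forall fun y => ?_
    rw [show chartForm (diagStructure w).form x y = _ from chartForm_euc _ x y]
    ext v
    have hv : ∀ i (u : Euc 7), (diagFrame w y).coord i u =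
        ((tangentFrame w x).map (coframeEquiv x)).coord i
          (diagMap (fun i => Real.exp (w i * (y 0 - x 0))) u) := by
      intro i u
      have h1 : (coframeEquiv x).symm (diagMap (fun i => Real.exp (w i * (y 0 - x 0))) u)
          = diagMap (fun i => Real.exp (w i * (y 0 - x 0))) u := coframeEquiv_symm_euc x _
      change (diagFrame w y).repr u i = (diagFrame w x).repr ((coframeEquiv x).symm _) i
      rw [h1, diagFrame_repr, diagFrame_repr, diagMap_apply, ← mul_assoc, ← Real.exp_add]
      congr 2
      ring
    have hI : ∀ I : Fin 3 → Fin 7, coordForm (diagFrame w y) I v =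
        coordForm ((tangentFrame w x).map (coframeEquiv x)) I
          (fun a => diagMap (fun i => Real.exp (w i * (y 0 - x 0))) (v a)) := by
      intro I
      have h1 : ∀ g : Euc 7 → Euc 7, (fun a => g (v a)) = ![g (v 0), g (v 1), g (v 2)] := by
        intro g; funext i; fin_cases i <;> rfl
      rw [h1, show v = ![v 0, v 1, v 2] from h1 id]
      simp only [coordForm_apply_three, ← hv]
      rfl
    change assocForm (diagFrame w y) v = assocForm ((tangentFrame w x).map (coframeEquiv x))
      (fun a => diagMap (fun i => Real.exp (w i * (y 0 - x 0))) (v a))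
    simp only [assocForm, AlternatingMap.add_apply, AlternatingMap.sub_apply, hI]

/-- The coframe varies only in the direction of `y₀`, where it scales the `j`-th axis at rate `wⱼ`.
The exponential is the length of `e₀` in coordinates. -/
theorem repr_coframeDeriv_diagDeriv (w : Fin 7 → ℝ) (x : Euc 7) (i j k : Fin 7) :
    (tangentFrame w x).repr
      (coframeDeriv x (diagDeriv w) (tangentFrame w x i) (tangentFrame w x j)) k
      = if i = 0 ∧ k = j then Real.exp (-w 0 * x 0) * w j else 0 := by
  have h : coframeDeriv x (diagDeriv w) (tangentFrame w x i) (tangentFrame w x j)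
      = diagDeriv w (diagFrame w x i) (diagFrame w x j) :=
    (coframeEquiv_symm_euc x _).trans (congrArg₂ (fun u v => diagDeriv w u v)
      (coframeEquiv_euc x _) (coframeEquiv_euc x _))
  rw [h]
  refine (diagFrame_repr w x _ k).trans ?_
  rw [diagFrame_apply, diagFrame_apply]
  simp only [diagDeriv, ContinuousLinearMap.smulRight_apply, _root_.smul_apply, PiLp.smul_apply,
    diagMap_apply, PiLp.proj_apply, PiLp.single_apply, smul_eq_mul]
  by_cases hi : i = 0 <;> by_cases hk : k = j
  · subst hi hk
    simp only [true_and, if_true]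
    have : Real.exp (w k * x 0) * Real.exp (-w k * x 0) = 1 := by
      rw [← Real.exp_add]; simp
    linear_combination Real.exp (-w 0 * x 0) * w k * this
  · simp [hk]
  · simp [hi, Ne.symm hi]
  · simp [hi, hk]

end Diagonal

section Sharpness

/-! ### Non-minimal coassociative planes -/

/-- The inclusion of the last four coordinates. -/
def lastFour : Euc 4 →L[ℝ] Euc 7 :=
  LinearMap.toContinuousLinearMap
    { toFun := fun v => WithLp.toLp 2 ![0, 0, 0, v 0, v 1, v 2, v 3]
      map_add' := fun x y => by ext i; fin_cases i <;> simp
      map_smul' := fun c x => by ext i; fin_cases i <;> simp }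

theorem lastFour_injective : Function.Injective lastFour := by
  intro u v h
  have h' : ∀ i, lastFour u i = lastFour v i := fun i => by rw [h]
  ext i
  fin_cases i
  exacts [h' 3, h' 4, h' 5, h' 6]

theorem isAdapted_tangentPlane_lastFour (w : Fin 7 → ℝ) (p : Euc 4) :
    IsAdapted (tangentFrame w (lastFour p))
      (G2Structure.tangentPlane (M := Euc 7) lastFour p) := by
  intro x
  have h := tangentFrame_repr_eq_zero_iff w (lastFour p) x
  refine Iff.trans ?_ (and_congr (h 0) (and_congr (h 1) (h 2))).symm
  have hm : ∀ v : Euc 4, mfderiv (𝓡 4) (𝓡 7) lastFour p v = lastFour v := fun v => by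
    rw [mfderiv_eq_fderiv, lastFour.fderiv]
    rfl
  constructor
  · rintro ⟨v, rfl⟩
    change (show Euc 7 from mfderiv (𝓡 4) (𝓡 7) lastFour p v) 0 = 0 ∧
      (show Euc 7 from mfderiv (𝓡 4) (𝓡 7) lastFour p v) 1 = 0 ∧
      (show Euc 7 from mfderiv (𝓡 4) (𝓡 7) lastFour p v) 2 = 0
    rw [hm v]
    exact ⟨rfl, rfl, rfl⟩
  · rintro ⟨h0, h1, h2⟩
    let z : Euc 7 := x
    refine ⟨(WithLp.toLp 2 ![z 3, z 4, z 5, z 6] : Euc 4), (hm _).trans ?_⟩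
    refine PiLp.ext (fun i => ?_)
    fin_cases i
    exacts [h0.symm, h1.symm, h2.symm, rfl, rfl, rfl, rfl]

/-- Every term of `φ` contains at least one of the covectors `e⁰`, `e¹`, `e²`, which vanish on the
last four coordinates whatever the weights are. -/
theorem isCoassociativeImmersion_lastFour (w : Fin 7 → ℝ) :
    (diagStructure w).IsCoassociativeImmersion (S := Euc 4) lastFour where
  smooth := lastFour.contMDiff
  injective := fun p => by
    rw [mfderiv_eq_fderiv, lastFour.fderiv]
    exact lastFour_injective
  coassociative := fun p => by
    have h := isAdapted_tangentPlane_lastFour w p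
    refine ⟨?_, fun u hu v hv z hz => ?_⟩
    · rw [G2Structure.tangentPlane, mfderiv_eq_fderiv, lastFour.fderiv]
      refine (LinearMap.finrank_range_of_inj lastFour_injective).trans ?_
      exact finrank_euclideanSpace_fin
    · obtain ⟨hu0, hu1, hu2⟩ := (h u).1 hu
      obtain ⟨hv0, hv1, hv2⟩ := (h v).1 hv
      obtain ⟨hz0, hz1, hz2⟩ := (h z).1 hz
      refine (assocForm_apply (tangentFrame w (lastFour p)) u v z).trans ?_
      rw [hu0, hu1, hu2, hv0, hv1, hv2, hz0, hz1, hz2]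
      ring

/-- In `d∗φ` only the derivative of the coefficient of `e³⁴⁵⁶` along `e₀` contributes on these
vectors, at the total rate `w₃ + w₄ + w₅ + w₆`. -/
theorem extD_coassoc_diagStructure (w : Fin 7 → ℝ) (x : Euc 7) :
    DFunLike.coe (F := Form (TangentSpace (𝓡 7) x) 5) (extD (diagStructure w).coassoc x)
      ![tangentFrame w x 0, tangentFrame w x 3, tangentFrame w x 4, tangentFrame w x 5,
        tangentFrame w x 6]
      = Real.exp (-w 0 * x 0) * (w 3 + w 4 + w 5 + w 6) := by
  refine ((isCoframe_diagStructure w x).extD_coassoc_apply _ _ _ _ _).trans ?_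
  have h := repr_coframeDeriv_diagDeriv w x
  simp only [coassoc_table_1, coassoc_table_2, coassoc_table_4]
  simp only [h]
  simp
  ring

theorem eq_zero_of_neg_smul_basis {V : Type*} [AddCommGroup V] [Module ℝ V]
    (e : Module.Basis (Fin 7) ℝ V) {a b c : ℝ} (h : -a • e 0 + -b • e 1 + -c • e 2 = 0) :
    a = 0 := by
  simpa using congrArg (fun v => e.repr v 0) h

/-- Already at the origin the `e₀`-component of the mean curvature of the plane of the last four
coordinates is nonzero. -/
theorem not_coassociativesMinimal_diagStructure {w : Fin 7 → ℝ} (hw : w 3 + w 4 + w 5 + w 6 ≠ 0) :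
    ¬ (diagStructure w).CoassociativesMinimal := by
  intro h
  have h0 := h (Euc 4) lastFour (isCoassociativeImmersion_lastFour w) 0
  rw [(diagStructure w).meanCurvature_eq_extD (isCoassociativeImmersion_lastFour w) 0
    (diagStructure_form w _) (isAdapted_tangentPlane_lastFour w 0)] at h0
  have h1 := eq_zero_of_neg_smul_basis (tangentFrame w (lastFour 0)) h0
  have h3 := (extD_coassoc_diagStructure w (lastFour 0)).symm.trans h1
  exact mul_ne_zero (Real.exp_pos _).ne' hw h3

/-- Equal weights give the conformally flat form `exp(3 x₀) φ₀`, for which `dφ = 3 dx₀ ∧ φ` and `d∗φ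
= 4 dx₀ ∧ ∗φ`. -/
theorem hasTorsionClass_diagStructure_one : (diagStructure fun _ => 1).HasTorsionClass {.W7} := by
  -- This is `τ₁ = dx₀`, whose value on `e₀ = exp(-x₀) ∂₀` is `exp(-x₀)`.
  refine ⟨fun x => ⟨0, oneForm (tangentFrame (fun _ => 1) x)
    ![Real.exp (-x 0), 0, 0, 0, 0, 0, 0], 0, 0⟩,
    ((diagStructure fun _ => 1).isTorsion_iff _ (fun x => diagStructure_form _ x) _).2
      fun x => ?_, fun x => by simp⟩
  have hx := isCoframe_diagStructure (fun _ => 1) x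
  have h := repr_coframeDeriv_diagDeriv (fun _ => 1) x
  set e := tangentFrame (fun _ => 1) x with he
  have h4 := hx.extD_form_apply
  have h5 := hx.extD_coassoc_apply
  have ho := oneForm_apply e ![Real.exp (-x 0), 0, 0, 0, 0, 0, 0]
  refine ⟨?_, ?_, ?_, ?_⟩
  · refine form_ext_four e ?_
    simp only [h4, assocForm_table_0, assocForm_table_1, assocForm_table_2]
    simp [h, ho, wedge13_apply e, hodgeOfBasis]
    and_intros <;> ring
  · refine form_ext_five e ?_
    simp only [h5, coassoc_table_0, coassoc_table_1, coassoc_table_2, coassoc_table_3,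
      coassoc_table_4]
    simp [h, ho, wedge14_apply e, wedge23_apply e]
    ring
  · refine form_ext_two e ?_
    simp [wedge32_apply e]
  · constructor
    · refine form_ext_six e ?_
      simp [wedge33_apply e]
    · refine form_ext_seven e ?_
      simp [wedge34_apply e]

/-- The weights make `φ` closed: a term of `φ` that contains `e⁰` is closed in any case, and each of
the others pairs one index of weight `-2` with two of weight `1`. A closed `φ` has only `τ₂`; here
`τ₁` vanishes because `dφ` and `d∗φ` determine the same `1`-form. -/
theorem hasTorsionClass_diagStructure_closed :
    (diagStructure ![0, -2, -2, 1, 1, 1, 1]).HasTorsionClass {.W14} := by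
  set w : Fin 7 → ℝ := ![0, -2, -2, 1, 1, 1, 1] with hw
  obtain ⟨τ, hτ, -⟩ := (diagStructure w).existsUnique_isTorsion
  refine ⟨τ, hτ, fun x => ?_⟩
  have hx := isCoframe_diagStructure w x
  have h := repr_coframeDeriv_diagDeriv w x
  have ht := hτ.isTorsionAt (diagStructure_form w x)
  set e := tangentFrame w x with he
  have h4 := hx.extD_form_apply
  have hd : extD (diagStructure w).form x = 0 := by
    refine form_ext_four e ?_
    simp only [h4, assocForm_table_0, assocForm_table_1, assocForm_table_2]
    simp only [h]
    simp [hw]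
    norm_num
  have h1 : (τ x).τ₁ = 0 := by
    refine one_form_ext e fun i => ?_
    have h6 := (hx.contr_extD_eq i).trans (ht.tau_one_apply i)
    rw [hd] at h6
    have h0 : contrAssoc e 0 i = 0 := by
      fin_cases i <;> simp [contrAssoc]
    have h7 := h0.symm.trans h6
    change (τ x).τ₁ ![e i] = 0
    linarith
  rw [hd] at ht
  obtain ⟨h0, h3⟩ := ht.eq_zero_of_d_form_eq_zero h1
  simp [h0, h1, h3]

/-- The class `W₁ ⊕ W₂₇` is the largest torsion class all of whose coassociative `4`-folds are
minimal. -/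
theorem isGreatest_coassociativesMinimal : IsGreatest {E : Set TorsionModule |
    ∀ (M : Type) [TopologicalSpace M] [ChartedSpace (Euc 7) M] [IsManifold (𝓡 7) ∞ M]
      [T2Space M] [SecondCountableTopology M] (φ : G2Structure M),
      φ.HasTorsionClass E → φ.CoassociativesMinimal} {.W1, .W27} := by
  constructor
  · intro M _ _ _ _ _ φ hφ
    exact φ.coassociativesMinimal_of_extD_eq_zero (φ.hasTorsionClass_iff.1 hφ)
  · intro E hE W hW
    cases W with
    | W1 => simp
    | W27 => simp
    -- A class admitting `W₇`, or in the next case `W₁₄`, contains the matching structure on `ℝ⁷`,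
    -- whose weights on the last four axes add up to `4`.
    | W7 =>
      refine absurd (hE (Euc 7) _ (G2Structure.hasTorsionClass_mono (Set.singleton_subset_iff.2 hW)
        hasTorsionClass_diagStructure_one)) (not_coassociativesMinimal_diagStructure (by norm_num))
    | W14 =>
      refine absurd (hE (Euc 7) _ (G2Structure.hasTorsionClass_mono (Set.singleton_subset_iff.2 hW)
        hasTorsionClass_diagStructure_closed))
        (not_coassociativesMinimal_diagStructure (by
          change (1 + 1 + 1 + 1 : ℝ) ≠ 0
          norm_num))

end Sharpness

end G2Geom
end

theorem theorem2p12 :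
    -- the torsion forms exist and are unique
    (∀ (M : Type*) [TopologicalSpace M] [ChartedSpace (G2Geom.Euc 7) M] [IsManifold (𝓡 7) ∞ M]
      (φ : G2Geom.G2Structure M), ∃! τ, φ.IsTorsion τ) ∧
    -- the mean curvature formula
    (∀ (M : Type*) [TopologicalSpace M] [ChartedSpace (G2Geom.Euc 7) M] [IsManifold (𝓡 7) ∞ M]
      (φ : G2Geom.G2Structure M)
      (S : Type*) [TopologicalSpace S] [ChartedSpace (G2Geom.Euc 4) S] [IsManifold (𝓡 4) ∞ S]
      (f : S → M), φ.IsCoassociativeImmersion f → ∀ τ, φ.IsTorsion τ → ∀ p : S,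
        φ.meanCurvature f p =
          (-4 : ℝ) • (φ.isG2 (f p)).sharp
              ((φ.isG2 (f p)).oneA (G2Geom.G2Structure.tangentPlane f p) (τ (f p)).τ₁)
            + (√6 / 3) • (φ.isG2 (f p)).natural (G2Geom.G2Structure.tangentPlane f p)
              ((φ.isG2 (f p)).twoA (G2Geom.G2Structure.tangentPlane f p) (τ (f p)).τ₂)) ∧
    -- the torsion class `W₁ ⊕ W₂₇` is the class of `G₂`-structures with `d∗φ = 0`
    (∀ (M : Type*) [TopologicalSpace M] [ChartedSpace (G2Geom.Euc 7) M] [IsManifold (𝓡 7) ∞ M]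
      (φ : G2Geom.G2Structure M),
        φ.HasTorsionClass {.W1, .W27} ↔ ∀ x, G2Geom.extD φ.coassoc x = 0) ∧
    -- it is the largest torsion class all of whose coassociative `4`-folds are minimal
    IsGreatest {E : Set G2Geom.TorsionModule |
      ∀ (M : Type) [TopologicalSpace M] [ChartedSpace (G2Geom.Euc 7) M] [IsManifold (𝓡 7) ∞ M]
        [T2Space M] [SecondCountableTopology M] (φ : G2Geom.G2Structure M),
        φ.HasTorsionClass E → φ.CoassociativesMinimal} {.W1, .W27} := by
  refine ⟨fun M _ _ _ φ => φ.existsUnique_isTorsion, fun M _ _ _ φ S _ _ _ f hf τ hτ p => ?_,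
    fun M _ _ _ φ => φ.hasTorsionClass_iff, G2Geom.isGreatest_coassociativesMinimal⟩
  exact φ.meanCurvature_eq hf hτ p
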